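/- **Setting.** Let $\mathbb G=(V,E)$ be a locally finite, connected, non-oriented graph (loops allowed) with graph distance $d$ and closed balls $\mathbb B(x,r)$. Time is $[0,\infty)$ for the constant speed random walk (CSRW) and $\mathbb N=\{0,1,2,\dots\}$ for the discrete time random walk (DTRW). For each time $t$ let $\pi_t(x,y)=\pi_t(y,x)$ be conductances, strictly positive exactly on $E$ (Borel measurable in $t$ for each edge, for the CSRW), and put $\pi_t(x)=\sum_{y}\pi_t(x,y)$, $\pi_t(A)=\sum_{x\in A}\pi_t(x)$, $K_t(x,y)=\pi_t(x,y)/\pi_t(x)$. For the DTRW, $K_{s,s}=I$ and $K_{s,t}=K_{s+1}K_{s+2}\cdots K_t$. For the CSRW, $K_{s,t}(x,y)=\mathbb P(Y_t=y\mid Y_s=x)$, where $Y$ moves at each arrival time $T$ of a unit rate Poisson process according to $K_{T}$. Put $\mu_{s,t}(y)=\sum_x\pi_s(x)K_{s,t}(x,y)$. Assume that $t\mapsto\pi_t(x)$ is non-decreasing for each $x$, and *uniform volume growth* $v$ *with $v$ doubling*: $v$ is non-decreasing on $[0,\infty)$, $v(0)=v(1)=1$, $v(2r)\le C_{\mathsf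 v}v(r)$, and $C_{\mathsf v}^{-1}\le \pi_t(\mathbb B(x,r))/v(r)\le C_{\mathsf v}$ for all $x\in V$ and $r,t\ge0$. For the DTRW assume also that it is *uniformly lazy*: $K_t(x,x)\ge\alpha_l>0$ for all $t,x$. **(a)** Let $I(r)=r^2$ on $[0,1]$ and, for $r>1$, $I(r)=r(\log r+1)$ for the CSRW and $I(r)=\infty$ for the DTRW. Suppose the *uniform Poincaré inequality* holds: for all $f:V\to\mathbb R$, $x_0\in V$, $t,r\ge0$, $$\inf_{f_\star\in\mathbb R}\sum_{x\in\mathbb B(x_0,r)}|f(x)-f_\star|^2\pi_t(x)\le C_{\mathsf P}\,r^2\sum_{x,y\in\mathbb B(x_0,2r)}(f(x)-f(y))^2K_t(x,y)\pi_t(x).$$ Then for some finite $C>0$, depending only on $C_{\mathsf P},C_{\mathsf v}$ (and on $\alpha_l$ for the DTRW), $$K_{s,t}(x,y)\le\frac{C}{v(\sqrt{t-s})}\exp\Big\{-\frac{t-s}{C}\,I\Big(\frac{d(x,y)}{t-s}\Big)\Big\}\qquad\forall x,y\in V,\ t\ge s\ge0,\tag{1}$$ where for $t=s$ the exponential means its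 limit as $t\downarrow s$, namely $\mathbf 1_{\{x=y\}}$. **(b)** The *parabolic Harnack inequality* (PHI) with constants $\gamma(\theta_1,\dots,\theta_4)\in(0,1)$ says: for all $0<\theta_1\le\theta_2<\theta_3\le\theta_4$, all $z\in V$, $R>0$, $T\ge(\theta_4R)^2$, every solution $u\ge0$ of the backward heat equation $\partial_{-s}u(s,x)=\sum_yK_s(x,y)u(s,y)-u(s,x)$ on $[T-(\theta_4R)^2,T]\times\mathbb B(z,8R)$, with non-negative values outside the cylinder, and all $x_1,x_2\in\mathbb B(z,R)$, $$(\theta_1R)^2<\tau_1\le(\theta_2R)^2,\quad(\theta_3R)^2<\tau_2\le(\theta_4R)^2\quad\Longrightarrow\quad u(T-\tau_2,x_2)\ge\gamma\,u(T-\tau_1,x_1).$$ For the CSRW, $s\mapsto u(s,x)$ is absolutely continuous and the equation holds for a.e. $s$. For the DTRW, $s,T,\tau_1,\tau_2$ are integers, $\partial_{-s}u(s,\cdot)=u(s-1,\cdot)-u(s,\cdot)$ and one requires also $\tau_2\ge\tau_1+d(x_1,x_2)$. Suppose that (1) holds with constant $C>0$ and that the PHI holds with constants $\gamma(\cdot)$.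 For the DTRW suppose also that the graphs are uniformly elliptic: for some $\bar\alpha>0$, $K_t(x,y)\ge\bar\alpha$ for all $t$ and all $(x,y)\in E$ (and also $K_t(x,x)\ge\bar\alpha$ for all $x$). Then all $\mu_{s,t}(y)$ are finite, and for some finite $C_\star>0$, depending only on $C,\gamma(\cdot),C_{\mathsf v}$ (and on $\bar\alpha$ for the DTRW), for all $t\ge s\ge0$ and $x,y\in V$ with $t-s\ge d(x,y)$, $$\frac{C_\star^{-1}\mu_{s,t}(y)}{v(\sqrt{t-s})}\exp\Big(-\frac{C_\star d(x,y)^2}{t-s}\Big)\le K_{s,t}(x,y)\le\frac{C_\star\,\mu_{s,t}(y)}{v(\sqrt{t-s})}\exp\Big(-\frac{d(x,y)^2}{C_\star(t-s)}\Big),$$ where the exponentials are $1$ when $t=s$. -/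

import Mathlib

open MeasureTheory Set

noncomputable section

namespace TimeVaryingWalk

/-! Time is indexed by `ι`, which is `ℝ` in continuous time and `ℕ` in discrete time; only times
`t ≥ 0` matter. The edge relation `E` may contain loops. The conductances are `c t x y`. -/

variable {V : Type*} {ι : Type*}

/-- Graph distance of the graph with edge relation `E` (loops do not affect it). -/
def gdist (E : V → V → Prop) (x y : V) : ℕ := (SimpleGraph.fromRel E).dist x y

/-- The closed ball of radius `r` for the graph distance. -/
def gball (E : V → V → Prop) (x : V) (r : ℝ) : Set V := {y | (gdist E x y : ℝ) ≤ r}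

/-- A locally finite, connected, non-oriented graph (loops allowed), with symmetric conductances
that are strictly positive exactly on the edges, at all times. -/
structure IsNetwork [Zero ι] [Preorder ι] (E : V → V → Prop) (c : ι → V → V → ℝ) : Prop where
  edge_symm : ∀ x y, E x y → E y x
  locallyFinite : ∀ x, {y | E x y}.Finite
  connected : (SimpleGraph.fromRel E).Connected
  cond_symm : ∀ t, 0 ≤ t → ∀ x y, c t x y = c t y x
  cond_pos : ∀ t, 0 ≤ t → ∀ x y, E x y → 0 < c t x y
  cond_zero : ∀ t, 0 ≤ t → ∀ x y, ¬ E x y → c t x y = 0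

/-- Vertex conductance `π(x) = ∑_y π(x,y)` of one conductance function (a loop counts once). -/
def vertexCond (a : V → V → ℝ) (x : V) : ℝ := ∑' y, a x y

/-- One-step transition probabilities `K(x,y) = π(x,y) / π(x)`. -/
def stepKernel (a : V → V → ℝ) (x y : V) : ℝ := a x y / vertexCond a x

/-- The measure `π(B(x,r))` of a ball. -/
def ballVol (E : V → V → Prop) (a : V → V → ℝ) (x : V) (r : ℝ) : ℝ :=
  ∑' y : gball E x r, vertexCond a y

/-- The vertex conductances are pointwise non-decreasing in time. -/
def MonotoneVertexCond [Zero ι] [Preorder ι] (c : ι → V → V → ℝ) : Prop :=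
  ∀ x, MonotoneOn (fun t => vertexCond (c t) x) (Ici 0)

/-- Uniform volume growth `v(r)` with `v(r)` doubling, with constant `Cv`. -/
structure UniformVolumeGrowth [Zero ι] [Preorder ι] (E : V → V → Prop) (c : ι → V → V → ℝ)
    (v : ℝ → ℝ) (Cv : ℝ) : Prop where
  lower : ∀ t, 0 ≤ t → ∀ x r, 0 ≤ r → Cv⁻¹ ≤ ballVol E (c t) x r / v r
  upper : ∀ t, 0 ≤ t → ∀ x r, 0 ≤ r → ballVol E (c t) x r / v r ≤ Cv
  mono : MonotoneOn v (Ici 0)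
  doubling : ∀ r, 0 ≤ r → v (2 * r) ≤ Cv * v r
  v_zero : v 0 = 1
  v_one : v 1 = 1

/-- The uniform Poincaré inequality with constant `CP`. -/
def UniformPoincare [Zero ι] [Preorder ι] (E : V → V → Prop) (c : ι → V → V → ℝ) (CP : ℝ) :
    Prop :=
  ∀ (f : V → ℝ) (x₀ : V) (t : ι) (r : ℝ), 0 ≤ t → 0 ≤ r →
    (⨅ a : ℝ, ∑' x : gball E x₀ r, |f x - a| ^ 2 * vertexCond (c t) x) ≤
      CP * r ^ 2 * ∑' x : gball E x₀ (2 * r), ∑' y : gball E x₀ (2 * r),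
        (f x - f y) ^ 2 * stepKernel (c t) x y * vertexCond (c t) x

/-- The kernels are uniformly lazy: `K_t(x,x) ≥ α` for all `t`, `x`. -/
def UniformlyLazy [Zero ι] [Preorder ι] (c : ι → V → V → ℝ) (α : ℝ) : Prop :=
  ∀ t, 0 ≤ t → ∀ x, α ≤ stepKernel (c t) x x

/-- The weighted graphs are uniformly elliptic: `K_t(x,y) ≥ α` for all `t` and all edges. -/
def UniformlyElliptic [Zero ι] [Preorder ι] (E : V → V → Prop) (c : ι → V → V → ℝ) (α : ℝ) :
    Prop :=
  ∀ t, 0 ≤ t → ∀ x y, E x y → α ≤ stepKernel (c t) x y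

/-! ### The two dynamics -/

open scoped Classical in
/-- `k`-step transition probabilities of the discrete time walk started at time `s`, given by
`K_{s,s} = I` and `K_{s,n} = K_{s+1} K_{s+1,n}`. -/
def dtrwSteps (c : ℕ → V → V → ℝ) : ℕ → ℕ → V → V → ℝ
  | 0, _, x, z => if x = z then 1 else 0
  | k + 1, s, x, z => ∑' y, stepKernel (c (s + 1)) x y * dtrwSteps c k (s + 1) y z

/-- Transition probabilities `K_{s,t}(x,z)`, `s ≤ t`, of the discrete time random walk. -/
def dtrwKernel (c : ℕ → V → V → ℝ) (s t : ℕ) (x z : V) : ℝ := dtrwSteps c (t - s) s x z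

open scoped Classical in
/-- For the constant speed walk `Y`, which at each arrival time `T` of a unit rate Poisson process
moves according to `K_T`: the probability, given `Y_s = x`, that there are exactly `n` arrivals
during `(s,t]` and that `Y_t = z`. The recursion is over the first arrival time `ξ` after `s`. -/
def csrwPart (c : ℝ → V → V → ℝ) (t : ℝ) (z : V) : ℕ → ℝ → V → ℝ
  | 0, s, x => if x = z then Real.exp (-(t - s)) else 0
  | n + 1, s, x => ∫ ξ in s..t,
      Real.exp (-(ξ - s)) * ∑' y, stepKernel (c ξ) x y * csrwPart c t z n ξ y

/-- Transition probabilities `K_{s,t}(x,z) = P(Y_t = z | Y_s = x)`, `s ≤ t`, of the constant speed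
random walk: the sum over the number of Poisson arrivals during `(s,t]`. -/
def csrwKernel (c : ℝ → V → V → ℝ) (s t : ℝ) (x z : V) : ℝ := ∑' n, csrwPart c t z n s x

/-- The evolving measure `μ_{s,t}(y) = ∑_x π_s(x) K_{s,t}(x,y)`, for transition probabilities
`K`. -/
def evolMeasure (c : ι → V → V → ℝ) (K : ι → ι → V → V → ℝ) (s t : ι) (y : V) : ℝ :=
  ∑' x, vertexCond (c s) x * K s t x y

/-! ### The Gaussian upper bound -/

/-- `I(r)` for the constant speed walk. -/
def rateCSRW (r : ℝ) : EReal :=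
  if r ≤ 1 then ((r ^ 2 : ℝ) : EReal) else ((r * (Real.log r + 1) : ℝ) : EReal)

/-- `I(r)` for the discrete time walk. -/
def rateDTRW (r : ℝ) : EReal := if r ≤ 1 then ((r ^ 2 : ℝ) : EReal) else ⊤

/-- `exp (-(τ / C) I(d / τ))`, and its limit as `τ ↓ 0` when `τ = 0`. -/
def decayFactor (I : ℝ → EReal) (C τ : ℝ) (d : ℕ) : ℝ :=
  if τ = 0 then (if d = 0 then 1 else 0)
  else (EReal.exp (-(((τ / C : ℝ) : EReal) * I (d / τ)))).toReal

/-- The Gaussian upper bound (without the evolving measure) with constant `C`, constant speed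
walk. -/
def UpperBoundCSRW (E : V → V → Prop) (c : ℝ → V → V → ℝ) (v : ℝ → ℝ) (C : ℝ) : Prop :=
  ∀ (s t : ℝ) (x y : V), 0 ≤ s → s ≤ t →
    csrwKernel c s t x y ≤
      C / v (Real.sqrt (t - s)) * decayFactor rateCSRW C (t - s) (gdist E x y)

/-- The Gaussian upper bound (without the evolving measure) with constant `C`, discrete time
walk. -/
def UpperBoundDTRW (E : V → V → Prop) (c : ℕ → V → V → ℝ) (v : ℝ → ℝ) (C : ℝ) : Prop :=
  ∀ (s t : ℕ) (x y : V), s ≤ t →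
    dtrwKernel c s t x y ≤
      C / v (Real.sqrt ((t : ℝ) - s)) * decayFactor rateDTRW C ((t : ℝ) - s) (gdist E x y)

/-! ### The parabolic Harnack inequality -/

/-- `u ≥ 0` solves the backward heat equation `∂_{-s} u = K_s u - u` of the constant speed walk on
the time-space cylinder `[t₁,t₂] × B(z,R)`. -/
structure IsSolutionCSRW (E : V → V → Prop) (c : ℝ → V → V → ℝ) (t₁ t₂ : ℝ) (z : V) (R : ℝ)
    (u : ℝ → V → ℝ) : Prop where
  nonneg : ∀ s ∈ Icc t₁ t₂, ∀ x, 0 ≤ u s x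
  absCont : ∀ x, AbsolutelyContinuousOnInterval (fun s => u s x) t₁ t₂
  equation : ∀ x ∈ gball E z R, ∀ᵐ s ∂(volume.restrict (Icc t₁ t₂)),
    HasDerivAt (fun r => u r x) (-((∑' y, stepKernel (c s) x y * u s y) - u s x)) s

/-- `u ≥ 0` solves the backward heat equation `u(s-1,·) = K_s u(s,·)` of the discrete time walk on
the time-space cylinder `[t₁,t₂] × B(z,R)`. -/
structure IsSolutionDTRW (E : V → V → Prop) (c : ℕ → V → V → ℝ) (t₁ t₂ : ℝ) (z : V) (R : ℝ)
    (u : ℕ → V → ℝ) : Prop where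
  nonneg : ∀ s : ℕ, t₁ ≤ s → (s : ℝ) ≤ t₂ → ∀ x, 0 ≤ u s x
  equation : ∀ s : ℕ, t₁ ≤ s → ((s + 1 : ℕ) : ℝ) ≤ t₂ → ∀ x ∈ gball E z R,
    u s x = ∑' y, stepKernel (c (s + 1)) x y * u (s + 1) y

/-- The parabolic Harnack inequality for the constant speed walk, with constants
`γ(θ₁,θ₂,θ₃,θ₄) ∈ (0,1)`. -/
def HarnackCSRW (E : V → V → Prop) (c : ℝ → V → V → ℝ) (γ : ℝ → ℝ → ℝ → ℝ → ℝ) : Prop :=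
  ∀ θ₁ θ₂ θ₃ θ₄ : ℝ, 0 < θ₁ → θ₁ ≤ θ₂ → θ₂ < θ₃ → θ₃ ≤ θ₄ →
    γ θ₁ θ₂ θ₃ θ₄ ∈ Ioo (0 : ℝ) 1 ∧
    ∀ (R T : ℝ) (z : V) (u : ℝ → V → ℝ), 0 < R → (θ₄ * R) ^ 2 ≤ T →
      IsSolutionCSRW E c (T - (θ₄ * R) ^ 2) T z (8 * R) u →
      ∀ τ₁ τ₂ : ℝ, (θ₁ * R) ^ 2 < τ₁ → τ₁ ≤ (θ₂ * R) ^ 2 →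
        (θ₃ * R) ^ 2 < τ₂ → τ₂ ≤ (θ₄ * R) ^ 2 →
        ∀ x₁ ∈ gball E z R, ∀ x₂ ∈ gball E z R,
          γ θ₁ θ₂ θ₃ θ₄ * u (T - τ₁) x₁ ≤ u (T - τ₂) x₂

/-- The parabolic Harnack inequality for the discrete time walk, with constants
`γ(θ₁,θ₂,θ₃,θ₄) ∈ (0,1)`; here `T`, `τ₁`, `τ₂` are integers and `τ₂ ≥ τ₁ + d(x₁,x₂)`. -/
def HarnackDTRW (E : V → V → Prop) (c : ℕ → V → V → ℝ) (γ : ℝ → ℝ → ℝ → ℝ → ℝ) : Prop :=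
  ∀ θ₁ θ₂ θ₃ θ₄ : ℝ, 0 < θ₁ → θ₁ ≤ θ₂ → θ₂ < θ₃ → θ₃ ≤ θ₄ →
    γ θ₁ θ₂ θ₃ θ₄ ∈ Ioo (0 : ℝ) 1 ∧
    ∀ (R : ℝ) (T : ℕ) (z : V) (u : ℕ → V → ℝ), 0 < R → (θ₄ * R) ^ 2 ≤ T →
      IsSolutionDTRW E c (T - (θ₄ * R) ^ 2) T z (8 * R) u →
      ∀ τ₁ τ₂ : ℕ, (θ₁ * R) ^ 2 < τ₁ → (τ₁ : ℝ) ≤ (θ₂ * R) ^ 2 →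
        (θ₃ * R) ^ 2 < τ₂ → (τ₂ : ℝ) ≤ (θ₄ * R) ^ 2 →
        ∀ x₁ ∈ gball E z R, ∀ x₂ ∈ gball E z R, τ₁ + gdist E x₁ x₂ ≤ τ₂ →
          γ θ₁ θ₂ θ₃ θ₄ * u (T - τ₁) x₁ ≤ u (T - τ₂) x₂

/-! ### The two-sided Gaussian estimate -/

/-- With the evolving measure value `m = μ_{s,t}(y)`, `τ = t - s`, `d = d(x,y)` and
`k = K_{s,t}(x,y)`, the two-sided Gaussian bound on `k` with constant `C`. -/
def TwoSided (v : ℝ → ℝ) (C τ : ℝ) (d : ℕ) (m k : ℝ) : Prop :=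
  C⁻¹ * m / v (Real.sqrt τ) * Real.exp (-(C * (d : ℝ) ^ 2 / τ)) ≤ k ∧
    k ≤ C * m / v (Real.sqrt τ) * Real.exp (-((d : ℝ) ^ 2 / (C * τ)))

/-- Two-sided Gaussian heat kernel estimates with constant `C`, constant speed walk: the evolving
measures are finite and the bounds hold whenever `t - s ≥ d(x,y)`. -/
def TwoSidedCSRW (E : V → V → Prop) (c : ℝ → V → V → ℝ) (v : ℝ → ℝ) (C : ℝ) : Prop :=
  ∀ (s t : ℝ) (y : V), 0 ≤ s → s ≤ t →
    Summable (fun x => vertexCond (c s) x * csrwKernel c s t x y) ∧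
    ∀ x : V, (gdist E x y : ℝ) ≤ t - s →
      TwoSided v C (t - s) (gdist E x y) (evolMeasure c (csrwKernel c) s t y)
        (csrwKernel c s t x y)

/-- Two-sided Gaussian heat kernel estimates with constant `C`, discrete time walk: the evolving
measures are finite and the bounds hold whenever `t - s ≥ d(x,y)`. -/
def TwoSidedDTRW (E : V → V → Prop) (c : ℕ → V → V → ℝ) (v : ℝ → ℝ) (C : ℝ) : Prop :=
  ∀ (s t : ℕ) (y : V), s ≤ t →
    Summable (fun x => vertexCond (c s) x * dtrwKernel c s t x y) ∧
    ∀ x : V, (gdist E x y : ℝ) ≤ (t : ℝ) - s →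
      TwoSided v C ((t : ℝ) - s) (gdist E x y) (evolMeasure c (dtrwKernel c) s t y)
        (dtrwKernel c s t x y)

/-! ### Standing assumptions -/

/-- Standing assumptions for the constant speed walk: Borel measurable time-varying conductances,
non-decreasing vertex conductances, uniform volume growth `v` with `v` doubling. -/
structure StandingCSRW (E : V → V → Prop) (c : ℝ → V → V → ℝ) (v : ℝ → ℝ) (Cv : ℝ) : Prop where
  network : IsNetwork E c
  measurable : ∀ x y, Measurable (fun t : Ici (0 : ℝ) => c t x y)
  monotone : MonotoneVertexCond c
  growth : UniformVolumeGrowth E c v Cv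

/-- Standing assumptions for the discrete time walk: non-decreasing vertex conductances, uniform
volume growth `v` with `v` doubling, uniform laziness with constant `αl`. -/
structure StandingDTRW (E : V → V → Prop) (c : ℕ → V → V → ℝ) (v : ℝ → ℝ) (Cv αl : ℝ) :
    Prop where
  network : IsNetwork E c
  monotone : MonotoneVertexCond c
  growth : UniformVolumeGrowth E c v Cv
  lazy : UniformlyLazy c αl

end TimeVaryingWalk

end

namespace TimeVaryingWalk

/-! ### Graph distance and weighted snapshots -/

/-! Part (a) is Nash's method with exponential weights, run against a moving reference measure. For
a lazy discrete walk there are two natural sequences: the functions `K_{t-k,t}(·, z)`, and the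
densities of the laws `K_{s,s+k}(x, ·)` with respect to `π_{s+k+1}`. Each passes to its successor by
one step of a reversible kernel followed by a change of reference measure. As `π_t` is
non-decreasing, that change never increases the `L¹` mass or the `L²` norm, in either direction of
time. `Chain` records exactly this, so one argument serves both.

Poincaré inequalities, averaged over all centres, give the Nash inequality `‖f‖₂² ≤ C r² E(f) + C
‖f‖₁² / v(r)` (`nash`). Laziness makes every step lose a multiple of the energy (`step_energy`),
whence `‖f_n‖₂² ≤ D / v(√n)` (`nash_decay`). In the norm weighted by `exp (2 l d(o, ·))` a step
costs only a factor `exp (C l²)` (`step_weight`). Interpolating at time `n / 4` between the rates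
`0` and `2 l` upgrades this to `C exp (C l² n) / v(√n)` (`chain_gaussian`). Cauchy–Schwarz at the
middle time joins a forward and a backward chain (`dtrwSteps_le`), and `l` is optimised at the end.

The constant speed walk is also the walk of rate `2` with kernels `(K + I) / 2`, that is, a Poisson
mixture of lazy discrete walks along its jump times. The discrete bounds are uniform over all
monotone sequences of jump times (`sum_dtrwSteps_mul_csrwKernel_le`). Summing them against Poisson
weights gives the Gaussian regime, and a Chernoff bound gives the tail `d log (d / τ)`
(`csrwKernel_bounds`).

For part (b) both walks are instances of `WalkFamily`. Averaging the Harnack inequality over balls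
shows that `μ_{s,t}(y)` changes by a bounded factor between comparable times, and that `K_{m,t}(·,
y)` is at most a multiple of `μ_{s,t}(y) / v` (`doubling`). The interpolation argument, now
normalised by `μ`, shows that the evolving measure is concentrated around `y` on the parabolic scale
(`evol_moment`). The upper bound follows by Cauchy–Schwarz at the middle time (`family_upper`). For
the lower bound, half of the mass lies within a multiple of `√τ` of `y`, and the Harnack inequality
carries it to `y` (`family_diag`); a Harnack chain along a geodesic then reaches the other vertices
(`harnack_chain`, `family_lower`). Short times, and distances comparable to the elapsed time, need
only the crude bound `exp (-CF (1 + τ))`. -/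

theorem gdist_self {V : Type*} (E : V → V → Prop) (x : V) : gdist E x x = 0 :=
  SimpleGraph.dist_self

theorem gdist_comm {V : Type*} (E : V → V → Prop) (x y : V) : gdist E x y = gdist E y x :=
  SimpleGraph.dist_comm

/-- A graph with one time-independent set of conductances, of volume growth `v`. -/
structure Snapshot {V : Type*} (E : V → V → Prop) (v : ℝ → ℝ) (Cv : ℝ) (a : V → V → ℝ) :
    Prop where
  edge_symm : ∀ x y, E x y → E y x
  locallyFinite : ∀ x, {y | E x y}.Finite
  connected : (SimpleGraph.fromRel E).Connected
  symm : ∀ x y, a x y = a y x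
  nonneg : ∀ x y, 0 ≤ a x y
  zero : ∀ x y, ¬ E x y → a x y = 0
  lower : ∀ x r, 0 ≤ r → Cv⁻¹ ≤ ballVol E a x r / v r
  upper : ∀ x r, 0 ≤ r → ballVol E a x r / v r ≤ Cv
  mono : MonotoneOn v (Ici 0)
  doubling : ∀ r, 0 ≤ r → v (2 * r) ≤ Cv * v r
  v_zero : v 0 = 1
  v_one : v 1 = 1

theorem snapshot_of_network {V ι : Type*} [Zero ι] [Preorder ι] {E : V → V → Prop}
    {c : ι → V → V → ℝ} {v : ℝ → ℝ} {Cv : ℝ} (hN : IsNetwork E c)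
    (hG : UniformVolumeGrowth E c v Cv) {t : ι} (ht : 0 ≤ t) : Snapshot E v Cv (c t) where
  edge_symm := hN.edge_symm
  locallyFinite := hN.locallyFinite
  connected := hN.connected
  symm := hN.cond_symm t ht
  nonneg x y := by
    by_cases h : E x y
    · exact (hN.cond_pos t ht x y h).le
    · exact (hN.cond_zero t ht x y h).ge
  zero := hN.cond_zero t ht
  lower := hG.lower t ht
  upper := hG.upper t ht
  mono := hG.mono
  doubling := hG.doubling
  v_zero := hG.v_zero
  v_one := hG.v_one

section Graph

variable {V : Type*} {E : V → V → Prop}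

theorem gdist_triangle (hE : (SimpleGraph.fromRel E).Connected) (x y z : V) :
    gdist E x z ≤ gdist E x y + gdist E y z := hE.dist_triangle

theorem gdist_eq_zero (hE : (SimpleGraph.fromRel E).Connected) {x y : V} :
    gdist E x y = 0 ↔ x = y := hE.dist_eq_zero_iff

theorem gdist_le_one {x y : V} (h : E x y) : gdist E x y ≤ 1 := by
  by_cases hxy : x = y
  · subst hxy; simp [gdist_self]
  · have : (SimpleGraph.fromRel E).Adj x y := by simp [hxy, h]
    exact (SimpleGraph.dist_eq_one_iff_adj.2 this).le

theorem gdist_le_add_one (hE : (SimpleGraph.fromRel E).Connected) {x y : V} (h : E x y) (z : V) :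
    gdist E x z ≤ gdist E y z + 1 := by
  have := gdist_triangle hE x y z
  have := gdist_le_one h
  omega

/-- A first step of a geodesic. -/
theorem exists_step (hE : (SimpleGraph.fromRel E).Connected) (hs : ∀ x y, E x y → E y x)
    {x y : V} {k : ℕ} (h : gdist E x y = k + 1) :
    ∃ z, E x z ∧ gdist E x z = 1 ∧ gdist E z y = k := by
  obtain ⟨p, hp⟩ := hE.exists_walk_length_eq_dist x y
  cases p with
  | nil => simp [gdist] at h
  | @cons _ z _ hadj q =>
    have h1 : gdist E x z = 1 := SimpleGraph.dist_eq_one_iff_adj.2 hadj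
    refine ⟨z, ?_, h1, ?_⟩
    · rw [SimpleGraph.fromRel_adj] at hadj
      exact hadj.2.elim id (hs _ _)
    · have h2 : gdist E z y ≤ q.length := SimpleGraph.dist_le q
      have h3 := gdist_triangle hE x z y
      simp only [SimpleGraph.Walk.length_cons] at hp
      unfold gdist at *
      omega

/-- An intermediate point of a geodesic. -/
theorem exists_between (hE : (SimpleGraph.fromRel E).Connected) (hs : ∀ x y, E x y → E y x)
    (l : ℕ) : ∀ {x y : V}, l ≤ gdist E x y →
    ∃ z, gdist E x z = l ∧ gdist E z y = gdist E x y - l := by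
  induction l with
  | zero => intro x y _; exact ⟨x, gdist_self E x, by simp⟩
  | succ l ih =>
    intro x y h
    obtain ⟨z, h1, h2⟩ := ih (by omega : l ≤ gdist E x y)
    obtain ⟨w, -, h3, h4⟩ := exists_step hE hs
      (show gdist E z y = (gdist E x y - l - 1) + 1 by omega)
    refine ⟨w, ?_, by omega⟩
    have := gdist_triangle hE x z w
    have := gdist_triangle hE x w y
    omega

theorem finite_nat_ball (hE : (SimpleGraph.fromRel E).Connected) (hs : ∀ x y, E x y → E y x)
    (hf : ∀ x, {y | E x y}.Finite) (n : ℕ) : ∀ x : V, {y | gdist E x y ≤ n}.Finite := by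
  induction n with
  | zero =>
    intro x
    refine (finite_singleton x).subset fun y hy => ?_
    simp only [mem_ofPred_eq, Nat.le_zero] at hy
    exact ((gdist_eq_zero hE).1 hy).symm
  | succ n ih =>
    intro x
    refine ((finite_singleton x).union ((hf x).biUnion fun z _ => ih z)).subset fun y hy => ?_
    simp only [mem_ofPred_eq] at hy
    rcases Nat.eq_zero_or_pos (gdist E x y) with h0 | h0
    · exact Or.inl ((gdist_eq_zero hE).1 h0).symm
    · obtain ⟨z, h1, -, h3⟩ := exists_step hE hs
        (show gdist E x y = (gdist E x y - 1) + 1 by omega)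
      exact Or.inr (mem_biUnion h1 (by simp only [mem_ofPred_eq]; omega))

theorem finite_gball (hE : (SimpleGraph.fromRel E).Connected) (hs : ∀ x y, E x y → E y x)
    (hf : ∀ x, {y | E x y}.Finite) (x : V) (r : ℝ) : (gball E x r).Finite := by
  refine (finite_nat_ball hE hs hf ⌊r⌋₊ x).subset fun y hy => ?_
  exact Nat.le_floor hy

end Graph

namespace Snapshot

variable {V : Type*} {E : V → V → Prop} {v : ℝ → ℝ} {Cv : ℝ} {a : V → V → ℝ}

/-- The closed ball as a finite set. -/
noncomputable def ball (h : Snapshot E v Cv a) (x : V) (r : ℝ) : Finset V :=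
  (finite_gball h.connected h.edge_symm h.locallyFinite x r).toFinset

/-- The neighbours of a vertex. -/
noncomputable def nbrs (h : Snapshot E v Cv a) (x : V) : Finset V := (h.locallyFinite x).toFinset

variable (h : Snapshot E v Cv a)
include h

theorem mem_ball {x y : V} {r : ℝ} : y ∈ h.ball x r ↔ (gdist E x y : ℝ) ≤ r := by
  simp [ball, gball]

theorem mem_nbrs {x y : V} : y ∈ h.nbrs x ↔ E x y := by simp [nbrs]

theorem tsum_gball (f : V → ℝ) (x : V) (r : ℝ) :
    ∑' y : gball E x r, f y = ∑ y ∈ h.ball x r, f y := by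
  have : gball E x r = ↑(h.ball x r) := by simp [ball]
  rw [this]
  exact Finset.tsum_subtype _ _

theorem ballVol_eq (x : V) (r : ℝ) : ballVol E a x r = ∑ y ∈ h.ball x r, vertexCond a y :=
  h.tsum_gball _ x r

theorem tsum_row {F : V → ℝ} (x : V) (hF : ∀ y, ¬ E x y → F y = 0) :
    ∑' y, F y = ∑ y ∈ h.nbrs x, F y :=
  tsum_eq_sum fun y hy => hF y fun hE => hy (h.mem_nbrs.2 hE)

theorem summable_row {F : V → ℝ} (x : V) (hF : ∀ y, ¬ E x y → F y = 0) : Summable F :=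
  summable_of_ne_finset_zero (s := h.nbrs x) fun y hy => hF y fun hE => hy (h.mem_nbrs.2 hE)

theorem vertexCond_eq (x : V) : vertexCond a x = ∑ y ∈ h.nbrs x, a x y :=
  h.tsum_row x (h.zero x)

theorem one_le : 1 ≤ Cv := by
  have := h.doubling 0 le_rfl
  simpa [h.v_zero] using this

theorem Cv_pos : 0 < Cv := one_pos.trans_le h.one_le

theorem one_le_v {r : ℝ} (hr : 0 ≤ r) : 1 ≤ v r := by
  rw [← h.v_zero]; exact h.mono (mem_Ici.2 le_rfl) hr hr

theorem v_pos {r : ℝ} (hr : 0 ≤ r) : 0 < v r := one_pos.trans_le (h.one_le_v hr)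

theorem v_mono {r r' : ℝ} (hr : 0 ≤ r) (hrr : r ≤ r') : v r ≤ v r' :=
  h.mono hr (hr.trans hrr) hrr

theorem v_eq_one {r : ℝ} (hr : 0 ≤ r) (hr1 : r ≤ 1) : v r = 1 :=
  le_antisymm (h.v_one ▸ h.v_mono hr hr1) (h.one_le_v hr)

theorem vol_le (x : V) {r : ℝ} (hr : 0 ≤ r) :
    ∑ y ∈ h.ball x r, vertexCond a y ≤ Cv * v r := by
  rw [← h.ballVol_eq]
  have := h.upper x r hr
  rwa [div_le_iff₀ (h.v_pos hr)] at this

theorem le_vol (x : V) {r : ℝ} (hr : 0 ≤ r) :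
    Cv⁻¹ * v r ≤ ∑ y ∈ h.ball x r, vertexCond a y := by
  rw [← h.ballVol_eq]
  have := h.lower x r hr
  rwa [le_div_iff₀ (h.v_pos hr)] at this

theorem ball_zero (x : V) : h.ball x 0 = {x} := by
  ext y
  rw [h.mem_ball, Finset.mem_singleton]
  constructor
  · intro hy
    exact ((gdist_eq_zero h.connected).1 (by exact_mod_cast le_antisymm hy (by positivity))).symm
  · rintro rfl; simp [gdist_self]

/-- A ball of radius `0` is a single vertex and `v 0 = 1`, so volume growth pins every vertex
conductance between `Cv⁻¹` and `Cv`. Hence `π` at any two times, and counting measure, agree up to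
constants. -/
theorem vertexCond_le (x : V) : vertexCond a x ≤ Cv := by
  have := h.vol_le x le_rfl
  simpa [h.ball_zero, h.v_zero] using this

theorem le_vertexCond (x : V) : Cv⁻¹ ≤ vertexCond a x := by
  have := h.le_vol x le_rfl
  simpa [h.ball_zero, h.v_zero] using this

theorem vertexCond_pos (x : V) : 0 < vertexCond a x :=
  (inv_pos.2 h.Cv_pos).trans_le (h.le_vertexCond x)

theorem one_le_mul_vertexCond (x : V) : 1 ≤ Cv * vertexCond a x := by
  have := mul_le_mul_of_nonneg_left (h.le_vertexCond x) h.Cv_pos.le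
  rwa [mul_inv_cancel₀ h.Cv_pos.ne'] at this

theorem stepKernel_nonneg (x y : V) : 0 ≤ stepKernel a x y :=
  div_nonneg (h.nonneg x y) (h.vertexCond_pos x).le

theorem stepKernel_zero {x y : V} (hxy : ¬ E x y) : stepKernel a x y = 0 := by
  simp [stepKernel, h.zero x y hxy]

theorem vertexCond_mul_stepKernel (x y : V) : vertexCond a x * stepKernel a x y = a x y :=
  mul_div_cancel₀ _ (h.vertexCond_pos x).ne'

theorem sum_stepKernel (x : V) : ∑ y ∈ h.nbrs x, stepKernel a x y = 1 := by
  simp only [stepKernel, ← Finset.sum_div, ← h.vertexCond_eq]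
  exact div_self (h.vertexCond_pos x).ne'

theorem stepKernel_le_one (x y : V) : stepKernel a x y ≤ 1 := by
  by_cases hxy : E x y
  · rw [← h.sum_stepKernel x]
    exact Finset.single_le_sum (f := fun y => stepKernel a x y)
      (fun z _ => h.stepKernel_nonneg x z) (h.mem_nbrs.2 hxy)
  · rw [h.stepKernel_zero hxy]; exact zero_le_one

theorem tsum_stepKernel_mul (x : V) (f : V → ℝ) :
    ∑' y, stepKernel a x y * f y = ∑ y ∈ h.nbrs x, stepKernel a x y * f y :=
  h.tsum_row x fun y hy => by rw [h.stepKernel_zero hy, zero_mul]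

theorem v_two_pow_mul (k : ℕ) {r : ℝ} (hr : 0 ≤ r) : v (2 ^ k * r) ≤ Cv ^ k * v r := by
  induction k with
  | zero => simp
  | succ k ih =>
    calc v (2 ^ (k + 1) * r) = v (2 * (2 ^ k * r)) := by ring_nf
      _ ≤ Cv * v (2 ^ k * r) := h.doubling _ (by positivity)
      _ ≤ Cv * (Cv ^ k * v r) := mul_le_mul_of_nonneg_left ih h.Cv_pos.le
      _ = _ := by ring

theorem v_le_of_le_two_pow_mul (k : ℕ) {r r' : ℝ} (hr : 0 ≤ r) (hr' : 0 ≤ r')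
    (hle : r' ≤ 2 ^ k * r) : v r' ≤ Cv ^ k * v r :=
  (h.v_mono hr' hle).trans (h.v_two_pow_mul k hr)

theorem v_le_pow (k : ℕ) {r : ℝ} (hr : 0 ≤ r) (hle : r ≤ 2 ^ k) : v r ≤ Cv ^ k := by
  have := h.v_le_of_le_two_pow_mul k zero_le_one hr (by simpa using hle)
  rwa [h.v_one, mul_one] at this

end Snapshot

end TimeVaryingWalk

/-! ### From the Poincaré inequality to a Nash inequality, and the effect of one lazy step. -/

namespace TimeVaryingWalk

/-- The Poincaré inequality for one conductance function. -/
def PoincareAt {V : Type*} (E : V → V → Prop) (a : V → V → ℝ) (CP : ℝ) : Prop :=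
  ∀ (f : V → ℝ) (x₀ : V) (r : ℝ), 0 ≤ r →
    (⨅ b : ℝ, ∑' x : gball E x₀ r, |f x - b| ^ 2 * vertexCond a x) ≤
      CP * r ^ 2 * ∑' x : gball E x₀ (2 * r), ∑' y : gball E x₀ (2 * r),
        (f x - f y) ^ 2 * stepKernel a x y * vertexCond a x

theorem sum_le_sum_of_support {ι : Type*} {B T : Finset ι} {f : ι → ℝ} (h0 : ∀ x, 0 ≤ f x)
    (h1 : ∀ x ∈ B, x ∉ T → f x = 0) : ∑ x ∈ B, f x ≤ ∑ x ∈ T, f x := by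
  classical
  rw [← Finset.sum_subset (Finset.inter_subset_left : B ∩ T ⊆ B) fun x hx hx' =>
    h1 x hx fun hT => hx' (Finset.mem_inter.2 ⟨hx, hT⟩)]
  exact Finset.sum_le_sum_of_subset_of_nonneg Finset.inter_subset_right fun x _ _ => h0 x

namespace Snapshot

variable {V : Type*} {E : V → V → Prop} {v : ℝ → ℝ} {Cv : ℝ} {a : V → V → ℝ}

theorem mem_ball_comm (h : Snapshot E v Cv a) {x y : V} {r : ℝ} :
    y ∈ h.ball x r ↔ x ∈ h.ball y r := by
  rw [h.mem_ball, h.mem_ball, gdist_comm]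

/-- Integrating ball sums of a finitely supported function over all centres. -/
theorem hasSum_average (h : Snapshot E v Cv a) (T : Finset V) {g : V → ℝ}
    (hg : ∀ x, x ∉ T → g x = 0) (r : ℝ) :
    HasSum (fun x₀ => vertexCond a x₀ * ∑ x ∈ h.ball x₀ r, g x)
      (∑ x ∈ T, g x * ∑ z ∈ h.ball x r, vertexCond a z) := by
  classical
  have h1 : (fun x₀ => vertexCond a x₀ * ∑ x ∈ h.ball x₀ r, g x) =
      fun x₀ => ∑ x ∈ T, (if x₀ ∈ h.ball x r then g x * vertexCond a x₀ else 0) := by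
    funext x₀
    have : ∑ x ∈ h.ball x₀ r, g x = ∑ x ∈ T, if x ∈ h.ball x₀ r then g x else 0 := by
      rw [← Finset.sum_filter, Finset.filter_mem_eq_inter, Finset.inter_comm]
      refine (Finset.sum_subset Finset.inter_subset_left fun x hx hx' => hg x fun hT => ?_).symm
      exact hx' (Finset.mem_inter.2 ⟨hx, hT⟩)
    rw [this, Finset.mul_sum]
    refine Finset.sum_congr rfl fun x _ => ?_
    simp only [h.mem_ball_comm (x := x) (y := x₀), ite_mul, mul_comm (vertexCond a x₀), zero_mul]
  rw [h1]
  refine hasSum_sum fun x _ => ?_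
  rw [Finset.mul_sum]
  have h2 : ∑ z ∈ h.ball x r, g x * vertexCond a z =
      ∑ z ∈ h.ball x r, (if z ∈ h.ball x r then g x * vertexCond a z else 0) :=
    Finset.sum_congr rfl fun z hz => by rw [if_pos hz]
  rw [h2]
  exact hasSum_sum_of_ne_finset_zero fun z hz => by rw [if_neg hz]

/-- The infimum over constants in the Poincaré inequality is the variance, that is, the second
moment minus `M² / P` with `P` the volume of the ball; volume growth bounds `1 / P` by `Cv / v r`.
-/
theorem poincare_ball (h : Snapshot E v Cv a) {CP : ℝ} (hP : PoincareAt E a CP) (f : V → ℝ)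
    (x₀ : V) {r : ℝ} (hr : 0 ≤ r) :
    ∑ x ∈ h.ball x₀ r, vertexCond a x * f x ^ 2 ≤
      |CP| * r ^ 2 * ∑ x ∈ h.ball x₀ (2 * r), ∑ y ∈ h.nbrs x, a x y * (f y - f x) ^ 2 +
      Cv / v r * (∑ x ∈ h.ball x₀ r, vertexCond a x * f x) ^ 2 := by
  set B := h.ball x₀ r
  set A := ∑ x ∈ B, vertexCond a x * f x ^ 2
  set M := ∑ x ∈ B, vertexCond a x * f x
  set P := ∑ x ∈ B, vertexCond a x
  have hvr := h.v_pos hr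
  have hPl : Cv⁻¹ * v r ≤ P := h.le_vol x₀ hr
  have hPpos : 0 < P := (mul_pos (inv_pos.2 h.Cv_pos) hvr).trans_le hPl
  have hinf : A - M ^ 2 / P ≤ ⨅ b : ℝ, ∑' x : gball E x₀ r, |f x - b| ^ 2 * vertexCond a x := by
    refine le_ciInf fun b => ?_
    rw [h.tsum_gball (fun x => |f x - b| ^ 2 * vertexCond a x)]
    have : ∑ x ∈ B, |f x - b| ^ 2 * vertexCond a x = A - 2 * b * M + b ^ 2 * P := by
      simp only [A, M, P, Finset.mul_sum, ← Finset.sum_sub_distrib, ← Finset.sum_add_distrib]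
      refine Finset.sum_congr rfl fun x _ => ?_
      rw [sq_abs]; ring
    rw [this]
    -- Completing the square: the optimal constant is the mean `M / P`.
    have h2 : 0 ≤ (M / P - b) ^ 2 * P := by positivity
    have h3 : (M / P - b) ^ 2 * P = M ^ 2 / P - 2 * b * M + b ^ 2 * P := by
      field_simp
      ring
    linarith
  have hen : ∑' x : gball E x₀ (2 * r), ∑' y : gball E x₀ (2 * r),
        (f x - f y) ^ 2 * stepKernel a x y * vertexCond a x ≤
      ∑ x ∈ h.ball x₀ (2 * r), ∑ y ∈ h.nbrs x, a x y * (f y - f x) ^ 2 := by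
    rw [h.tsum_gball (fun x => ∑' y : gball E x₀ (2 * r),
        (f x - f y) ^ 2 * stepKernel a x y * vertexCond a x)]
    refine Finset.sum_le_sum fun x _ => ?_
    rw [h.tsum_gball (fun y => (f x - f y) ^ 2 * stepKernel a x y * vertexCond a x)]
    have h4 : ∀ y, (f x - f y) ^ 2 * stepKernel a x y * vertexCond a x =
        a x y * (f y - f x) ^ 2 := fun y => by
      rw [← h.vertexCond_mul_stepKernel x y]; ring
    simp only [h4]
    refine sum_le_sum_of_support (fun y => mul_nonneg (h.nonneg x y) (sq_nonneg _)) fun y _ hy => ?_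
    rw [h.zero x y fun hE => hy (h.mem_nbrs.2 hE), zero_mul]
  have hen0 : 0 ≤ ∑' x : gball E x₀ (2 * r), ∑' y : gball E x₀ (2 * r),
        (f x - f y) ^ 2 * stepKernel a x y * vertexCond a x :=
    tsum_nonneg fun x => tsum_nonneg fun y => mul_nonneg
      (mul_nonneg (sq_nonneg _) (h.stepKernel_nonneg _ _)) (h.vertexCond_pos _).le
  have hmain := hinf.trans (hP f x₀ r hr)
  have h5 : CP * r ^ 2 * ∑' x : gball E x₀ (2 * r), ∑' y : gball E x₀ (2 * r),
        (f x - f y) ^ 2 * stepKernel a x y * vertexCond a x ≤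
      |CP| * r ^ 2 * ∑ x ∈ h.ball x₀ (2 * r), ∑ y ∈ h.nbrs x, a x y * (f y - f x) ^ 2 :=
    mul_le_mul (mul_le_mul_of_nonneg_right (le_abs_self _) (sq_nonneg _)) hen hen0 (by positivity)
  have h6 : M ^ 2 / P ≤ Cv / v r * M ^ 2 := by
    rw [div_eq_mul_inv, mul_comm]
    refine mul_le_mul_of_nonneg_right ?_ (sq_nonneg _)
    rw [inv_le_comm₀ hPpos (div_pos h.Cv_pos hvr), inv_div]
    rwa [div_eq_inv_mul]
  linarith

/-- `f` vanishes at all vertices of `Tᶜ` and at their neighbours. -/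
def _root_.TimeVaryingWalk.Inner {V : Type*} (E : V → V → Prop) (T : Finset V) (f : V → ℝ) :
    Prop :=
  ∀ x, f x ≠ 0 → x ∈ T ∧ ∀ y, E x y → y ∈ T

theorem sum_nbrs_eq (h : Snapshot E v Cv a) {T : Finset V} {F : V → V → ℝ} {x : V}
    (hF : ∀ y, E x y → y ∉ T → F x y = 0) :
    ∑ y ∈ h.nbrs x, a x y * F x y = ∑ y ∈ T, a x y * F x y := by
  classical
  rw [← Finset.sum_filter_of_ne (s := T) (p := fun y => y ∈ h.nbrs x),
    Finset.filter_mem_eq_inter, Finset.inter_comm]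
  · refine (Finset.sum_subset Finset.inter_subset_left fun y hy hy' => ?_).symm
    rw [hF y (h.mem_nbrs.1 hy) fun hT => hy' (Finset.mem_inter.2 ⟨hy, hT⟩), mul_zero]
  · intro y _ hne
    rw [h.mem_nbrs]
    by_contra hE
    exact hne (by rw [h.zero x y hE, zero_mul])

theorem inner_eq_zero {T : Finset V} {f : V → ℝ} (hf : Inner E T f) {x : V} (hx : x ∉ T) :
    f x = 0 := by
  by_contra h0; exact hx (hf x h0).1

theorem inner_eq_zero_of_adj {T : Finset V} {f : V → ℝ} (hf : Inner E T f) {x y : V}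
    (hE : E x y) (hy : y ∉ T) : f x = 0 := by
  by_contra h0; exact hy ((hf x h0).2 y hE)

/-- `poincare_ball` is multiplied by `π(x₀)` and summed over all centres `x₀`. By `hasSum_average`
every local sum turns into a global one times a ball volume, and these volumes are all comparable to
`v r` and cancel. -/
theorem nash (h : Snapshot E v Cv a) {CP : ℝ} (hP : PoincareAt E a CP) {T : Finset V}
    {f : V → ℝ} (hf : Inner E T f) (hf0 : ∀ x, 0 ≤ f x) {r : ℝ} (hr : 0 ≤ r) :
    ∑ x ∈ T, vertexCond a x * f x ^ 2 ≤
      |CP| * Cv ^ 3 * r ^ 2 * ∑ x ∈ T, ∑ y ∈ T, a x y * (f y - f x) ^ 2 +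
      Cv ^ 3 / v r * (∑ x ∈ T, vertexCond a x * f x) ^ 2 := by
  classical
  set e : V → ℝ := fun x => ∑ y ∈ h.nbrs x, a x y * (f y - f x) ^ 2 with he
  set m := ∑ x ∈ T, vertexCond a x * f x
  have hvr := h.v_pos hr
  have hCv := h.Cv_pos
  have hπf : ∀ x, 0 ≤ vertexCond a x * f x := fun x =>
    mul_nonneg (h.vertexCond_pos x).le (hf0 x)
  have he0 : ∀ x, 0 ≤ e x := fun x => Finset.sum_nonneg fun y _ =>
    mul_nonneg (h.nonneg x y) (sq_nonneg _)
  have heT : ∀ x, x ∉ T → e x = 0 := by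
    intro x hx
    refine Finset.sum_eq_zero fun y hy => ?_
    have h1 := inner_eq_zero hf hx
    have h2 := inner_eq_zero_of_adj hf (h.edge_symm _ _ (h.mem_nbrs.1 hy)) hx
    rw [h1, h2]; simp
  have heq : ∑ x ∈ T, e x = ∑ x ∈ T, ∑ y ∈ T, a x y * (f y - f x) ^ 2 := by
    refine Finset.sum_congr rfl fun x _ => h.sum_nbrs_eq (F := fun x y => (f y - f x) ^ 2) ?_
    intro y hE hy
    simp only [inner_eq_zero hf hy, inner_eq_zero_of_adj hf hE hy]; simp
  have s1 := h.hasSum_average T (g := fun x => vertexCond a x * f x ^ 2)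
    (fun x hx => by rw [inner_eq_zero hf hx]; simp) r
  have s2 := h.hasSum_average T (g := e) heT (2 * r)
  have s3 := h.hasSum_average T (g := fun x => vertexCond a x * f x)
    (fun x hx => by rw [inner_eq_zero hf hx]; simp) r
  have hle := hasSum_le (fun x₀ => ?_) s1 ((s2.mul_left (|CP| * r ^ 2)).add
    (s3.mul_left (Cv / v r * m)))
  · have t1 : Cv⁻¹ * v r * ∑ x ∈ T, vertexCond a x * f x ^ 2 ≤
        ∑ x ∈ T, vertexCond a x * f x ^ 2 * ∑ z ∈ h.ball x r, vertexCond a z := by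
      rw [Finset.mul_sum]
      refine Finset.sum_le_sum fun x _ => ?_
      rw [mul_comm]
      exact mul_le_mul_of_nonneg_left (h.le_vol x hr)
        (mul_nonneg (h.vertexCond_pos x).le (sq_nonneg _))
    have t2 : ∑ x ∈ T, e x * ∑ z ∈ h.ball x (2 * r), vertexCond a z ≤
        Cv * (Cv * v r) * ∑ x ∈ T, e x := by
      rw [Finset.mul_sum]
      refine Finset.sum_le_sum fun x _ => ?_
      rw [mul_comm]
      refine mul_le_mul_of_nonneg_right ((h.vol_le x (by positivity)).trans ?_) (he0 x)
      exact mul_le_mul_of_nonneg_left (h.doubling r hr) hCv.le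
    have t3 : ∑ x ∈ T, vertexCond a x * f x * ∑ z ∈ h.ball x r, vertexCond a z ≤
        Cv * v r * m := by
      rw [Finset.mul_sum]
      refine Finset.sum_le_sum fun x _ => ?_
      rw [mul_comm]
      exact mul_le_mul_of_nonneg_right (h.vol_le x hr) (hπf x)
    have hm0 : 0 ≤ m := Finset.sum_nonneg fun x _ => hπf x
    rw [← heq]
    have t4 : Cv⁻¹ * v r * ∑ x ∈ T, vertexCond a x * f x ^ 2 ≤
        |CP| * r ^ 2 * (Cv * (Cv * v r) * ∑ x ∈ T, e x) + Cv / v r * m * (Cv * v r * m) :=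
      t1.trans (hle.trans (add_le_add (mul_le_mul_of_nonneg_left t2 (by positivity))
        (mul_le_mul_of_nonneg_left t3 (by positivity))))
    have t5 := mul_le_mul_of_nonneg_left t4 (by positivity : 0 ≤ Cv / v r)
    have t6 : Cv / v r * (Cv⁻¹ * v r * ∑ x ∈ T, vertexCond a x * f x ^ 2) =
        ∑ x ∈ T, vertexCond a x * f x ^ 2 := by field_simp
    rw [t6] at t5
    refine t5.trans (le_of_eq ?_)
    field_simp
  · have h1 := h.poincare_ball hP f x₀ hr
    have h2 : ∑ x ∈ h.ball x₀ r, vertexCond a x * f x ≤ m := by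
      refine sum_le_sum_of_support hπf fun x _ hT => ?_
      rw [inner_eq_zero hf hT, mul_zero]
    have h3 : 0 ≤ ∑ x ∈ h.ball x₀ r, vertexCond a x * f x := Finset.sum_nonneg fun x _ => hπf x
    -- Only one of the two factors of the local mass is replaced by the total mass `m`. The other
    -- stays local, so that averaging over `x₀` still produces the factor `v r` that is needed.
    have h4 : Cv / v r * (∑ x ∈ h.ball x₀ r, vertexCond a x * f x) ^ 2 ≤
        Cv / v r * m * ∑ x ∈ h.ball x₀ r, vertexCond a x * f x := by
      rw [mul_assoc, sq]
      exact mul_le_mul_of_nonneg_left (mul_le_mul_of_nonneg_right h2 h3) (by positivity)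
    have h5 := mul_le_mul_of_nonneg_left (h1.trans (add_le_add le_rfl h4)) (h.vertexCond_pos x₀).le
    refine h5.trans (le_of_eq ?_)
    simp only [he]
    ring

/-! ### One lazy step -/

/-- Jensen's inequality with a gain coming from laziness. -/
theorem lazy_jensen (h : Snapshot E v Cv a) {α : ℝ} {x : V} (hl : α ≤ stepKernel a x x)
    (f : V → ℝ) :
    vertexCond a x * (∑' y, stepKernel a x y * f y) ^ 2 ≤
      ∑ y ∈ h.nbrs x, a x y * (f y ^ 2 - α * (f y - f x) ^ 2) := by
  classical
  rw [h.tsum_stepKernel_mul]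
  set N := h.nbrs x
  set K := stepKernel a x
  have hK0 : ∀ y, 0 ≤ K y := h.stepKernel_nonneg x
  have hsum : ∑ y ∈ N, K y = 1 := h.sum_stepKernel x
  set D := ∑ y ∈ N, K y * (f y - f x)
  set Q := ∑ y ∈ N, K y * (f y - f x) ^ 2
  have hKf : ∑ y ∈ N, K y * f y = f x + D := by
    simp only [D, mul_sub, Finset.sum_sub_distrib, ← Finset.sum_mul, hsum]; ring
  -- The term `y = x` contributes nothing to `D`, so Cauchy–Schwarz sees only the mass `1 - K x x ≤
  -- 1 - α`. This is where laziness yields its gain.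
  have hCS : D ^ 2 ≤ (1 - K x) * Q := by
    have hD : D = ∑ y ∈ N.erase x, K y * (f y - f x) :=
      (Finset.sum_erase _ (by simp)).symm
    have hQ : Q = ∑ y ∈ N.erase x, K y * (f y - f x) ^ 2 :=
      (Finset.sum_erase _ (by simp)).symm
    have hR : ∑ y ∈ N.erase x, K y = 1 - K x := by
      by_cases hx : x ∈ N
      · rw [← hsum, ← Finset.add_sum_erase _ _ hx]; ring
      · rw [Finset.erase_eq_of_notMem hx, hsum,
          show K x = 0 from h.stepKernel_zero fun hE => hx (h.mem_nbrs.2 hE)]; ring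
    rw [hD, hQ, ← hR]
    refine Finset.sum_sq_le_sum_mul_sum_of_sq_le_mul _ (fun y _ => hK0 y)
      (fun y _ => mul_nonneg (hK0 y) (sq_nonneg _)) (fun y _ => le_of_eq (by ring))
  have hQ0 : 0 ≤ Q := Finset.sum_nonneg fun y _ => mul_nonneg (hK0 y) (sq_nonneg _)
  have hfin : ∑ y ∈ N, a x y * (f y ^ 2 - α * (f y - f x) ^ 2) =
      vertexCond a x * (f x ^ 2 + 2 * f x * D + Q - α * Q) := by
    have : f x ^ 2 = ∑ y ∈ N, K y * f x ^ 2 := by rw [← Finset.sum_mul, hsum, one_mul]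
    rw [this]
    simp only [D, Q, Finset.mul_sum, ← Finset.sum_add_distrib, ← Finset.sum_sub_distrib]
    refine Finset.sum_congr rfl fun y _ => ?_
    rw [← h.vertexCond_mul_stepKernel x y]
    ring
  rw [hfin, hKf]
  refine mul_le_mul_of_nonneg_left ?_ (h.vertexCond_pos x).le
  have : (1 - K x) * Q ≤ (1 - α) * Q := mul_le_mul_of_nonneg_right (by linarith) hQ0
  nlinarith

theorem sum_row_T (h : Snapshot E v Cv a) {T : Finset V} {f : V → ℝ} (hf : Inner E T f)
    (w : V → ℝ) :
    ∑ x ∈ T, vertexCond a x * w x * f x ^ 2 = ∑ x ∈ T, ∑ y ∈ T, a x y * (w x * f x ^ 2) := by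
  refine Finset.sum_congr rfl fun x _ => ?_
  rw [← h.sum_nbrs_eq (F := fun x _ => w x * f x ^ 2), ← Finset.sum_mul, ← h.vertexCond_eq]
  · ring
  · intro y hE hy
    simp [inner_eq_zero_of_adj hf hE hy]

theorem sum_swap (h : Snapshot E v Cv a) (T : Finset V) (F : V → V → ℝ) :
    ∑ x ∈ T, ∑ y ∈ T, a x y * F x y = ∑ x ∈ T, ∑ y ∈ T, a x y * F y x := by
  rw [Finset.sum_comm]
  exact Finset.sum_congr rfl fun x _ => Finset.sum_congr rfl fun y _ => by rw [h.symm]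

theorem sum_lazy_jensen (h : Snapshot E v Cv a) {α : ℝ} (hl : ∀ x, α ≤ stepKernel a x x)
    {T : Finset V} {f : V → ℝ} (hf : Inner E T f) {w : V → ℝ} (hw : ∀ x, 0 ≤ w x) :
    ∑ x ∈ T, vertexCond a x * w x * (∑' y, stepKernel a x y * f y) ^ 2 ≤
      ∑ x ∈ T, ∑ y ∈ T, a x y * (w x * (f y ^ 2 - α * (f y - f x) ^ 2)) := by
  refine Finset.sum_le_sum fun x _ => ?_
  have h1 := mul_le_mul_of_nonneg_left (h.lazy_jensen (hl x) f) (hw x)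
  rw [h.sum_nbrs_eq (F := fun x y => f y ^ 2 - α * (f y - f x) ^ 2), Finset.mul_sum] at h1
  · refine le_trans (le_of_eq (by ring)) (h1.trans (le_of_eq ?_))
    exact Finset.sum_congr rfl fun y _ => by ring
  · intro y hE hy
    simp [inner_eq_zero_of_adj hf hE hy, inner_eq_zero hf hy]

/-- One lazy step dissipates energy. -/
theorem step_energy (h : Snapshot E v Cv a) {α : ℝ} (hl : ∀ x, α ≤ stepKernel a x x)
    {T : Finset V} {f : V → ℝ} (hf : Inner E T f) :
    ∑ x ∈ T, vertexCond a x * (∑' y, stepKernel a x y * f y) ^ 2 ≤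
      ∑ x ∈ T, vertexCond a x * f x ^ 2 -
        α * ∑ x ∈ T, ∑ y ∈ T, a x y * (f y - f x) ^ 2 := by
  have h1 := h.sum_lazy_jensen hl hf (w := fun _ => 1) (fun _ => zero_le_one)
  have h2 := h.sum_row_T hf (fun _ => 1)
  simp only [mul_one, one_mul] at h1 h2
  rw [h2, h.sum_swap T (fun x _ => f x ^ 2), Finset.mul_sum, ← Finset.sum_sub_distrib]
  refine h1.trans (le_of_eq (Finset.sum_congr rfl fun x _ => ?_))
  rw [Finset.mul_sum, ← Finset.sum_sub_distrib]
  exact Finset.sum_congr rfl fun y _ => by ring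

/-- This is the contribution of one edge to the symmetrised weighted step, with `p`, `q` the weights
and `s`, `t` the function values at its ends. The two sides differ at first order by `-(q - p)(t -
s)(t + s)`. The dissipation `α (p + q)(t - s)²` absorbs this product and leaves a term of second
order in `κ`. -/
theorem weight_pointwise {α κ p q s t : ℝ} (hα : 0 < α) (hp : 0 < p) (hq : 0 < q)
    (h1 : |q - p| ≤ κ * p) (h2 : |q - p| ≤ κ * q) :
    p * t ^ 2 + q * s ^ 2 - α * (p + q) * (t - s) ^ 2 ≤
      (1 + κ ^ 2 / (4 * α)) * (p * s ^ 2 + q * t ^ 2) := by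
  have hpq : 0 < p + q := by linarith
  have key : -(q - p) * (t - s) * (s + t) ≤
      α * (p + q) * (t - s) ^ 2 + (q - p) ^ 2 * (s + t) ^ 2 / (4 * α * (p + q)) := by
    have : 0 ≤ (2 * α * (p + q) * (t - s) + (q - p) * (s + t)) ^ 2 / (4 * α * (p + q)) := by
      positivity
    have e : (2 * α * (p + q) * (t - s) + (q - p) * (s + t)) ^ 2 / (4 * α * (p + q)) =
        α * (p + q) * (t - s) ^ 2 + (q - p) * (t - s) * (s + t) +
          (q - p) ^ 2 * (s + t) ^ 2 / (4 * α * (p + q)) := by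
      field_simp
      ring
    linarith
  have hsq : (q - p) ^ 2 ≤ κ ^ 2 * p * q := by
    have : |q - p| * |q - p| ≤ κ * p * (κ * q) :=
      mul_le_mul h1 h2 (abs_nonneg _) ((abs_nonneg _).trans h1)
    rw [abs_mul_abs_self] at this
    nlinarith
  have hst : (q - p) ^ 2 * (s + t) ^ 2 ≤ κ ^ 2 * (p + q) * (p * s ^ 2 + q * t ^ 2) := by
    have e1 : (q - p) ^ 2 * (s + t) ^ 2 ≤ κ ^ 2 * p * q * (s + t) ^ 2 :=
      mul_le_mul_of_nonneg_right hsq (sq_nonneg _)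
    have e2 : p * q * (s + t) ^ 2 ≤ (p + q) * (p * s ^ 2 + q * t ^ 2) := by
      nlinarith [sq_nonneg (p * s - q * t)]
    nlinarith [sq_nonneg κ]
  have hdiv : (q - p) ^ 2 * (s + t) ^ 2 / (4 * α * (p + q)) ≤
      κ ^ 2 / (4 * α) * (p * s ^ 2 + q * t ^ 2) := by
    rw [div_le_iff₀ (by positivity)]
    refine hst.trans (le_of_eq ?_)
    field_simp
  nlinarith

/-- One lazy step in a weighted norm. -/
theorem step_weight (h : Snapshot E v Cv a) {α κ : ℝ} (hα : 0 < α)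
    (hl : ∀ x, α ≤ stepKernel a x x)
    {T : Finset V} {f : V → ℝ} (hf : Inner E T f) {w : V → ℝ} (hw : ∀ x, 0 < w x)
    (hκ : ∀ x y, E x y → |w y - w x| ≤ κ * w x) :
    ∑ x ∈ T, vertexCond a x * w x * (∑' y, stepKernel a x y * f y) ^ 2 ≤
      (1 + κ ^ 2 / (4 * α)) * ∑ x ∈ T, vertexCond a x * w x * f x ^ 2 := by
  have h1 := h.sum_lazy_jensen hl hf (fun x => (hw x).le)
  -- Each double sum is added to its copy with `x` and `y` exchanged; only after this symmetrisation
  -- is the error quadratic in `κ`.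
  have h2 := h.sum_swap T (fun x y => w x * (f y ^ 2 - α * (f y - f x) ^ 2))
  have h3 := h.sum_row_T hf w
  have h4 := h.sum_swap T (fun x _ => w x * f x ^ 2)
  have h5 : ∑ x ∈ T, ∑ y ∈ T, a x y * (w x * (f y ^ 2 - α * (f y - f x) ^ 2)) +
      ∑ x ∈ T, ∑ y ∈ T, a x y * (w y * (f x ^ 2 - α * (f x - f y) ^ 2)) ≤
      (1 + κ ^ 2 / (4 * α)) * (∑ x ∈ T, ∑ y ∈ T, a x y * (w x * f x ^ 2) +
        ∑ x ∈ T, ∑ y ∈ T, a x y * (w y * f y ^ 2)) := by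
    simp only [← Finset.sum_add_distrib, Finset.mul_sum]
    refine Finset.sum_le_sum fun x _ => Finset.sum_le_sum fun y _ => ?_
    by_cases hE : E x y
    · have := mul_le_mul_of_nonneg_left (weight_pointwise (s := f x) (t := f y) hα (hw x) (hw y)
        (hκ x y hE) (by rw [abs_sub_comm]; exact hκ y x (h.edge_symm _ _ hE))) (h.nonneg x y)
      linarith
    · simp [h.zero x y hE]
  rw [← h2, ← h4] at h5
  rw [h3]
  linarith

end Snapshot

end TimeVaryingWalk

/-! ### Decay of weighted norms along chains. -/

namespace TimeVaryingWalk

/-- Reversibility makes `π` invariant under the kernel. Since `f` vanishes near the boundary of `T`,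
no mass leaves `T` in one step. -/
theorem Snapshot.sum_step_mass {V : Type*} {E : V → V → Prop} {v : ℝ → ℝ} {Cv : ℝ}
    {a : V → V → ℝ} (h : Snapshot E v Cv a) {T : Finset V} {f : V → ℝ} (hf : Inner E T f) :
    ∑ x ∈ T, vertexCond a x * ∑' y, stepKernel a x y * f y = ∑ x ∈ T, vertexCond a x * f x := by
  have h1 : ∑ x ∈ T, vertexCond a x * ∑' y, stepKernel a x y * f y =
      ∑ x ∈ T, ∑ y ∈ T, a x y * f y := by
    refine Finset.sum_congr rfl fun x _ => ?_
    rw [h.tsum_stepKernel_mul, Finset.mul_sum,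
      ← h.sum_nbrs_eq (F := fun _ y => f y) (fun y _ hy => inner_eq_zero hf hy)]
    exact Finset.sum_congr rfl fun y _ => by rw [← mul_assoc, h.vertexCond_mul_stepKernel]
  rw [h1, h.sum_swap T (fun _ y => f y)]
  refine Finset.sum_congr rfl fun x _ => ?_
  rw [← h.sum_nbrs_eq (F := fun x _ => f x), ← Finset.sum_mul, ← h.vertexCond_eq]
  exact fun y hE hy => inner_eq_zero_of_adj hf hE hy

/-- A sequence of functions, started from a point mass at `o`, each dominated by one step of a
lazy reversible walk applied to the previous one. -/
structure Chain {V : Type*} (E : V → V → Prop) (v : ℝ → ℝ) (Cv CP α : ℝ) (c : ℕ → V → V → ℝ)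
    (f : ℕ → V → ℝ) (o : V) : Prop where
  snap : ∀ k, Snapshot E v Cv (c k)
  poincare : ∀ k, PoincareAt E (c k) CP
  lazy : ∀ k x, α ≤ stepKernel (c k) x x
  nonneg : ∀ k x, 0 ≤ f k x
  mass : ∀ k x, vertexCond (c (k + 1)) x * f (k + 1) x ≤
    vertexCond (c k) x * ∑' y, stepKernel (c k) x y * f k y
  sq : ∀ k x, vertexCond (c (k + 1)) x * f (k + 1) x ^ 2 ≤
    vertexCond (c k) x * (∑' y, stepKernel (c k) x y * f k y) ^ 2
  start : ∀ x, x ≠ o → f 0 x = 0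
  start_le : vertexCond (c 0) o * f 0 o ≤ Cv

namespace Chain

variable {V : Type*} {E : V → V → Prop} {v : ℝ → ℝ} {Cv CP α : ℝ} {c : ℕ → V → V → ℝ}
  {f : ℕ → V → ℝ} {o : V}

/-- The `n`-th weighted squared norm of a chain. -/
noncomputable def F (H : Chain E v Cv CP α c f o) (l : ℝ) (n : ℕ) : ℝ :=
  ∑ x ∈ (H.snap 0).ball o n, vertexCond (c n) x * Real.exp (2 * l * gdist E o x) * f n x ^ 2

variable (H : Chain E v Cv CP α c f o)
include H

theorem support (k : ℕ) : ∀ x, f k x ≠ 0 → gdist E o x ≤ k := by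
  induction k with
  | zero =>
    intro x hx
    have : x = o := by by_contra hne; exact hx (H.start x hne)
    simp [this, gdist_self]
  | succ k ih =>
    intro x hx
    by_contra hd
    refine hx (le_antisymm ?_ (H.nonneg _ _))
    have h1 : ∑' y, stepKernel (c k) x y * f k y = 0 := by
      rw [(H.snap k).tsum_stepKernel_mul]
      refine Finset.sum_eq_zero fun y hy => ?_
      have hE := (H.snap k).mem_nbrs.1 hy
      have : f k y = 0 := by
        by_contra h0
        have h2 := ih y h0
        have h3 := gdist_le_add_one (H.snap 0).connected hE o
        rw [gdist_comm E x o, gdist_comm E y o] at h3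
        omega
      rw [this, mul_zero]
    have h2 := H.mass k x
    rw [h1, mul_zero] at h2
    have h3 := (H.snap (k + 1)).vertexCond_pos x
    by_contra h4
    exact absurd h2 (not_le.2 (mul_pos h3 (not_le.1 h4)))

theorem inner {k n : ℕ} (hkn : k < n) : Inner E ((H.snap 0).ball o n) (f k) := by
  intro x hx
  have h1 := H.support k x hx
  refine ⟨(H.snap 0).mem_ball.2 (by exact_mod_cast h1.trans hkn.le), fun y hE => ?_⟩
  have h2 := gdist_le_add_one (H.snap 0).connected ((H.snap 0).edge_symm _ _ hE) o
  rw [gdist_comm E x o, gdist_comm E y o] at h2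
  exact (H.snap 0).mem_ball.2 (by exact_mod_cast (by omega : gdist E o y ≤ n))

theorem F_eq (l : ℝ) {k n : ℕ} (hkn : k ≤ n) : H.F l k =
    ∑ x ∈ (H.snap 0).ball o n,
      vertexCond (c k) x * Real.exp (2 * l * gdist E o x) * f k x ^ 2 := by
  refine Finset.sum_subset (fun x hx => ?_) (fun x _ hx => ?_)
  · rw [Snapshot.mem_ball] at hx ⊢
    exact hx.trans (by exact_mod_cast hkn)
  · have : f k x = 0 := by
      by_contra h0
      exact hx ((H.snap 0).mem_ball.2 (by exact_mod_cast H.support k x h0))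
    simp [this]

theorem F_nonneg (l : ℝ) (n : ℕ) : 0 ≤ H.F l n :=
  Finset.sum_nonneg fun x _ => mul_nonneg (mul_nonneg ((H.snap n).vertexCond_pos x).le
    (Real.exp_pos _).le) (sq_nonneg _)

theorem F_start (l : ℝ) : H.F l 0 ≤ Cv ^ 3 := by
  have h1 : H.F l 0 = vertexCond (c 0) o * f 0 o ^ 2 := by
    unfold F
    simp [(H.snap 0).ball_zero, gdist_self]
  have h2 := H.start_le
  have h3 := (H.snap 0).one_le_mul_vertexCond o
  have h0 := H.nonneg 0 o
  have h5 := (H.snap 0).Cv_pos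
  have h4 : f 0 o ≤ Cv * Cv := by
    calc f 0 o ≤ Cv * vertexCond (c 0) o * f 0 o := le_mul_of_one_le_left h0 h3
      _ = Cv * (vertexCond (c 0) o * f 0 o) := by ring
      _ ≤ Cv * Cv := mul_le_mul_of_nonneg_left h2 h5.le
  rw [h1, pow_two, ← mul_assoc]
  calc vertexCond (c 0) o * f 0 o * f 0 o ≤ Cv * (Cv * Cv) :=
        mul_le_mul h2 h4 h0 h5.le
    _ = Cv ^ 3 := by ring

theorem mass_le {k n : ℕ} (hkn : k < n) :
    ∑ x ∈ (H.snap 0).ball o n, vertexCond (c k) x * f k x ≤ Cv := by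
  induction k with
  | zero =>
    rw [Finset.sum_eq_single o]
    · exact H.start_le
    · intro x _ hx; rw [H.start x hx, mul_zero]
    · intro ho
      exact absurd ((H.snap 0).mem_ball.2 (by simp [gdist_self])) ho
  | succ k ih =>
    refine le_trans (Finset.sum_le_sum fun x _ => H.mass k x) ?_
    rw [(H.snap k).sum_step_mass (H.inner (by omega : k < n))]
    exact ih (by omega)

/-- The witness is the Dirichlet energy of `f k`. The same number measures the loss in one step and
enters the Nash inequality, where the mass is at most `Cv`. -/
theorem exists_energy (k : ℕ) : ∃ e : ℝ, 0 ≤ e ∧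
    H.F 0 (k + 1) ≤ H.F 0 k - α * e ∧
    ∀ r, 0 ≤ r → H.F 0 k ≤ |CP| * Cv ^ 3 * r ^ 2 * e + Cv ^ 5 / v r := by
  set T := (H.snap 0).ball o (k + 1 : ℕ)
  have hin : Inner E T (f k) := H.inner (Nat.lt_succ_self k)
  refine ⟨∑ x ∈ T, ∑ y ∈ T, c k x y * (f k y - f k x) ^ 2, ?_, ?_, ?_⟩
  · exact Finset.sum_nonneg fun x _ => Finset.sum_nonneg fun y _ =>
      mul_nonneg ((H.snap k).nonneg x y) (sq_nonneg _)
  · have h1 := (H.snap k).step_energy (H.lazy k) hin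
    rw [H.F_eq 0 le_rfl, H.F_eq 0 (Nat.le_succ k)]
    simp only [mul_zero, zero_mul, Real.exp_zero, mul_one]
    exact (Finset.sum_le_sum fun x _ => H.sq k x).trans h1
  · intro r hr
    have h1 := (H.snap k).nash (H.poincare k) hin (H.nonneg k) hr
    rw [H.F_eq 0 (Nat.le_succ k)]
    simp only [mul_zero, zero_mul, Real.exp_zero, mul_one]
    refine h1.trans (add_le_add le_rfl ?_)
    have h2 := H.mass_le (Nat.lt_succ_self k)
    have h3 : 0 ≤ ∑ x ∈ T, vertexCond (c k) x * f k x :=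
      Finset.sum_nonneg fun x _ => mul_nonneg ((H.snap k).vertexCond_pos x).le (H.nonneg k x)
    have hC := (H.snap 0).Cv_pos
    have hv := (H.snap 0).v_pos hr
    calc Cv ^ 3 / v r * (∑ x ∈ T, vertexCond (c k) x * f k x) ^ 2 ≤ Cv ^ 3 / v r * Cv ^ 2 :=
          mul_le_mul_of_nonneg_left (pow_le_pow_left₀ h3 h2 2) (by positivity)
      _ = Cv ^ 5 / v r := by ring

/-- The weight `exp (2 l d(o, ·))` varies along an edge by a relative amount of at most `16 l`, so
`step_weight` applies with `κ = 16 l`, and `κ² / (4 α) = 64 l² / α`. -/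
theorem F_step (hα : 0 < α) {l : ℝ} (hl : 0 ≤ l) (hl1 : l ≤ 1) (k : ℕ) :
    H.F l (k + 1) ≤ Real.exp (64 / α * l ^ 2) * H.F l k := by
  set T := (H.snap 0).ball o (k + 1 : ℕ)
  have hin : Inner E T (f k) := H.inner (Nat.lt_succ_self k)
  set w : V → ℝ := fun x => Real.exp (2 * l * gdist E o x) with hw
  have hκ : ∀ x y, E x y → |w y - w x| ≤ 16 * l * w x := by
    intro x y hE
    have h1 := gdist_le_add_one (H.snap 0).connected hE o
    have h2 := gdist_le_add_one (H.snap 0).connected ((H.snap 0).edge_symm _ _ hE) o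
    rw [gdist_comm E x o, gdist_comm E y o] at h1 h2
    have h1' : (gdist E o x : ℝ) ≤ gdist E o y + 1 := by exact_mod_cast h1
    have h2' : (gdist E o y : ℝ) ≤ gdist E o x + 1 := by exact_mod_cast h2
    -- From `exp (2 l) (1 - 2 l) ≤ 1` one gets `exp (2 l) ≤ 1 + 2 l exp (2 l)`, and `exp (2 l) ≤ 8`
    -- because `l ≤ 1`.
    have e1 : Real.exp (2 * l) ≤ 1 + 16 * l := by
      have a1 : Real.exp (2 * l) * (1 - 2 * l) ≤ 1 := by
        have := Real.add_one_le_exp (-(2 * l))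
        calc Real.exp (2 * l) * (1 - 2 * l) ≤ Real.exp (2 * l) * Real.exp (-(2 * l)) :=
              mul_le_mul_of_nonneg_left (by linarith) (Real.exp_pos _).le
          _ = 1 := by rw [← Real.exp_add]; simp
      have a2 : Real.exp (2 * l) ≤ 8 := by
        have b1 : Real.exp (2 * l) ≤ Real.exp 1 ^ 2 := by
          rw [← Real.exp_nat_mul]; exact Real.exp_le_exp.2 (by push_cast; linarith)
        have b2 := Real.exp_one_lt_d9
        have b3 := Real.exp_pos 1
        nlinarith
      nlinarith
    have e2 : 1 - 16 * l ≤ Real.exp (-(2 * l)) := by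
      have := Real.add_one_le_exp (-(2 * l)); linarith
    have hwx : 0 < w x := Real.exp_pos _
    have hwy : w y = w x * Real.exp (2 * l * (gdist E o y - gdist E o x)) := by
      simp only [hw, ← Real.exp_add]; ring_nf
    have u1 : Real.exp (2 * l * (gdist E o y - gdist E o x)) ≤ 1 + 16 * l :=
      (Real.exp_le_exp.2 (by nlinarith)).trans e1
    have u2 : 1 - 16 * l ≤ Real.exp (2 * l * (gdist E o y - gdist E o x)) :=
      e2.trans (Real.exp_le_exp.2 (by nlinarith))
    rw [hwy, abs_le]
    constructor <;> nlinarith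
  have h1 := (H.snap k).step_weight hα (H.lazy k) hin (w := w) (fun x => Real.exp_pos _) hκ
  rw [H.F_eq l le_rfl, H.F_eq l (Nat.le_succ k)]
  have h2 : ∑ x ∈ T, vertexCond (c (k + 1)) x * w x * f (k + 1) x ^ 2 ≤
      ∑ x ∈ T, vertexCond (c k) x * w x * (∑' y, stepKernel (c k) x y * f k y) ^ 2 := by
    refine Finset.sum_le_sum fun x _ => ?_
    have := mul_le_mul_of_nonneg_left (H.sq k x) (Real.exp_pos (2 * l * gdist E o x)).le
    calc _ = w x * (vertexCond (c (k + 1)) x * f (k + 1) x ^ 2) := by ring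
      _ ≤ _ := this
      _ = _ := by ring
  refine h2.trans (h1.trans (mul_le_mul_of_nonneg_right ?_ ?_))
  · have := Real.add_one_le_exp (64 / α * l ^ 2)
    refine le_trans (le_of_eq ?_) this
    field_simp
    ring
  · exact Finset.sum_nonneg fun x _ => mul_nonneg (mul_nonneg ((H.snap k).vertexCond_pos x).le
      (Real.exp_pos _).le) (sq_nonneg _)

theorem F_steps (hα : 0 < α) {l : ℝ} (hl : 0 ≤ l) (hl1 : l ≤ 1) (j k : ℕ) :
    H.F l (j + k) ≤ Real.exp (64 / α * l ^ 2 * k) * H.F l j := by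
  induction k with
  | zero => simp
  | succ k ih =>
    refine (H.F_step hα hl hl1 (j + k)).trans ?_
    refine (mul_le_mul_of_nonneg_left ih (Real.exp_pos _).le).trans (le_of_eq ?_)
    rw [← mul_assoc, ← Real.exp_add]
    push_cast
    ring_nf

/-- Cauchy–Schwarz, the weight at rate `l` being the geometric mean of those at rates `2 l` and `0`.
It lets the unweighted decay enter the weighted estimate. -/
theorem F_holder (l : ℝ) (n : ℕ) : H.F l n ^ 2 ≤ H.F (2 * l) n * H.F 0 n := by
  refine Finset.sum_sq_le_sum_mul_sum_of_sq_le_mul _ (fun x _ => ?_) (fun x _ => ?_)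
    (fun x _ => le_of_eq ?_)
  · exact mul_nonneg (mul_nonneg ((H.snap n).vertexCond_pos x).le
      (Real.exp_pos _).le) (sq_nonneg _)
  · exact mul_nonneg (mul_nonneg ((H.snap n).vertexCond_pos x).le
      (Real.exp_pos _).le) (sq_nonneg _)
  · have : Real.exp (2 * (2 * l) * gdist E o x) = Real.exp (2 * l * gdist E o x) ^ 2 := by
      rw [← Real.exp_nat_mul]; congr 1; push_cast; ring
    rw [this]
    simp only [mul_zero, zero_mul, Real.exp_zero]
    ring

end Chain

/-- A discrete Nash argument. -/
theorem nash_decay {v : ℝ → ℝ} {Cv : ℝ} (hC : 1 ≤ Cv) (hmono : MonotoneOn v (Ici 0))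
    (hd : ∀ r, 0 ≤ r → v (2 * r) ≤ Cv * v r) (h0 : v 0 = 1) (h1 : v 1 = 1)
    {α P Q A₀ : ℝ} (hα : 0 < α) (hP : 0 < P) (hQ : 0 ≤ Q) {A : ℕ → ℝ} (hA : ∀ k, 0 ≤ A k)
    (hA₀ : A 0 ≤ A₀)
    (hstep : ∀ k, ∃ e : ℝ, 0 ≤ e ∧ A (k + 1) ≤ A k - α * e ∧
      ∀ r, 0 ≤ r → A k ≤ P * r ^ 2 * e + Q / v r)
    {j : ℕ} (hj : 4 * P * Cv / α ≤ 4 ^ j) (n : ℕ) :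
    A n ≤ (A₀ + 2 * Q * Cv ^ j) / v (Real.sqrt n) := by
  have hv1 : ∀ r, 0 ≤ r → 1 ≤ v r := fun r hr => h0 ▸ hmono (mem_Ici.2 le_rfl) hr hr
  have hanti : Antitone A := antitone_nat_of_succ_le fun k => by
    obtain ⟨e, he, h2, -⟩ := hstep k
    have := mul_nonneg hα.le he
    linarith
  have hC0 : 0 < Cv := one_pos.trans_le hC
  have hA0' : 0 ≤ A₀ := (hA 0).trans hA₀
  have hdk : ∀ k r, 0 ≤ r → v (2 ^ k * r) ≤ Cv ^ k * v r := by
    intro k r hr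
    induction k with
    | zero => simp
    | succ k ih =>
      calc v (2 ^ (k + 1) * r) = v (2 * (2 ^ k * r)) := by ring_nf
        _ ≤ Cv * v (2 ^ k * r) := hd _ (by positivity)
        _ ≤ Cv * (Cv ^ k * v r) := mul_le_mul_of_nonneg_left ih hC0.le
        _ = _ := by ring
  induction n using Nat.strong_induction_on with
  | _ n ih =>
  have hvn := one_pos.trans_le (hv1 (Real.sqrt n) (Real.sqrt_nonneg _))
  by_cases hn : n ≤ 1
  · have hs : v (Real.sqrt n) ≤ 1 := by
      rw [← h1]
      refine hmono (Real.sqrt_nonneg _) (mem_Ici.2 zero_le_one) ?_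
      exact Real.sqrt_le_iff.2 ⟨zero_le_one, by rw [one_pow]; exact_mod_cast hn⟩
    rw [le_div_iff₀ hvn]
    have h3 : A n ≤ A₀ := (hanti (Nat.zero_le n)).trans hA₀
    have h4 : 0 ≤ 2 * Q * Cv ^ j := by positivity
    calc A n * v (Real.sqrt n) ≤ A n * 1 := mul_le_mul_of_nonneg_left hs (hA n)
      _ ≤ _ := by linarith
  push Not at hn
  have hnpos : (0 : ℝ) < n := by exact_mod_cast (by omega : 0 < n)
  -- The radius is a small fraction of the diffusive scale, so that the energy loss over `n / 2`
  -- steps outweighs one doubling factor `Cv`. The price is the factor `Cv ^ j` in the constant.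
  set r := Real.sqrt n / 2 ^ j with hr
  have hr0 : 0 < r := div_pos (Real.sqrt_pos.2 hnpos) (by positivity)
  have hr2 : r ^ 2 = n / 4 ^ j := by
    rw [hr, div_pow, Real.sq_sqrt hnpos.le, ← pow_mul, mul_comm, pow_mul]; norm_num
  have hvr := one_pos.trans_le (hv1 r hr0.le)
  have hvrn : v (Real.sqrt n) ≤ Cv ^ j * v r := by
    have := hdk j r hr0.le
    rwa [hr, mul_div_cancel₀ _ (by positivity)] at this
  by_cases hcase : A n ≤ 2 * Q / v r
  · refine hcase.trans ?_
    rw [div_le_div_iff₀ hvr hvn]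
    have h4 : 2 * Q * v (Real.sqrt n) ≤ 2 * Q * (Cv ^ j * v r) :=
      mul_le_mul_of_nonneg_left hvrn (by positivity)
    have h5 : 0 ≤ A₀ * v r := by positivity
    nlinarith
  push Not at hcase
  -- In this case `A k > 2 Q / v r` for every `k ≤ n`, so the energy term of the Nash inequality
  -- dominates and `A` decays geometrically at rate `x`. From `m` to `n` this gains a factor `1 /
  -- Cv`, which pays for comparing `v (√m)` with `v (√n)` in the induction.
  set m := n / 2 with hm
  have hmn : m < n := by omega
  set x := α / (2 * P * r ^ 2) with hx
  have hdec : ∀ k, k ≤ n → A (k + 1) ≤ Real.exp (-x) * A k := by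
    intro k hk
    obtain ⟨e, he, h2, h3⟩ := hstep k
    have h4 := h3 r hr0.le
    have h5 : Q / v r ≤ A k / 2 := by
      have := hcase.le.trans (hanti hk)
      rw [mul_div_assoc] at this
      linarith
    have h6 : x * A k ≤ α * e := by
      have : A k ≤ 2 * P * r ^ 2 * e := by linarith
      rw [hx, div_mul_eq_mul_div, div_le_iff₀ (by positivity)]
      calc α * A k ≤ α * (2 * P * r ^ 2 * e) := mul_le_mul_of_nonneg_left this hα.le
        _ = _ := by ring
    have h7 := mul_le_mul_of_nonneg_right (Real.add_one_le_exp (-x)) (hA k)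
    linarith
  have hiter : ∀ k, m + k ≤ n → A (m + k) ≤ Real.exp (-x * k) * A m := by
    intro k
    induction k with
    | zero => intro _; simp
    | succ k ihk =>
      intro hk
      refine (hdec (m + k) (by omega)).trans ?_
      refine (mul_le_mul_of_nonneg_left (ihk (by omega)) (Real.exp_pos _).le).trans (le_of_eq ?_)
      rw [← mul_assoc, ← Real.exp_add]
      push_cast
      ring_nf
  have hfin := hiter (n - m) (by omega)
  rw [show m + (n - m) = n by omega] at hfin
  have hk : (n : ℝ) / 2 ≤ (n - m : ℕ) := by
    rw [Nat.cast_sub hmn.le]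
    have : (m : ℝ) ≤ n / 2 := by rw [hm]; exact_mod_cast Nat.cast_div_le
    linarith
  have hxk : Cv ≤ x * (n - m : ℕ) := by
    have hxn : x * (n / 2) = α * 4 ^ j / (4 * P) := by
      rw [hx, hr2]; field_simp; ring
    have h8 : Cv ≤ α * 4 ^ j / (4 * P) := by
      rw [le_div_iff₀ (by positivity)]
      rw [div_le_iff₀ hα] at hj
      linarith
    exact h8.trans (hxn ▸ mul_le_mul_of_nonneg_left hk (by positivity))
  have hexp : Real.exp (-x * (n - m : ℕ)) ≤ 1 / Cv := by
    rw [neg_mul, Real.exp_neg, ← one_div]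
    refine one_div_le_one_div_of_le hC0 ?_
    have := Real.add_one_le_exp (x * (n - m : ℕ))
    linarith
  have hvm := one_pos.trans_le (hv1 (Real.sqrt m) (Real.sqrt_nonneg _))
  have hvnm : v (Real.sqrt n) ≤ Cv * v (Real.sqrt m) := by
    refine le_trans (hmono (Real.sqrt_nonneg _) (mem_Ici.2 (by positivity)) ?_)
      (hd _ (Real.sqrt_nonneg m))
    have h4 : (n : ℝ) ≤ 2 ^ 2 * m := by
      have : n ≤ 4 * m := by omega
      norm_num; exact_mod_cast this
    calc Real.sqrt n ≤ Real.sqrt (2 ^ 2 * m) := Real.sqrt_le_sqrt h4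
      _ = 2 * Real.sqrt m := by rw [Real.sqrt_mul (by positivity), Real.sqrt_sq (by norm_num)]
  have hB : 0 ≤ A₀ + 2 * Q * Cv ^ j := by positivity
  calc A n ≤ 1 / Cv * ((A₀ + 2 * Q * Cv ^ j) / v (Real.sqrt m)) :=
        hfin.trans (mul_le_mul hexp (ih m hmn) (hA m) (by positivity))
    _ = (A₀ + 2 * Q * Cv ^ j) / (Cv * v (Real.sqrt m)) := by field_simp
    _ ≤ _ := div_le_div_of_nonneg_left hB hvn hvnm

universe u

/-- At rate `l = 0` the norms of a chain satisfy the hypotheses of `nash_decay`. The constant is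
fixed before the graph is, as for all the bounds below. -/
theorem chain_diag (Cv CP α : ℝ) (hα : 0 < α) : ∃ D : ℝ, 0 < D ∧
    ∀ (V : Type u) (E : V → V → Prop) (v : ℝ → ℝ) (c : ℕ → V → V → ℝ) (f : ℕ → V → ℝ) (o : V)
      (H : Chain E v Cv CP α c f o) (n : ℕ), H.F 0 n ≤ D / v (Real.sqrt n) := by
  -- Doubling at `0` forces `1 ≤ Cv`, so otherwise there is no chain and any constant will do.
  by_cases hC : 1 ≤ Cv
  swap
  · exact ⟨1, one_pos, fun V E v c f o H => absurd (H.snap 0).one_le hC⟩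
  have hC0 : 0 < Cv := one_pos.trans_le hC
  set P := (|CP| + 1) * Cv ^ 3 with hP
  have hP0 : 0 < P := by positivity
  obtain ⟨j, hj⟩ := pow_unbounded_of_one_lt (4 * P * Cv / α) (by norm_num : (1 : ℝ) < 4)
  refine ⟨Cv ^ 3 + 2 * Cv ^ 5 * Cv ^ j, by positivity, fun V E v c f o H n => ?_⟩
  have h := H.snap 0
  refine nash_decay hC h.mono h.doubling h.v_zero h.v_one hα hP0 (by positivity)
    (H.F_nonneg 0) (H.F_start 0) (fun k => ?_) hj.le n
  obtain ⟨e, he, h1, h2⟩ := H.exists_energy k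
  refine ⟨e, he, h1, fun r hr => (h2 r hr).trans (add_le_add ?_ le_rfl)⟩
  have : |CP| * Cv ^ 3 ≤ P := by rw [hP]; nlinarith [pow_pos hC0 3]
  exact mul_le_mul_of_nonneg_right (mul_le_mul_of_nonneg_right this (sq_nonneg _)) he

theorem sqrt_le_two_pow (n : ℕ) : Real.sqrt n ≤ 2 ^ n := by
  rw [Real.sqrt_le_left (by positivity)]
  have h1 : (n : ℝ) ≤ 2 ^ n := by exact_mod_cast Nat.lt_two_pow_self.le
  have h2 : (1 : ℝ) ≤ 2 ^ n := one_le_pow₀ (by norm_num)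
  nlinarith

/-- Gaussian weighted norms of chains. -/
theorem chain_gaussian (Cv CP α : ℝ) (hα : 0 < α) : ∃ C : ℝ, 0 < C ∧
    ∀ (V : Type u) (E : V → V → Prop) (v : ℝ → ℝ) (c : ℕ → V → V → ℝ) (f : ℕ → V → ℝ) (o : V)
      (H : Chain E v Cv CP α c f o) (n : ℕ) (l : ℝ), 0 ≤ l → l ≤ 1 →
      H.F l n ≤ C * Real.exp (C * l ^ 2 * n) / v (Real.sqrt n) := by
  by_cases hC : 1 ≤ Cv
  swap
  · exact ⟨1, one_pos, fun V E v c f o H => absurd (H.snap 0).one_le hC⟩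
  have hC0 : 0 < Cv := one_pos.trans_le hC
  obtain ⟨D, hD, hdiag⟩ := chain_diag.{u} Cv CP α hα
  set B := 64 / α with hB
  have hB0 : 0 < B := by positivity
  set C := Cv ^ 3 * Cv ^ 3 + D * Cv ^ 4 + 2 * B + 4 * Cv with hCdef
  have c1 : Cv ^ 3 * Cv ^ 3 ≤ C := by
    have : 0 < D * Cv ^ 4 := by positivity
    linarith
  have c2 : D * Cv ^ 4 ≤ C := by
    have : 0 < Cv ^ 3 * Cv ^ 3 := by positivity
    linarith
  have c3 : 2 * B ≤ C ∧ B + 4 * Cv ≤ C := by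
    have : 0 < D * Cv ^ 4 := by positivity
    have : 0 < Cv ^ 3 * Cv ^ 3 := by positivity
    constructor <;> linarith
  have c4 : Cv ^ 3 ≤ C := by
    have : 1 ≤ Cv ^ 3 := one_le_pow₀ hC
    nlinarith
  have hCpos : 0 < C := lt_of_lt_of_le (by positivity) c4
  refine ⟨C, hCpos, fun V E v c f o H n => ?_⟩
  have h := H.snap 0
  induction n using Nat.strong_induction_on with
  | _ n ih =>
  intro l hl hl1
  have hvn := h.v_pos (Real.sqrt_nonneg (n : ℝ))
  have hcrude : H.F l n ≤ Real.exp (B * l ^ 2 * n) * Cv ^ 3 := by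
    have := H.F_steps hα hl hl1 0 n
    rw [zero_add] at this
    exact this.trans (mul_le_mul_of_nonneg_left (H.F_start l) (Real.exp_pos _).le)
  rw [le_div_iff₀ hvn]
  -- For the first few times `v (√n)` is bounded and iterating `F_step` from the start is enough.
  by_cases hn : n < 8
  · have h1 : v (Real.sqrt n) ≤ Cv ^ 3 := by
      refine h.v_le_pow 3 (Real.sqrt_nonneg _) ?_
      rw [Real.sqrt_le_left (by positivity)]
      have : (n : ℝ) < 8 := by exact_mod_cast hn
      norm_num; linarith
    calc H.F l n * v (Real.sqrt n) ≤ Real.exp (B * l ^ 2 * n) * Cv ^ 3 * Cv ^ 3 :=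
          mul_le_mul hcrude h1 hvn.le (by positivity)
      _ = Cv ^ 3 * Cv ^ 3 * Real.exp (B * l ^ 2 * n) := by ring
      _ ≤ C * Real.exp (C * l ^ 2 * n) := by
          refine mul_le_mul c1 (Real.exp_le_exp.2 ?_) (Real.exp_pos _).le hCpos.le
          rw [mul_assoc, mul_assoc]
          exact mul_le_mul_of_nonneg_right (by linarith [c3.1]) (by positivity)
  push Not at hn
  have hnpos : (0 : ℝ) < n := by exact_mod_cast (by omega : 0 < n)
  -- Here `4 l² ≥ 1`, so the volume, which is at most `Cv ^ n`, is absorbed by the exponential. In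
  -- the other case `2 l ≤ 1`, and the induction hypothesis is available at rate `2 l`.
  by_cases hl2 : 1 / 2 < l
  · have h1 : v (Real.sqrt n) ≤ Real.exp (4 * Cv * l ^ 2 * n) := by
      have h2 := h.v_le_pow n (Real.sqrt_nonneg _) (sqrt_le_two_pow n)
      have h3 : Cv ≤ Real.exp Cv := by linarith [Real.add_one_le_exp Cv]
      calc v (Real.sqrt n) ≤ Real.exp Cv ^ n := h2.trans (pow_le_pow_left₀ hC0.le h3 n)
        _ = Real.exp (n * Cv) := (Real.exp_nat_mul _ _).symm
        _ ≤ _ := Real.exp_le_exp.2 (by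
          have : 1 ≤ 4 * l ^ 2 := by nlinarith
          have h5 : 0 < n * Cv := by positivity
          nlinarith)
    calc H.F l n * v (Real.sqrt n) ≤
        Real.exp (B * l ^ 2 * n) * Cv ^ 3 * Real.exp (4 * Cv * l ^ 2 * n) :=
          mul_le_mul hcrude h1 hvn.le (by positivity)
      _ = Cv ^ 3 * Real.exp ((B + 4 * Cv) * l ^ 2 * n) := by
          rw [mul_right_comm, ← Real.exp_add]; ring_nf
      _ ≤ C * Real.exp (C * l ^ 2 * n) := by
          refine mul_le_mul c4 (Real.exp_le_exp.2 ?_) (Real.exp_pos _).le hCpos.le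
          rw [mul_assoc, mul_assoc]
          exact mul_le_mul_of_nonneg_right c3.2 (by positivity)
  push Not at hl2
  -- The rate doubles and the time shrinks by at least `4`, so the exponent `C (2 l)² j` is at most
  -- `C l² n`. The square root from `F_holder` halves it, which leaves `C l² n / 2` to pay for the
  -- steps from `j` to `n`; this is why `2 B ≤ C`.
  set j := n / 4 with hj
  have hjn : j < n := by omega
  have h1 := H.F_steps hα hl hl1 j (n - j)
  rw [show j + (n - j) = n by omega] at h1
  have hvj := h.v_pos (Real.sqrt_nonneg (j : ℝ))
  have h2 : H.F l j ≤ C * Real.exp (2 * C * l ^ 2 * j) / (Cv ^ 2 * v (Real.sqrt j)) := by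
    refine le_of_sq_le_sq ?_ (by positivity)
    refine (H.F_holder l j).trans ?_
    have h3 := ih j hjn (2 * l) (by linarith) (by linarith)
    have h4 := hdiag V E v c f o H j
    refine (mul_le_mul h3 h4 (H.F_nonneg _ _) (by positivity)).trans ?_
    have h5 : Real.exp (C * (2 * l) ^ 2 * j) = Real.exp (2 * C * l ^ 2 * j) ^ 2 := by
      rw [← Real.exp_nat_mul]; congr 1; push_cast; ring
    rw [h5]
    set X := Real.exp (2 * C * l ^ 2 * j)
    have hX : 0 < X := Real.exp_pos _
    rw [div_mul_div_comm, div_pow, div_le_div_iff₀ (by positivity) (by positivity)]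
    have : 0 ≤ C * X ^ 2 * v (Real.sqrt j) ^ 2 := by positivity
    have := mul_le_mul_of_nonneg_left c2 this
    nlinarith
  have hvnj : v (Real.sqrt n) ≤ Cv ^ 2 * v (Real.sqrt j) := by
    refine h.v_le_of_le_two_pow_mul 2 (Real.sqrt_nonneg _) (Real.sqrt_nonneg _) ?_
    have h4 : (n : ℝ) ≤ (2 ^ 2) ^ 2 * j := by
      have : n ≤ 16 * j := by omega
      norm_num; exact_mod_cast this
    calc Real.sqrt n ≤ Real.sqrt ((2 ^ 2) ^ 2 * j) := Real.sqrt_le_sqrt h4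
      _ = 2 ^ 2 * Real.sqrt j := by
        rw [Real.sqrt_mul (by positivity), Real.sqrt_sq (by norm_num)]
  have hF := H.F_nonneg l j
  calc H.F l n * v (Real.sqrt n)
      ≤ (Real.exp (B * l ^ 2 * (n - j : ℕ)) *
        (C * Real.exp (2 * C * l ^ 2 * j) / (Cv ^ 2 * v (Real.sqrt j)))) *
        (Cv ^ 2 * v (Real.sqrt j)) := by
        refine mul_le_mul (h1.trans ?_) hvnj hvn.le (by positivity)
        exact mul_le_mul_of_nonneg_left h2 (Real.exp_pos _).le
    _ = C * (Real.exp (B * l ^ 2 * (n - j : ℕ)) * Real.exp (2 * C * l ^ 2 * j)) := by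
        field_simp
    _ ≤ C * Real.exp (C * l ^ 2 * n) := by
        rw [← Real.exp_add]
        refine mul_le_mul_of_nonneg_left (Real.exp_le_exp.2 ?_) hCpos.le
        have e1 : ((n - j : ℕ) : ℝ) ≤ n := by exact_mod_cast Nat.sub_le n j
        have e2 : (j : ℝ) ≤ n / 4 := by rw [hj]; exact_mod_cast Nat.cast_div_le
        have e3 : 0 ≤ l ^ 2 := sq_nonneg l
        have e4 : B * l ^ 2 * (n - j : ℕ) ≤ C / 2 * l ^ 2 * n :=
          mul_le_mul (mul_le_mul_of_nonneg_right (by linarith [c3.1]) e3) e1 (by positivity)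
            (by positivity)
        have e5 : 2 * C * l ^ 2 * j ≤ 2 * C * l ^ 2 * (n / 4) :=
          mul_le_mul_of_nonneg_left e2 (by positivity)
        linarith

end TimeVaryingWalk

/-! ### The discrete time walk and its Gaussian upper bound. -/

namespace TimeVaryingWalk

section Discrete

variable {V : Type*} {E : V → V → Prop} {v : ℝ → ℝ} {Cv : ℝ} {c : ℕ → V → V → ℝ}

theorem dtrwSteps_zero_self (c : ℕ → V → V → ℝ) (s : ℕ) (x : V) : dtrwSteps c 0 s x x = 1 := by
  simp [dtrwSteps]

theorem dtrwSteps_zero_ne (c : ℕ → V → V → ℝ) (s : ℕ) {x z : V} (h : x ≠ z) :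
    dtrwSteps c 0 s x z = 0 := by
  simp [dtrwSteps, h]

theorem dtrwSteps_succ (hS : ∀ i, Snapshot E v Cv (c i)) (k s : ℕ) (x z : V) :
    dtrwSteps c (k + 1) s x z =
      ∑ y ∈ (hS (s + 1)).nbrs x, stepKernel (c (s + 1)) x y * dtrwSteps c k (s + 1) y z :=
  (hS (s + 1)).tsum_stepKernel_mul x _

theorem dtrwSteps_nonneg (hS : ∀ i, Snapshot E v Cv (c i)) (k : ℕ) :
    ∀ (s : ℕ) (x z : V), 0 ≤ dtrwSteps c k s x z := by
  induction k with
  | zero =>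
    intro s x z
    by_cases h : x = z
    · subst h; rw [dtrwSteps_zero_self]; exact zero_le_one
    · rw [dtrwSteps_zero_ne c s h]
  | succ k ih =>
    intro s x z
    rw [dtrwSteps_succ hS]
    exact Finset.sum_nonneg fun y _ => mul_nonneg ((hS _).stepKernel_nonneg _ _) (ih _ _ _)

theorem dtrwSteps_support (hS : ∀ i, Snapshot E v Cv (c i)) (k : ℕ) :
    ∀ (s : ℕ) (x z : V), k < gdist E x z → dtrwSteps c k s x z = 0 := by
  induction k with
  | zero =>
    intro s x z h
    refine dtrwSteps_zero_ne c s fun hxz => ?_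
    rw [hxz, gdist_self] at h
    exact lt_irrefl _ h
  | succ k ih =>
    intro s x z h
    rw [dtrwSteps_succ hS]
    refine Finset.sum_eq_zero fun y hy => ?_
    have := gdist_le_add_one (hS 0).connected ((hS _).mem_nbrs.1 hy) z
    rw [ih _ y z (by omega), mul_zero]

/-- The Chapman–Kolmogorov equation. -/
theorem dtrwSteps_add (hS : ∀ i, Snapshot E v Cv (c i)) (j k : ℕ) :
    ∀ (s : ℕ) (x z : V) (T : Finset V), (∀ y, gdist E x y ≤ j → y ∈ T) →
      dtrwSteps c (j + k) s x z =
        ∑ y ∈ T, dtrwSteps c j s x y * dtrwSteps c k (s + j) y z := by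
  induction j with
  | zero =>
    intro s x z T hT
    rw [Finset.sum_eq_single x]
    · simp [dtrwSteps_zero_self]
    · intro y _ hy; rw [dtrwSteps_zero_ne c s hy.symm, zero_mul]
    · intro hx; exact absurd (hT x (by simp [gdist_self])) hx
  | succ j ih =>
    intro s x z T hT
    rw [show j + 1 + k = (j + k) + 1 by omega, dtrwSteps_succ hS]
    have h1 : ∀ w ∈ (hS (s + 1)).nbrs x,
        stepKernel (c (s + 1)) x w * dtrwSteps c (j + k) (s + 1) w z =
        ∑ y ∈ T, stepKernel (c (s + 1)) x w * dtrwSteps c j (s + 1) w y *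
          dtrwSteps c k (s + (j + 1)) y z := by
      intro w hw
      have hE := (hS _).mem_nbrs.1 hw
      rw [ih (s + 1) w z T, Finset.mul_sum]
      · exact Finset.sum_congr rfl fun y _ => by
          rw [show s + 1 + j = s + (j + 1) by omega, mul_assoc]
      · intro y hy
        have := gdist_le_add_one (hS 0).connected hE y
        exact hT y (by omega)
    rw [Finset.sum_congr rfl h1, Finset.sum_comm]
    refine Finset.sum_congr rfl fun y _ => ?_
    rw [dtrwSteps_succ hS, Finset.sum_mul]

theorem dtrwSteps_one (hS : ∀ i, Snapshot E v Cv (c i)) (s : ℕ) (x z : V) :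
    dtrwSteps c 1 s x z = stepKernel (c (s + 1)) x z := by
  rw [dtrwSteps_succ hS]
  by_cases hE : E x z
  · rw [Finset.sum_eq_single z]
    · rw [dtrwSteps_zero_self, mul_one]
    · intro y _ hy; rw [dtrwSteps_zero_ne _ _ hy, mul_zero]
    · intro hz; exact absurd ((hS _).mem_nbrs.2 hE) hz
  · rw [(hS (s + 1)).stepKernel_zero hE]
    refine Finset.sum_eq_zero fun y hy => ?_
    rw [dtrwSteps_zero_ne, mul_zero]
    rintro rfl
    exact hE ((hS _).mem_nbrs.1 hy)

/-- Transition probabilities to `z` at the fixed time `t`, indexed by the elapsed time. -/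
noncomputable def backward (c : ℕ → V → V → ℝ) (t : ℕ) (z : V) : ℕ → V → ℝ
  | 0 => fun x => dtrwSteps c 0 t x z
  | k + 1 => fun x => ∑' y, stepKernel (c (t - k)) x y * backward c t z k y

theorem backward_eq (t : ℕ) (z : V) (k : ℕ) :
    k ≤ t → ∀ x, backward c t z k x = dtrwSteps c k (t - k) x z := by
  induction k with
  | zero => intro _ x; simp [backward]
  | succ k ih =>
    intro hk x
    rw [backward, dtrwSteps, show t - (k + 1) + 1 = t - k by omega]
    exact tsum_congr fun y => by rw [ih (by omega)]

theorem backward_nonneg (hS : ∀ i, Snapshot E v Cv (c i)) (t : ℕ) (z : V) (k : ℕ) :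
    ∀ x, 0 ≤ backward c t z k x := by
  induction k with
  | zero => exact fun x => dtrwSteps_nonneg hS 0 t x z
  | succ k ih =>
    exact fun x => tsum_nonneg fun y => mul_nonneg ((hS _).stepKernel_nonneg _ _) (ih y)

variable {CP α : ℝ}

/-- Going back in time decreases `π`, so after each averaging step the new reference measure is
dominated by the old one. -/
theorem backward_chain (hS : ∀ i, Snapshot E v Cv (c i)) (hP : ∀ i, PoincareAt E (c i) CP)
    (hl : ∀ i x, α ≤ stepKernel (c i) x x) (hm : ∀ x, Monotone fun i => vertexCond (c i) x)
    (t : ℕ) (z : V) :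
    Chain E v Cv CP α (fun k => c (t - k)) (backward c t z) z where
  snap _ := hS _
  poincare _ := hP _
  lazy _ := hl _
  nonneg k x := backward_nonneg hS t z k x
  mass k x := mul_le_mul_of_nonneg_right (hm x (by omega)) (backward_nonneg hS t z (k + 1) x)
  sq k x := mul_le_mul_of_nonneg_right (hm x (by omega)) (sq_nonneg _)
  start x hx := dtrwSteps_zero_ne c t hx
  start_le := by
    change _ * dtrwSteps c 0 t z z ≤ _
    rw [dtrwSteps_zero_self, mul_one]
    exact (hS _).vertexCond_le z

/-- By reversibility of the step at time `s + k + 1`, the law evolves like its density with respect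
to `π_{s+k+1}`, averaged by the same kernel. -/
theorem forward_step (hS : ∀ i, Snapshot E v Cv (c i)) (s : ℕ) (x : V) (k : ℕ) (y : V) :
    dtrwSteps c (k + 1) s x y = vertexCond (c (s + k + 1)) y *
      ∑' w, stepKernel (c (s + k + 1)) y w *
        (dtrwSteps c k s x w / vertexCond (c (s + k + 1)) w) := by
  have h := hS (s + k + 1)
  set T := (hS 0).ball x k
  have hT : ∀ y, gdist E x y ≤ k → y ∈ T := fun y hy =>
    (hS 0).mem_ball.2 (by exact_mod_cast hy)
  rw [dtrwSteps_add hS k 1 s x y T hT, h.tsum_stepKernel_mul, Finset.mul_sum]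
  have h1 : ∑ w ∈ h.nbrs y, vertexCond (c (s + k + 1)) y * (stepKernel (c (s + k + 1)) y w *
        (dtrwSteps c k s x w / vertexCond (c (s + k + 1)) w)) =
      ∑ w ∈ h.nbrs y, c (s + k + 1) y w *
        (dtrwSteps c k s x w / vertexCond (c (s + k + 1)) w) :=
    Finset.sum_congr rfl fun w _ => by rw [← mul_assoc, h.vertexCond_mul_stepKernel]
  rw [h1, h.sum_nbrs_eq (T := T)
    (F := fun _ w => dtrwSteps c k s x w / vertexCond (c (s + k + 1)) w)]
  · refine Finset.sum_congr rfl fun w _ => ?_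
    rw [dtrwSteps_one hS, h.symm y w, stepKernel]
    ring
  · intro w _ hw
    rw [dtrwSteps_support hS k s x w (not_le.1 fun hle => hw (hT w hle)), zero_div]

/-- The density at elapsed time `k` is taken with respect to `π_{s+k+1}`, the measure that is
reversible for the next step. Changing to the larger measure `π_{s+k+2}` keeps the mass and
multiplies the squared density, integrated at a point, by a ratio at most one. -/
theorem forward_chain (hS : ∀ i, Snapshot E v Cv (c i)) (hP : ∀ i, PoincareAt E (c i) CP)
    (hl : ∀ i x, α ≤ stepKernel (c i) x x) (hm : ∀ x, Monotone fun i => vertexCond (c i) x)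
    (s : ℕ) (x : V) :
    Chain E v Cv CP α (fun k => c (s + k + 1))
      (fun k y => dtrwSteps c k s x y / vertexCond (c (s + k + 1)) y) x where
  snap _ := hS _
  poincare _ := hP _
  lazy _ := hl _
  nonneg k y := div_nonneg (dtrwSteps_nonneg hS _ _ _ _) ((hS _).vertexCond_pos _).le
  mass k y := by
    rw [← forward_step hS s x k y, mul_div_cancel₀ _ ((hS _).vertexCond_pos y).ne']
  sq k y := by
    have h1 := (hS (s + k + 1)).vertexCond_pos y
    have h2 := (hS (s + (k + 1) + 1)).vertexCond_pos y
    have h3 : vertexCond (c (s + k + 1)) y ≤ vertexCond (c (s + (k + 1) + 1)) y :=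
      hm y (by omega)
    rw [forward_step hS s x k y]
    set S := ∑' w, stepKernel (c (s + k + 1)) y w *
        (dtrwSteps c k s x w / vertexCond (c (s + k + 1)) w)
    set p := vertexCond (c (s + k + 1)) y
    set q := vertexCond (c (s + (k + 1) + 1)) y
    have h4 : q * (p * S / q) ^ 2 = p * S ^ 2 * (p / q) := by field_simp
    rw [h4]
    exact mul_le_of_le_one_right (by positivity) ((div_le_one h2).2 h3)
  start y hy := by rw [dtrwSteps_zero_ne c s (Ne.symm hy), zero_div]
  start_le := by
    rw [mul_div_cancel₀ _ ((hS _).vertexCond_pos x).ne', dtrwSteps_zero_self]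
    exact (hS 0).one_le

end Discrete

universe u

/-- Gaussian upper bound in exponential form for lazy walks. -/
theorem dtrwSteps_le (Cv CP α : ℝ) (hα : 0 < α) : ∃ C : ℝ, 1 ≤ C ∧
    ∀ (V : Type u) (E : V → V → Prop) (v : ℝ → ℝ) (c : ℕ → V → V → ℝ)
      (_ : ∀ i, Snapshot E v Cv (c i)) (_ : ∀ i, PoincareAt E (c i) CP)
      (_ : ∀ i x, α ≤ stepKernel (c i) x x) (_ : ∀ x, Monotone fun i => vertexCond (c i) x)
      (n s : ℕ) (x z : V) (l : ℝ), 0 ≤ l → l ≤ 1 →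
      dtrwSteps c n s x z ≤
        C / v (Real.sqrt n) * Real.exp (-(l * gdist E x z) + C * l ^ 2 * n) := by
  by_cases hC : 1 ≤ Cv
  swap
  · exact ⟨1, le_rfl, fun V E v c hS => absurd (hS 0).one_le hC⟩
  have hC0 : 0 < Cv := one_pos.trans_le hC
  obtain ⟨C₀, hC₀, hch⟩ := chain_gaussian.{u} Cv CP α hα
  refine ⟨Cv ^ 2 * C₀ + 1, by nlinarith [mul_pos (pow_pos hC0 2) hC₀],
    fun V E v c hS hP hl hm n s x z l hl0 hl1 => ?_⟩
  set j := n / 2 with hj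
  set k := n - j with hk
  have hjk : j + k = n := by omega
  have h := hS 0
  have hfw := hch V E v _ _ x (forward_chain hS hP hl hm s x) j l hl0 hl1
  have hbw := hch V E v _ _ z (backward_chain hS hP hl hm (s + n) z) k l hl0 hl1
  set T := h.ball x j with hTdef
  have hT : ∀ y, gdist E x y ≤ j → y ∈ T := fun y hy => h.mem_ball.2 (by exact_mod_cast hy)
  have hP0 := dtrwSteps_nonneg hS
  set X : V → ℝ := fun y => vertexCond (c (s + j + 1)) y * Real.exp (2 * l * gdist E x y) *
    (dtrwSteps c j s x y / vertexCond (c (s + j + 1)) y) ^ 2 with hX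
  set Y : V → ℝ := fun y => vertexCond (c (s + j)) y * Real.exp (2 * l * gdist E z y) *
    dtrwSteps c k (s + j) y z ^ 2 with hY
  have hX0 : ∀ y, 0 ≤ X y := fun y => mul_nonneg (mul_nonneg ((hS _).vertexCond_pos _).le
    (Real.exp_pos _).le) (sq_nonneg _)
  have hY0 : ∀ y, 0 ≤ Y y := fun y => mul_nonneg (mul_nonneg ((hS _).vertexCond_pos _).le
    (Real.exp_pos _).le) (sq_nonneg _)
  have hXs : ∑ y ∈ T, X y ≤ C₀ * Real.exp (C₀ * l ^ 2 * j) / v (Real.sqrt j) := hfw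
  have hYs : ∑ y ∈ T, Y y ≤ C₀ * Real.exp (C₀ * l ^ 2 * k) / v (Real.sqrt k) := by
    refine le_trans ?_ hbw
    have h1 : (backward_chain hS hP hl hm (s + n) z).F l k = ∑ y ∈ h.ball z k, Y y := by
      unfold Chain.F
      refine Finset.sum_congr rfl fun y _ => ?_
      simp only [hY]
      rw [backward_eq (s + n) z k (by omega), show s + n - k = s + j by omega]
    rw [h1]
    refine sum_le_sum_of_support hY0 fun y _ hy => ?_
    have : k < gdist E y z := by
      rw [h.mem_ball, gdist_comm, not_le] at hy
      exact_mod_cast hy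
    simp only [hY]
    rw [dtrwSteps_support hS k _ y z this]
    ring
  -- The kernel is split at the middle time, the weight is distributed by the triangle inequality,
  -- and Cauchy–Schwarz separates the forward chain from `x` and the backward chain from `z`.
  have hCS : (Real.exp (l * gdist E x z) * dtrwSteps c n s x z) ^ 2 ≤
      Cv ^ 2 * ((∑ y ∈ T, X y) * ∑ y ∈ T, Y y) := by
    have h1 : Real.exp (l * gdist E x z) * dtrwSteps c n s x z ≤
        ∑ y ∈ T, (Real.exp (l * gdist E x y) * dtrwSteps c j s x y) *
          (Real.exp (l * gdist E y z) * dtrwSteps c k (s + j) y z) := by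
      rw [← hjk, dtrwSteps_add hS j k s x z T hT, Finset.mul_sum]
      refine Finset.sum_le_sum fun y _ => ?_
      have h2 : Real.exp (l * gdist E x z) ≤
          Real.exp (l * gdist E x y) * Real.exp (l * gdist E y z) := by
        rw [← Real.exp_add, ← mul_add]
        refine Real.exp_le_exp.2 (mul_le_mul_of_nonneg_left ?_ hl0)
        exact_mod_cast gdist_triangle h.connected x y z
      calc _ ≤ Real.exp (l * gdist E x y) * Real.exp (l * gdist E y z) *
            (dtrwSteps c j s x y * dtrwSteps c k (s + j) y z) :=
            mul_le_mul_of_nonneg_right h2 (mul_nonneg (hP0 _ _ _ _) (hP0 _ _ _ _))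
        _ = _ := by ring
    refine (pow_le_pow_left₀ (mul_nonneg (Real.exp_pos _).le (hP0 _ _ _ _)) h1 2).trans ?_
    have h3 := Finset.sum_sq_le_sum_mul_sum_of_sq_le_mul T
      (r := fun y => (Real.exp (l * gdist E x y) * dtrwSteps c j s x y) *
          (Real.exp (l * gdist E y z) * dtrwSteps c k (s + j) y z))
      (f := fun y => Cv ^ 2 * X y) (g := Y) (fun y _ => mul_nonneg (by positivity) (hX0 y))
      (fun y _ => hY0 y) (fun y _ => ?_)
    · rw [← Finset.mul_sum, mul_assoc] at h3
      exact h3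
    · have e1 : Real.exp (2 * l * gdist E x y) = Real.exp (l * gdist E x y) ^ 2 := by
        rw [← Real.exp_nat_mul]; congr 1; push_cast; ring
      have e2 : Real.exp (2 * l * gdist E z y) = Real.exp (l * gdist E y z) ^ 2 := by
        rw [← Real.exp_nat_mul, gdist_comm E z y]; congr 1; push_cast; ring
      have p1 := (hS (s + j)).vertexCond_pos y
      have p2 := (hS (s + j + 1)).vertexCond_pos y
      -- The forward chain is measured with `π_{s+j+1}` and the backward chain with `π_{s+j}`; the
      -- mismatch costs a factor `Cv ^ 2`.
      have p3 : 1 ≤ Cv ^ 2 * (vertexCond (c (s + j)) y / vertexCond (c (s + j + 1)) y) := by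
        rw [← mul_div_assoc, one_le_div p2]
        have q1 := (hS (s + j)).one_le_mul_vertexCond y
        have q2 := (hS (s + j + 1)).vertexCond_le y
        nlinarith
      simp only [hX, hY, e1, e2]
      set A := Real.exp (l * gdist E x y) * dtrwSteps c j s x y
      set B := Real.exp (l * gdist E y z) * dtrwSteps c k (s + j) y z
      calc (A * B) ^ 2 ≤ (A * B) ^ 2 *
            (Cv ^ 2 * (vertexCond (c (s + j)) y / vertexCond (c (s + j + 1)) y)) :=
            le_mul_of_one_le_right (sq_nonneg _) p3
        _ = _ := by simp only [A, B]; field_simp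
  have hvj := h.v_pos (Real.sqrt_nonneg (j : ℝ))
  have hvk := h.v_pos (Real.sqrt_nonneg (k : ℝ))
  have hvn := h.v_pos (Real.sqrt_nonneg (n : ℝ))
  have hsq : ∀ i : ℕ, n ≤ 4 * i → v (Real.sqrt n) ≤ Cv * v (Real.sqrt i) := by
    intro i hi
    have := h.v_le_of_le_two_pow_mul 1 (Real.sqrt_nonneg i) (Real.sqrt_nonneg n) ?_
    · simpa using this
    have h4 : (n : ℝ) ≤ (2 ^ 1) ^ 2 * i := by norm_num; exact_mod_cast hi
    calc Real.sqrt n ≤ Real.sqrt ((2 ^ 1) ^ 2 * i) := Real.sqrt_le_sqrt h4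
      _ = 2 ^ 1 * Real.sqrt i := by
        rw [Real.sqrt_mul (by positivity), Real.sqrt_sq (by norm_num)]
  have hvnk := hsq k (by omega)
  have hvnj : v (Real.sqrt n) ≤ Cv * v (Real.sqrt j) := by
    -- For `n ≤ 1` the first half is empty, `j = 0`, but then `v (√n) = 1`.
    by_cases hn : 2 ≤ n
    · exact hsq j (by omega)
    · have h1 : v (Real.sqrt n) = 1 := h.v_eq_one (Real.sqrt_nonneg _)
        (Real.sqrt_le_iff.2 ⟨zero_le_one, by
          rw [one_pow]; exact_mod_cast (by omega : n ≤ 1)⟩)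
      rw [h1]
      have := h.one_le_v (Real.sqrt_nonneg (j : ℝ))
      nlinarith
  have hmain : Real.exp (l * gdist E x z) * dtrwSteps c n s x z ≤
      Cv ^ 2 * C₀ / v (Real.sqrt n) * Real.exp (C₀ * l ^ 2 * n) := by
    refine le_of_sq_le_sq (hCS.trans ?_) (by positivity)
    have h1 : (∑ y ∈ T, X y) * ∑ y ∈ T, Y y ≤
        (C₀ * Real.exp (C₀ * l ^ 2 * j) / v (Real.sqrt j)) *
        (C₀ * Real.exp (C₀ * l ^ 2 * k) / v (Real.sqrt k)) :=
      mul_le_mul hXs hYs (Finset.sum_nonneg fun y _ => hY0 y) (by positivity)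
    have h2 : Real.exp (C₀ * l ^ 2 * j) * Real.exp (C₀ * l ^ 2 * k) ≤
        Real.exp (C₀ * l ^ 2 * n) ^ 2 := by
      rw [← Real.exp_add, ← Real.exp_nat_mul]
      refine Real.exp_le_exp.2 ?_
      have : (n : ℝ) = j + k := by exact_mod_cast hjk.symm
      rw [this]
      push_cast
      have : 0 ≤ C₀ * l ^ 2 * (j + k) := by positivity
      nlinarith
    have h3 : v (Real.sqrt n) ^ 2 ≤ Cv ^ 2 * (v (Real.sqrt j) * v (Real.sqrt k)) := by
      calc v (Real.sqrt n) ^ 2 = v (Real.sqrt n) * v (Real.sqrt n) := pow_two _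
        _ ≤ (Cv * v (Real.sqrt j)) * (Cv * v (Real.sqrt k)) :=
          mul_le_mul hvnj hvnk hvn.le (by positivity)
        _ = _ := by ring
    calc Cv ^ 2 * ((∑ y ∈ T, X y) * ∑ y ∈ T, Y y)
        ≤ Cv ^ 2 * ((C₀ * Real.exp (C₀ * l ^ 2 * j) / v (Real.sqrt j)) *
          (C₀ * Real.exp (C₀ * l ^ 2 * k) / v (Real.sqrt k))) :=
          mul_le_mul_of_nonneg_left h1 (by positivity)
      _ = Cv ^ 2 * C₀ ^ 2 * (Real.exp (C₀ * l ^ 2 * j) * Real.exp (C₀ * l ^ 2 * k)) /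
          (v (Real.sqrt j) * v (Real.sqrt k)) := by field_simp
      _ ≤ Cv ^ 2 * C₀ ^ 2 * Real.exp (C₀ * l ^ 2 * n) ^ 2 /
          (v (Real.sqrt j) * v (Real.sqrt k)) := by gcongr
      _ ≤ Cv ^ 2 * C₀ ^ 2 * Real.exp (C₀ * l ^ 2 * n) ^ 2 /
          (v (Real.sqrt n) ^ 2 / Cv ^ 2) := by
          refine div_le_div_of_nonneg_left (by positivity) (by positivity) ?_
          rw [div_le_iff₀ (by positivity)]
          linarith
      _ = _ := by field_simp
  have hCC : C₀ ≤ Cv ^ 2 * C₀ + 1 := by nlinarith [one_le_pow₀ (n := 2) hC]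
  have h5 : dtrwSteps c n s x z = Real.exp (-(l * gdist E x z)) *
      (Real.exp (l * gdist E x z) * dtrwSteps c n s x z) := by
    rw [← mul_assoc, ← Real.exp_add]; simp
  rw [h5]
  calc _ ≤ Real.exp (-(l * gdist E x z)) *
        (Cv ^ 2 * C₀ / v (Real.sqrt n) * Real.exp (C₀ * l ^ 2 * n)) :=
        mul_le_mul_of_nonneg_left hmain (Real.exp_pos _).le
    _ ≤ Real.exp (-(l * gdist E x z)) *
        ((Cv ^ 2 * C₀ + 1) / v (Real.sqrt n) * Real.exp ((Cv ^ 2 * C₀ + 1) * l ^ 2 * n)) := by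
        gcongr
        linarith
    _ = _ := by rw [Real.exp_add]; ring

theorem poincareAt_of_uniform {V ι : Type*} [Zero ι] [Preorder ι] {E : V → V → Prop}
    {c : ι → V → V → ℝ} {CP : ℝ} (hP : UniformPoincare E c CP) {t : ι} (ht : 0 ≤ t) :
    PoincareAt E (c t) CP := fun f x₀ r hr => hP f x₀ t r ht hr

theorem decayFactor_of_le {I : ℝ → EReal} (hI : ∀ r, r ≤ 1 → I r = ((r ^ 2 : ℝ) : EReal))
    {C τ : ℝ} {d : ℕ} (hτ : 0 < τ) (hd : (d : ℝ) ≤ τ) :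
    decayFactor I C τ d = Real.exp (-((d : ℝ) ^ 2 / (C * τ))) := by
  rw [decayFactor, if_neg hτ.ne', hI _ ((div_le_one hτ).2 hd), ← EReal.coe_mul, ← EReal.coe_neg,
    EReal.exp_coe, ENNReal.toReal_ofReal (Real.exp_pos _).le]
  congr 2
  field_simp

theorem upperBound_dtrw (CP Cv αl : ℝ) (hα : 0 < αl) : ∃ C : ℝ, 0 < C ∧
      ∀ (V : Type u) (E : V → V → Prop) (c : ℕ → V → V → ℝ) (v : ℝ → ℝ),
        StandingDTRW E c v Cv αl → UniformPoincare E c CP → UpperBoundDTRW E c v C := by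
  obtain ⟨C, hC, hb⟩ := dtrwSteps_le.{u} Cv CP αl hα
  have hC0 : 0 < C := one_pos.trans_le hC
  refine ⟨4 * C, by positivity, fun V E c v hst hP s t x z hst' => ?_⟩
  have hS : ∀ i, Snapshot E v Cv (c i) := fun i =>
    snapshot_of_network hst.network hst.growth (Nat.zero_le i)
  have hb' := hb V E v c hS (fun i => poincareAt_of_uniform hP (Nat.zero_le i))
    (fun i => hst.lazy i (Nat.zero_le i))
    (fun x i j hij => hst.monotone x (mem_Ici.2 (Nat.zero_le i)) (mem_Ici.2 (Nat.zero_le j)) hij)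
    (t - s) s x z
  rw [dtrwKernel, ← Nat.cast_sub hst']
  set n := t - s
  have hvn := (hS 0).v_pos (Real.sqrt_nonneg (n : ℝ))
  have hC4 : C / v (Real.sqrt n) ≤ 4 * C / v (Real.sqrt n) := by gcongr; linarith
  rcases Nat.eq_zero_or_pos n with hn | hn
  · rw [hn, decayFactor, Nat.cast_zero, if_pos rfl, Real.sqrt_zero, (hS 0).v_zero]
    by_cases hxz : x = z
    · subst hxz
      rw [dtrwSteps_zero_self, gdist_self, if_pos rfl]
      linarith
    · rw [dtrwSteps_zero_ne _ _ hxz, if_neg fun h0 => hxz ((gdist_eq_zero (hS 0).connected).1 h0)]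
      simp
  have hnpos : (0 : ℝ) < n := by exact_mod_cast hn
  by_cases hd : gdist E x z ≤ n
  · have hd' : (gdist E x z : ℝ) ≤ n := by exact_mod_cast hd
    rw [decayFactor_of_le (I := rateDTRW) (fun r hr => if_pos hr) hnpos hd']
    set d : ℝ := (gdist E x z : ℝ)
    -- This rate minimises `-l d + C l² n`, with minimum `-d² / (4 C n)`; hence the final constant
    -- `4 * C`.
    have h1 := hb' (d / (2 * C * n)) (by positivity) (by
      rw [div_le_one (by positivity)]
      nlinarith)
    refine h1.trans (mul_le_mul hC4 (Real.exp_le_exp.2 (le_of_eq ?_)) (Real.exp_pos _).le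
      (by positivity))
    field_simp
    ring
  · rw [dtrwSteps_support hS n s x z (not_le.1 hd)]
    have : 0 ≤ decayFactor rateDTRW (4 * C) n (gdist E x z) := by
      unfold decayFactor
      split_ifs <;> simp
    positivity

end TimeVaryingWalk

namespace TimeVaryingWalk

universe u w

/-! ### Exponential volume sums -/

/-- Since `exp (-x) ≤ k! / x ^ k` with `2 ^ k > 2 Cv`, the terms are dominated by a geometric series
of ratio `1 / 2`. This is the sum over dyadic shells in `volume_sum`. -/
theorem exists_bound_sum (Cv η : ℝ) (hC : 0 < Cv) (hη : 0 < η) : ∃ B : ℝ, 0 ≤ B ∧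
    ∀ J : ℕ, ∑ j ∈ Finset.range J, Cv ^ (j + 1) * Real.exp (-(η * 2 ^ j)) ≤ B := by
  obtain ⟨k, hk⟩ := pow_unbounded_of_one_lt (2 * Cv) (by norm_num : (1 : ℝ) < 2)
  set A := Cv * (k.factorial / η ^ k) with hA
  have hA0 : 0 < A := by positivity
  refine ⟨A * 2, by positivity, fun J => ?_⟩
  have hterm : ∀ j : ℕ, Cv ^ (j + 1) * Real.exp (-(η * 2 ^ j)) ≤ A * (1 / 2) ^ j := by
    intro j
    have h1 := Real.pow_div_factorial_le_exp (η * 2 ^ j) (by positivity) k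
    have h2 : Real.exp (-(η * 2 ^ j)) ≤ k.factorial / (η * 2 ^ j) ^ k := by
      rw [Real.exp_neg, inv_le_comm₀ (Real.exp_pos _) (by positivity), inv_div]
      exact h1
    have h3 : Cv ^ j ≤ (2 ^ k) ^ j * (1 / 2) ^ j := by
      rw [← mul_pow]; exact pow_le_pow_left₀ hC.le (by linarith) j
    calc Cv ^ (j + 1) * Real.exp (-(η * 2 ^ j))
        ≤ Cv * ((2 ^ k) ^ j * (1 / 2) ^ j) * (k.factorial / (η * 2 ^ j) ^ k) := by
          rw [pow_succ, mul_comm (Cv ^ j)]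
          gcongr
      _ = A * (1 / 2) ^ j := by
          rw [hA, mul_pow, ← pow_mul (2 : ℝ) k j, ← pow_mul (2 : ℝ) j k, mul_comm k j]
          field_simp
  calc _ ≤ ∑ j ∈ Finset.range J, A * (1 / 2 : ℝ) ^ j := Finset.sum_le_sum fun j _ => hterm j
    _ = A * ∑ j ∈ Finset.range J, (1 / 2 : ℝ) ^ j := (Finset.mul_sum _ _ _).symm
    _ ≤ A * 2 := mul_le_mul_of_nonneg_left (sum_geometric_two_le J) hA0.le

/-- The value at `q` is at most the term of the dyadic shell that contains `q`; writing the shells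
as full balls makes them directly measurable by `v`. -/
theorem exp_le_shells {η q : ℝ} (hη : 0 < η) (J : ℕ) (hq : q ≤ 2 ^ J) (hq0 : 0 ≤ q) :
    Real.exp (-(η * q)) ≤ (if q ≤ 1 then 1 else 0) +
      ∑ j ∈ Finset.range J, (if q ≤ 2 ^ (j + 1) then Real.exp (-(η * 2 ^ j)) else 0) := by
  induction J with
  | zero =>
    rw [pow_zero] at hq
    rw [if_pos hq, Finset.sum_range_zero, add_zero, Real.exp_le_one_iff]
    have := mul_nonneg hη.le hq0
    linarith
  | succ J ih =>
    rw [Finset.sum_range_succ, ← add_assoc, if_pos hq]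
    by_cases hqJ : q ≤ 2 ^ J
    · exact (ih hqJ).trans (le_add_of_nonneg_right (Real.exp_pos _).le)
    · push Not at hqJ
      refine (Real.exp_le_exp.2 ?_).trans (le_add_of_nonneg_left ?_)
      · have := mul_le_mul_of_nonneg_left hqJ.le hη.le
        linarith
      · refine add_nonneg (by split_ifs <;> norm_num) (Finset.sum_nonneg fun j _ => ?_)
        split_ifs
        · exact (Real.exp_pos _).le
        · exact le_rfl

/-- The shell of radius `2 ^ (j + 1) ρ` has at most `Cv ^ 2 * Cv ^ (j + 1) * v ρ` vertices by
doubling, and the exponential weight beats this growth. -/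
theorem volume_sum (Cv η : ℝ) (hη : 0 < η) : ∃ B : ℝ, 0 < B ∧
    ∀ (V : Type u) (E : V → V → Prop) (v : ℝ → ℝ) (a : V → V → ℝ) (_ : Snapshot E v Cv a)
      (z : V) (ρ : ℝ), 1 ≤ ρ → ∀ X : Finset V,
      ∑ x ∈ X, Real.exp (-(η * (gdist E z x / ρ))) ≤ B * v ρ := by
  by_cases hC : 1 ≤ Cv
  swap
  · exact ⟨1, one_pos, fun V E v a h => absurd h.one_le hC⟩
  have hC0 : 0 < Cv := one_pos.trans_le hC
  obtain ⟨B, hB0, hB⟩ := exists_bound_sum Cv η hC0 hη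
  refine ⟨Cv ^ 2 * (1 + B), by positivity, fun V E v a h z ρ hρ X => ?_⟩
  classical
  have hρ0 : 0 < ρ := one_pos.trans_le hρ
  have hv := h.v_pos hρ0.le
  have hcard : ∀ j : ℕ, ∑ x ∈ X, (if (gdist E z x : ℝ) / ρ ≤ 2 ^ j then (1 : ℝ) else 0) ≤
      Cv ^ 2 * (Cv ^ j * v ρ) := by
    intro j
    rw [← Finset.sum_filter]
    calc ∑ x ∈ X with (gdist E z x : ℝ) / ρ ≤ 2 ^ j, (1 : ℝ)
        ≤ ∑ x ∈ X with (gdist E z x : ℝ) / ρ ≤ 2 ^ j, Cv * vertexCond a x :=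
          Finset.sum_le_sum fun x _ => h.one_le_mul_vertexCond x
      _ ≤ ∑ x ∈ h.ball z (2 ^ j * ρ), Cv * vertexCond a x := by
          refine sum_le_sum_of_support
            (fun x => mul_nonneg hC0.le (h.vertexCond_pos x).le) fun x hx hx' => ?_
          exfalso
          rw [Finset.mem_filter, div_le_iff₀ hρ0] at hx
          exact hx' (h.mem_ball.2 hx.2)
      _ ≤ Cv * (Cv * v (2 ^ j * ρ)) := by
          rw [← Finset.mul_sum]
          exact mul_le_mul_of_nonneg_left (h.vol_le z (by positivity)) hC0.le
      _ ≤ Cv * (Cv * (Cv ^ j * v ρ)) := by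
          have := h.v_two_pow_mul j hρ0.le
          gcongr
      _ = _ := by ring
  obtain ⟨J, hJ⟩ : ∃ J : ℕ, ∀ x ∈ X, (gdist E z x : ℝ) / ρ ≤ 2 ^ J := by
    refine ⟨∑ x ∈ X, gdist E z x, fun x hx => ?_⟩
    have h1 : gdist E z x ≤ ∑ x ∈ X, gdist E z x :=
      Finset.single_le_sum (f := fun x => gdist E z x) (fun _ _ => Nat.zero_le _) hx
    calc (gdist E z x : ℝ) / ρ ≤ gdist E z x := div_le_self (by positivity) hρ
      _ ≤ ((2 ^ (∑ x ∈ X, gdist E z x) : ℕ) : ℝ) := by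
          exact_mod_cast h1.trans Nat.lt_two_pow_self.le
      _ = _ := by push_cast; rfl
  calc ∑ x ∈ X, Real.exp (-(η * (gdist E z x / ρ)))
      ≤ ∑ x ∈ X, ((if (gdist E z x : ℝ) / ρ ≤ 1 then (1 : ℝ) else 0) +
        ∑ j ∈ Finset.range J,
          (if (gdist E z x : ℝ) / ρ ≤ 2 ^ (j + 1) then Real.exp (-(η * 2 ^ j)) else 0)) :=
        Finset.sum_le_sum fun x hx => exp_le_shells hη J (hJ x hx) (by positivity)
    _ = ∑ x ∈ X, (if (gdist E z x : ℝ) / ρ ≤ 1 then (1 : ℝ) else 0) +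
        ∑ j ∈ Finset.range J, Real.exp (-(η * 2 ^ j)) *
          ∑ x ∈ X, (if (gdist E z x : ℝ) / ρ ≤ 2 ^ (j + 1) then (1 : ℝ) else 0) := by
        rw [Finset.sum_add_distrib, Finset.sum_comm]
        simp only [Finset.mul_sum, mul_ite, mul_one, mul_zero]
    _ ≤ Cv ^ 2 * v ρ + ∑ j ∈ Finset.range J, Real.exp (-(η * 2 ^ j)) *
          (Cv ^ 2 * (Cv ^ (j + 1) * v ρ)) := by
        refine add_le_add ?_ (Finset.sum_le_sum fun j _ =>
          mul_le_mul_of_nonneg_left (hcard (j + 1)) (Real.exp_pos _).le)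
        simpa using hcard 0
    _ = Cv ^ 2 * v ρ + Cv ^ 2 * v ρ *
          ∑ j ∈ Finset.range J, Cv ^ (j + 1) * Real.exp (-(η * 2 ^ j)) := by
        rw [Finset.mul_sum]
        congr 1
        exact Finset.sum_congr rfl fun j _ => by ring
    _ ≤ Cv ^ 2 * v ρ + Cv ^ 2 * v ρ * B :=
        add_le_add le_rfl (mul_le_mul_of_nonneg_left (hB J) (by positivity))
    _ = _ := by ring

/-! ### Two-sided estimates for a family of transition probabilities -/

/-- Transition probabilities `K` of a walk among time-increasing conductances `c`, with the
Gaussian upper bound in exponential form and the Harnack inequality for `K`. The map `e` embeds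
the time set into `ℝ`. -/
structure WalkFamily {V : Type u} {ι : Type w} [LinearOrder ι] (e : ι → ℝ) (E : V → V → Prop)
    (v : ℝ → ℝ) (Cv C₁ l₀ CF : ℝ) (g : ℝ → ℝ) (c : ι → V → V → ℝ) (K : ι → ι → V → V → ℝ) :
    Prop where
  e_mono : ∀ s t, s ≤ t → e s ≤ e t
  split : ∀ s t δ, s ≤ t → 0 ≤ δ → δ ≤ e t - e s →
    ∃ m, s ≤ m ∧ m ≤ t ∧ δ - 1 < e m - e s ∧ e m - e s ≤ δ
  snap : ∀ t, Snapshot E v Cv (c t)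
  nonneg : ∀ s t, s ≤ t → ∀ x y, 0 ≤ K s t x y
  mass : ∀ s t, s ≤ t → ∀ (X : Finset V) (y : V),
    ∑ x ∈ X, vertexCond (c s) x * K s t x y ≤ vertexCond (c t) y
  row : ∀ s t, s ≤ t → ∀ (x : V) (Y : Finset V), ∑ y ∈ Y, K s t x y ≤ 1
  ck : ∀ s m t, s ≤ m → m ≤ t → ∀ x z, K s t x z ≤ ∑' y, K s m x y * K m t y z
  upper : ∀ s t, s ≤ t → ∀ x y l, 0 ≤ l → l ≤ l₀ → K s t x y ≤
    C₁ / v (Real.sqrt (e t - e s)) *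
      Real.exp (-(l * gdist E x y) + C₁ * l ^ 2 * (e t - e s))
  harnack : ∀ A s m T t, 1 ≤ A → s ≤ m → m ≤ T → T ≤ t → e s < e T →
    1 / 8 * (e T - e s) ≤ e T - e m → e T - e m ≤ 3 / 4 * (e T - e s) →
    ∀ x₁ x₂ y, (gdist E x₁ x₂ : ℝ) ≤ A * Real.sqrt (e T - e s) →
      (gdist E x₁ x₂ : ℝ) ≤ e m - e s → g A * K m t x₁ y ≤ K s t x₂ y
  crude : ∀ s t, s ≤ t → ∀ x y, (gdist E x y : ℝ) ≤ e t - e s →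
    Real.exp (-(CF * (1 + (e t - e s)))) ≤ K s t x y

namespace WalkFamily

section

variable {V : Type u} {ι : Type w} [LinearOrder ι] {e : ι → ℝ} {E : V → V → Prop}
  {v : ℝ → ℝ} {Cv C₁ l₀ CF : ℝ} {g : ℝ → ℝ} {c : ι → V → V → ℝ} {K : ι → ι → V → V → ℝ}

variable (H : WalkFamily e E v Cv C₁ l₀ CF g c K)
include H

theorem le_one {s t : ι} (hst : s ≤ t) (x y : V) : K s t x y ≤ 1 := by
  simpa using H.row s t hst x {y}

theorem term_nonneg {s t : ι} (hst : s ≤ t) (y x : V) : 0 ≤ vertexCond (c s) x * K s t x y :=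
  mul_nonneg ((H.snap s).vertexCond_pos x).le (H.nonneg s t hst x y)

theorem summable_mass {s t : ι} (hst : s ≤ t) (y : V) :
    Summable fun x => vertexCond (c s) x * K s t x y :=
  summable_of_sum_le (H.term_nonneg hst y) fun X => H.mass s t hst X y

theorem sum_le_evol {s t : ι} (hst : s ≤ t) (y : V) (X : Finset V) :
    ∑ x ∈ X, vertexCond (c s) x * K s t x y ≤ evolMeasure c K s t y :=
  (H.summable_mass hst y).sum_le_tsum X fun x _ => H.term_nonneg hst y x

theorem evol_le {s t : ι} (hst : s ≤ t) (y : V) : evolMeasure c K s t y ≤ Cv :=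
  ((H.summable_mass hst y).tsum_le_of_sum_le fun X => H.mass s t hst X y).trans
    ((H.snap t).vertexCond_le y)

theorem evol_nonneg {s t : ι} (hst : s ≤ t) (y : V) : 0 ≤ evolMeasure c K s t y :=
  tsum_nonneg (H.term_nonneg hst y)

theorem le_evol {s t : ι} (hst : s ≤ t) (y : V) :
    Cv⁻¹ * Real.exp (-(CF * (1 + (e t - e s)))) ≤ evolMeasure c K s t y := by
  have h1 := H.sum_le_evol hst y {y}
  rw [Finset.sum_singleton] at h1
  refine le_trans (mul_le_mul ((H.snap s).le_vertexCond y) (H.crude s t hst y y ?_)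
    (Real.exp_pos _).le ((H.snap s).vertexCond_pos y).le) h1
  rw [gdist_self, Nat.cast_zero]
  linarith [H.e_mono s t hst]

theorem summable_ck {s m t : ι} (hsm : s ≤ m) (hmt : m ≤ t) (x z : V) :
    Summable fun y => K s m x y * K m t y z := by
  refine summable_of_sum_le (c := 1) (fun y => mul_nonneg (H.nonneg s m hsm x y)
    (H.nonneg m t hmt y z)) fun Y => ?_
  refine le_trans (Finset.sum_le_sum fun y _ => ?_) (H.row s m hsm x Y)
  exact mul_le_of_le_one_right (H.nonneg s m hsm x y) (H.le_one hmt y z)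

/-- Splitting a weighted sum of transition probabilities at an intermediate time. -/
theorem sum_le_tsum {s m t : ι} (hsm : s ≤ m) (hmt : m ≤ t) (y : V) (X : Finset V) {p : V → ℝ}
    (hp : ∀ x, 0 ≤ p x) {q : V → ℝ} (hq : ∀ z, ∑ x ∈ X, p x * K s m x z ≤ q z)
    (hs : Summable fun z => q z * K m t z y) :
    ∑ x ∈ X, p x * K s t x y ≤ ∑' z, q z * K m t z y := by
  have h1 : ∀ x ∈ X, Summable fun z => p x * (K s m x z * K m t z y) := fun x _ =>
    (H.summable_ck hsm hmt x y).mul_left _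
  calc ∑ x ∈ X, p x * K s t x y ≤ ∑ x ∈ X, ∑' z, p x * (K s m x z * K m t z y) := by
        refine Finset.sum_le_sum fun x _ => ?_
        rw [tsum_mul_left]
        exact mul_le_mul_of_nonneg_left (H.ck s m t hsm hmt x y) (hp x)
    _ = ∑' z, ∑ x ∈ X, p x * (K s m x z * K m t z y) := (Summable.tsum_finsetSum h1).symm
    _ ≤ _ := by
        refine (summable_sum h1).tsum_le_tsum (fun z => ?_) hs
        have := mul_le_mul_of_nonneg_right (hq z) (H.nonneg m t hmt z y)
        refine le_trans (le_of_eq ?_) this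
        rw [Finset.sum_mul]
        exact Finset.sum_congr rfl fun x _ => by ring

/-- The measure `π_s` evolved up to time `m` is dominated by `π_m`, and evolving both up to `t`
keeps the order. -/
theorem evol_anti {s m t : ι} (hsm : s ≤ m) (hmt : m ≤ t) (y : V) :
    evolMeasure c K s t y ≤ evolMeasure c K m t y := by
  refine (H.summable_mass (hsm.trans hmt) y).tsum_le_of_sum_le fun X => ?_
  exact H.sum_le_tsum hsm hmt y X (fun x => ((H.snap s).vertexCond_pos x).le)
    (fun z => H.mass s m hsm X z) (H.summable_mass hmt y)

/-- Comparison of transition probabilities and evolving measures at comparable times. -/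
theorem doubling (hg : 0 < g 1) {s m t : ι} (hsm : s ≤ m) (hmt : m ≤ t)
    (hτ : 16 ≤ e t - e s) (h1 : 1 / 8 * (e t - e s) ≤ e t - e m)
    (h2 : e t - e m ≤ 3 / 4 * (e t - e s)) (y : V) :
    (∀ z, K m t z y * v (Real.sqrt (e t - e s)) ≤ Cv ^ 2 / g 1 * evolMeasure c K s t y) ∧
      evolMeasure c K m t y ≤ Cv ^ 2 / g 1 * evolMeasure c K s t y := by
  classical
  have hst := hsm.trans hmt
  set ρ := Real.sqrt (e t - e s) with hρ
  -- Then `ρ ≤ ρ² / 4 ≤ e m - e s`, so all vertices within `ρ` meet the distance condition of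
  -- `harnack`.
  have hρ4 : 4 ≤ ρ := by
    rw [hρ, Real.le_sqrt (by norm_num) (by linarith)]; norm_num; exact hτ
  have hρ2 : ρ ^ 2 = e t - e s := Real.sq_sqrt (by linarith)
  have hv := (H.snap s).v_pos (Real.sqrt_nonneg (e t - e s))
  have hC := (H.snap s).Cv_pos
  have hC1 := (H.snap s).one_le
  have hvρ : v ρ ≠ 0 := hv.ne'
  set B : V → Finset V := fun z => (H.snap s).ball z ρ with hB
  -- The Harnack inequality, with `T = t`, is averaged against `π_s` over the ball of radius `ρ`
  -- around `z`. Bounding the average by `μ_{s,t}(y)` gives the first claim; summing over `z`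
  -- against `π_m` and exchanging the sums gives the second.
  have hlow : ∀ z, g 1 * K m t z y * (Cv⁻¹ * v ρ) ≤
      ∑ x ∈ B z, vertexCond (c s) x * K s t x y := by
    intro z
    have : 0 ≤ g 1 * K m t z y := mul_nonneg hg.le (H.nonneg m t hmt z y)
    refine (mul_le_mul_of_nonneg_left ((H.snap s).le_vol z (by positivity)) this).trans ?_
    rw [mul_comm, Finset.sum_mul]
    refine Finset.sum_le_sum fun x hx => ?_
    refine mul_le_mul_of_nonneg_left ?_ ((H.snap s).vertexCond_pos x).le
    have hd := (H.snap s).mem_ball.1 hx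
    exact H.harnack 1 s m t t le_rfl hsm hmt le_rfl (by linarith) h1 h2 z x y
      (by rw [one_mul]; exact hd) (by nlinarith)
  constructor
  · intro z
    have h3 := (hlow z).trans (H.sum_le_evol hst y (B z))
    have h4 := mul_le_mul_of_nonneg_left h3 (by positivity : 0 ≤ Cv / g 1)
    have h5 : Cv / g 1 * (g 1 * K m t z y * (Cv⁻¹ * v ρ)) = K m t z y * v ρ := by field_simp
    rw [h5] at h4
    refine h4.trans (mul_le_mul_of_nonneg_right ?_ (H.evol_nonneg hst y))
    gcongr
    nlinarith
  · refine (H.summable_mass hmt y).tsum_le_of_sum_le fun Z => ?_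
    have h3 : (g 1 * (Cv⁻¹ * v ρ)) * ∑ z ∈ Z, vertexCond (c m) z * K m t z y ≤
        Cv * v ρ * evolMeasure c K s t y := by
      calc (g 1 * (Cv⁻¹ * v ρ)) * ∑ z ∈ Z, vertexCond (c m) z * K m t z y
          = ∑ z ∈ Z, vertexCond (c m) z * (g 1 * K m t z y * (Cv⁻¹ * v ρ)) := by
            rw [Finset.mul_sum]
            exact Finset.sum_congr rfl fun z _ => by ring
        _ ≤ ∑ z ∈ Z, vertexCond (c m) z * ∑ x ∈ B z, vertexCond (c s) x * K s t x y :=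
            Finset.sum_le_sum fun z _ =>
              mul_le_mul_of_nonneg_left (hlow z) ((H.snap m).vertexCond_pos z).le
        _ = ∑ z ∈ Z, ∑ x ∈ Z.biUnion B, (if x ∈ B z then
              vertexCond (c m) z * (vertexCond (c s) x * K s t x y) else 0) := by
            refine Finset.sum_congr rfl fun z hz => ?_
            rw [← Finset.sum_filter, Finset.filter_mem_eq_inter,
              Finset.inter_eq_right.2 (Finset.subset_biUnion_of_mem B hz), Finset.mul_sum]
        _ = ∑ x ∈ Z.biUnion B, vertexCond (c s) x * K s t x y *
              ∑ z ∈ Z with x ∈ B z, vertexCond (c m) z := by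
            rw [Finset.sum_comm]
            refine Finset.sum_congr rfl fun x _ => ?_
            rw [← Finset.sum_filter, Finset.mul_sum]
            exact Finset.sum_congr rfl fun z _ => by ring
        _ ≤ ∑ x ∈ Z.biUnion B, vertexCond (c s) x * K s t x y * (Cv * v ρ) := by
            refine Finset.sum_le_sum fun x _ =>
              mul_le_mul_of_nonneg_left ?_ (H.term_nonneg hst y x)
            refine le_trans (sum_le_sum_of_support (fun z => ((H.snap m).vertexCond_pos z).le)
              fun z hz hz' => ?_) ((H.snap m).vol_le x (Real.sqrt_nonneg (e t - e s)))
            exfalso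
            rw [Finset.mem_filter, hB, Snapshot.mem_ball_comm] at hz
            exact hz' ((H.snap m).mem_ball.2 ((H.snap s).mem_ball.1 hz.2))
        _ ≤ _ := by
            rw [← Finset.sum_mul, mul_comm]
            exact mul_le_mul_of_nonneg_left (H.sum_le_evol hst y _) (by positivity)
    have h4 := mul_le_mul_of_nonneg_left h3 (by positivity : 0 ≤ Cv / (g 1 * v ρ))
    have h5 : ∀ S : ℝ, Cv / (g 1 * v ρ) * (g 1 * (Cv⁻¹ * v ρ) * S) = S := fun S => by field_simp
    have h6 : ∀ S : ℝ, Cv / (g 1 * v ρ) * (Cv * v ρ * S) = Cv ^ 2 / g 1 * S := fun S => by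
      field_simp
    rwa [h5, h6] at h4

/-- A chain of applications of the Harnack inequality along a geodesic. -/
theorem harnack_chain (hg : 0 < g 1) {l : ℕ} (hl : 1 ≤ l) (n : ℕ) :
    ∀ {s t : ι}, s ≤ t → ∀ {x z : V} (y : V), gdist E x z ≤ n * l →
      (n + 1) * (4 * (l : ℝ) ^ 2) ≤ e t - e s →
      ∃ s', s ≤ s' ∧ s' ≤ t ∧ g 1 ^ n * K s' t z y ≤ K s t x y := by
  induction n with
  | zero =>
    intro s t hst x z y hd _
    have : x = z := (gdist_eq_zero (H.snap s).connected).1 (by omega)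
    subst this
    exact ⟨s, le_rfl, hst, by simp⟩
  | succ n ih =>
    intro s t hst x z y hd hτ
    have hl' : (1 : ℝ) ≤ l := by exact_mod_cast hl
    -- Each link moves a distance of at most `l`, advances time by at most `δ`, and looks ahead by
    -- `2 δ`; the extra unit in `(n + 1)` pays for the last look-ahead. As `δ ≥ 4`, the loss of less
    -- than one time unit in `split` keeps `(e T - e m) / (e T - e s)` inside `[1/8, 3/4]`.
    set δ : ℝ := 4 * (l : ℝ) ^ 2 with hδ
    have hδ4 : 4 ≤ δ := by nlinarith
    have hn0 : (0 : ℝ) ≤ n := Nat.cast_nonneg n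
    push_cast at hτ
    have hτ2 : 2 * δ ≤ e t - e s := by nlinarith
    obtain ⟨T, hsT, hTt, hT1, hT2⟩ := H.split s t (2 * δ) hst (by linarith) hτ2
    obtain ⟨m, hsm, hmT, hm1, hm2⟩ := H.split s T δ hsT (by linarith) (by linarith)
    obtain ⟨w, hw1, hw2⟩ := exists_between (H.snap s).connected (H.snap s).edge_symm
      (min l (gdist E x z)) (x := x) (y := z) (min_le_right _ _)
    have hwl : gdist E x w ≤ l := hw1 ▸ min_le_left _ _
    have hwz : gdist E w z ≤ n * l := by
      rw [hw2]
      rw [add_mul, one_mul] at hd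
      rcases le_total l (gdist E x z) with h | h
      · rw [min_eq_left h]; omega
      · rw [min_eq_right h]; omega
    obtain ⟨s', h1, h2, h3⟩ := ih (hmT.trans hTt) y hwz (by nlinarith)
    refine ⟨s', hsm.trans h1, h2, ?_⟩
    have hwl' : (gdist E w x : ℝ) ≤ l := by rw [gdist_comm]; exact_mod_cast hwl
    have h4 := H.harnack 1 s m T t le_rfl hsm hmT hTt (by linarith) (by linarith) (by linarith)
      w x y (by
        rw [one_mul]
        refine hwl'.trans (Real.le_sqrt_of_sq_le ?_)
        nlinarith) (by nlinarith)
    calc g 1 ^ (n + 1) * K s' t z y = g 1 * (g 1 ^ n * K s' t z y) := by ring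
      _ ≤ g 1 * K m t w y := mul_le_mul_of_nonneg_left h3 hg.le
      _ ≤ _ := h4

end

end WalkFamily

end TimeVaryingWalk

/-! ### Exponential moments of the kernels and of the evolving measure. -/

namespace TimeVaryingWalk

universe u w

/-- The upper bound is used at the slightly larger rate `l + l₀ / (2 ρ)`. On the parabolic scale `ρ`
the surplus costs only a constant factor, and it leaves a decay in `d / ρ` that can be summed
against the volume. -/
theorem WalkFamily.pointwise_moment {V : Type u} {ι : Type w} [LinearOrder ι] {e : ι → ℝ}
    {E : V → V → Prop} {v : ℝ → ℝ} {Cv C₁ l₀ CF : ℝ} {g : ℝ → ℝ} {c : ι → V → V → ℝ}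
    {K : ι → ι → V → V → ℝ} (H : WalkFamily e E v Cv C₁ l₀ CF g c K) (hC₁ : 0 < C₁)
    (hl₀ : 0 < l₀) {s t : ι} (hst : s ≤ t) (x y : V) {l : ℝ} (hl : 0 ≤ l) (hl2 : l ≤ l₀ / 2) :
    K s t x y * Real.exp (l * gdist E x y) ≤
      C₁ * Real.exp (C₁ * l₀ ^ 2) * Real.exp (2 * C₁ * l ^ 2 * (e t - e s)) *
        (Real.exp (-(l₀ / 2 * (gdist E x y / max 1 (Real.sqrt (e t - e s))))) /
          v (max 1 (Real.sqrt (e t - e s)))) := by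
  have h := H.snap s
  have hτ : 0 ≤ e t - e s := by linarith [H.e_mono s t hst]
  set τ := e t - e s
  set ρ := max 1 (Real.sqrt τ) with hρ
  have hρ1 : 1 ≤ ρ := le_max_left _ _
  have hρ0 : 0 < ρ := one_pos.trans_le hρ1
  have hv : v (Real.sqrt τ) = v ρ := by
    rcases le_total (Real.sqrt τ) 1 with h1 | h1
    · rw [h.v_eq_one (Real.sqrt_nonneg _) h1, hρ, max_eq_left h1, h.v_one]
    · rw [hρ, max_eq_right h1]
  have hτρ : τ ≤ ρ ^ 2 := by
    rw [← Real.sq_sqrt hτ]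
    exact pow_le_pow_left₀ (Real.sqrt_nonneg _) (le_max_right _ _) 2
  have hvρ := h.v_pos hρ0.le
  set d : ℝ := (gdist E x y : ℝ)
  have hη : l₀ / 2 / ρ ≤ l₀ / 2 := div_le_self (by positivity) hρ1
  have h1 := H.upper s t hst x y (l + l₀ / 2 / ρ) (by positivity) (by linarith)
  rw [hv] at h1
  have h2 : C₁ * (l + l₀ / 2 / ρ) ^ 2 * τ ≤ C₁ * l₀ ^ 2 + 2 * C₁ * l ^ 2 * τ := by
    have e1 : (l + l₀ / 2 / ρ) ^ 2 ≤ 2 * l ^ 2 + 2 * (l₀ / 2 / ρ) ^ 2 := by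
      nlinarith [sq_nonneg (l - l₀ / 2 / ρ)]
    have e2 : (l₀ / 2 / ρ) ^ 2 * τ ≤ (l₀ / 2) ^ 2 := by
      rw [div_pow (l₀ / 2) ρ, div_mul_eq_mul_div, div_le_iff₀ (by positivity)]
      exact mul_le_mul_of_nonneg_left hτρ (by positivity)
    have e3 : (l + l₀ / 2 / ρ) ^ 2 * τ ≤ 2 * l ^ 2 * τ + 2 * (l₀ / 2) ^ 2 := by
      have := mul_le_mul_of_nonneg_right e1 hτ
      linarith
    have e4 := mul_le_mul_of_nonneg_left e3 hC₁.le
    have e5 : 0 ≤ C₁ * l₀ ^ 2 := by positivity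
    linarith
  calc K s t x y * Real.exp (l * d)
      ≤ (C₁ / v ρ * Real.exp (-((l + l₀ / 2 / ρ) * d) + C₁ * (l + l₀ / 2 / ρ) ^ 2 * τ)) *
        Real.exp (l * d) := mul_le_mul_of_nonneg_right h1 (Real.exp_pos _).le
    _ = C₁ / v ρ * Real.exp (-(l₀ / 2 * (d / ρ)) + C₁ * (l + l₀ / 2 / ρ) ^ 2 * τ) := by
        rw [mul_assoc, ← Real.exp_add]
        congr 2
        ring
    _ ≤ C₁ / v ρ * Real.exp (-(l₀ / 2 * (d / ρ)) + (C₁ * l₀ ^ 2 + 2 * C₁ * l ^ 2 * τ)) := by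
        gcongr
    _ = _ := by
        rw [Real.exp_add, Real.exp_add]
        ring

section Constants

variable (Cv C₁ l₀ CF : ℝ) (g : ℝ → ℝ)

/-- Exponential moments. -/
theorem exp_moment (hC₁ : 0 < C₁) (hl₀ : 0 < l₀) : ∃ B : ℝ, 0 < B ∧
    ∀ (V : Type u) (ι : Type w) [LinearOrder ι] (e : ι → ℝ) (E : V → V → Prop) (v : ℝ → ℝ)
      (c : ι → V → V → ℝ) (K : ι → ι → V → V → ℝ), WalkFamily e E v Cv C₁ l₀ CF g c K →
      ∀ (s t : ι), s ≤ t → ∀ l, 0 ≤ l → l ≤ l₀ / 2 → ∀ (z : V) (X : Finset V),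
        ∑ x ∈ X, K s t x z * Real.exp (l * gdist E x z) ≤
          B * Real.exp (B * l ^ 2 * (e t - e s)) ∧
        ∑ x ∈ X, K s t z x * Real.exp (l * gdist E z x) ≤
          B * Real.exp (B * l ^ 2 * (e t - e s)) := by
  obtain ⟨B₀, hB₀, hB⟩ := volume_sum.{u} Cv (l₀ / 2) (by positivity)
  set A := C₁ * Real.exp (C₁ * l₀ ^ 2) * B₀ with hA
  have hA0 : 0 < A := by positivity
  refine ⟨A + 2 * C₁, by positivity, fun V ι _ e E v c K H s t hst l hl hl2 z X => ?_⟩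
  have h := H.snap s
  have hτ : 0 ≤ e t - e s := by linarith [H.e_mono s t hst]
  set τ := e t - e s
  set ρ := max 1 (Real.sqrt τ) with hρ
  have hρ1 : 1 ≤ ρ := le_max_left _ _
  have hvρ := h.v_pos (zero_le_one.trans hρ1)
  have hvol := hB V E v _ h z ρ hρ1 X
  have key : C₁ * Real.exp (C₁ * l₀ ^ 2) * Real.exp (2 * C₁ * l ^ 2 * τ) *
      ((∑ x ∈ X, Real.exp (-(l₀ / 2 * (gdist E z x / ρ)))) / v ρ) ≤
      (A + 2 * C₁) * Real.exp ((A + 2 * C₁) * l ^ 2 * τ) := by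
    have h1 : (∑ x ∈ X, Real.exp (-(l₀ / 2 * (gdist E z x / ρ)))) / v ρ ≤ B₀ := by
      rw [div_le_iff₀ hvρ]; exact hvol
    calc _ ≤ C₁ * Real.exp (C₁ * l₀ ^ 2) * Real.exp (2 * C₁ * l ^ 2 * τ) * B₀ :=
          mul_le_mul_of_nonneg_left h1 (by positivity)
      _ = A * Real.exp (2 * C₁ * l ^ 2 * τ) := by rw [hA]; ring
      _ ≤ _ := by
          gcongr
          · linarith
          · linarith
  constructor
  · refine le_trans (Finset.sum_le_sum fun x _ =>
      H.pointwise_moment hC₁ hl₀ hst x z hl hl2) (le_trans (le_of_eq ?_) key)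
    rw [Finset.sum_div, Finset.mul_sum]
    exact Finset.sum_congr rfl fun x _ => by rw [gdist_comm E x z]
  · refine le_trans (Finset.sum_le_sum fun x _ =>
      H.pointwise_moment hC₁ hl₀ hst z x hl hl2) (le_trans (le_of_eq ?_) key)
    rw [Finset.sum_div, Finset.mul_sum]

end Constants

namespace WalkFamily

variable {V : Type u} {ι : Type w} [LinearOrder ι] {e : ι → ℝ} {E : V → V → Prop}
  {v : ℝ → ℝ} {Cv C₁ l₀ CF : ℝ} {g : ℝ → ℝ} {c : ι → V → V → ℝ} {K : ι → ι → V → V → ℝ}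

/-- Exponential moment of the evolving measure seen from the target. -/
noncomputable def W (_ : WalkFamily e E v Cv C₁ l₀ CF g c K) (l : ℝ) (s t : ι) (y : V) : ℝ :=
  ∑' x, vertexCond (c s) x * K s t x y * Real.exp (l * gdist E x y)

/-- The conclusion of `exp_moment` for one family. -/
def HasMoments (_ : WalkFamily e E v Cv C₁ l₀ CF g c K) (B : ℝ) : Prop :=
  ∀ (s t : ι), s ≤ t → ∀ l, 0 ≤ l → l ≤ l₀ / 2 → ∀ (z : V) (X : Finset V),
    ∑ x ∈ X, K s t x z * Real.exp (l * gdist E x z) ≤ B * Real.exp (B * l ^ 2 * (e t - e s)) ∧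
    ∑ x ∈ X, K s t z x * Real.exp (l * gdist E z x) ≤ B * Real.exp (B * l ^ 2 * (e t - e s))

variable (H : WalkFamily e E v Cv C₁ l₀ CF g c K)
include H

theorem W_term_nonneg (l : ℝ) {s t : ι} (hst : s ≤ t) (y x : V) :
    0 ≤ vertexCond (c s) x * K s t x y * Real.exp (l * gdist E x y) :=
  mul_nonneg (H.term_nonneg hst y x) (Real.exp_pos _).le

theorem W_sum_le {B : ℝ} (hB : H.HasMoments B) {s t : ι} (hst : s ≤ t) {l : ℝ} (hl : 0 ≤ l)
    (hl2 : l ≤ l₀ / 2) (y : V) (X : Finset V) :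
    ∑ x ∈ X, vertexCond (c s) x * K s t x y * Real.exp (l * gdist E x y) ≤
      Cv * (B * Real.exp (B * l ^ 2 * (e t - e s))) := by
  have hC := (H.snap s).Cv_pos
  refine le_trans ?_ (mul_le_mul_of_nonneg_left (hB s t hst l hl hl2 y X).1 hC.le)
  rw [Finset.mul_sum]
  refine Finset.sum_le_sum fun x _ => ?_
  rw [mul_assoc]
  exact mul_le_mul_of_nonneg_right ((H.snap s).vertexCond_le x)
    (mul_nonneg (H.nonneg s t hst x y) (Real.exp_pos _).le)

theorem W_summable {B : ℝ} (hB : H.HasMoments B) {s t : ι} (hst : s ≤ t) {l : ℝ} (hl : 0 ≤ l)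
    (hl2 : l ≤ l₀ / 2) (y : V) :
    Summable fun x => vertexCond (c s) x * K s t x y * Real.exp (l * gdist E x y) :=
  summable_of_sum_le (H.W_term_nonneg l hst y) fun X => H.W_sum_le hB hst hl hl2 y X

theorem W_nonneg (l : ℝ) {s t : ι} (hst : s ≤ t) (y : V) : 0 ≤ H.W l s t y :=
  tsum_nonneg (H.W_term_nonneg l hst y)

/-- The weight factorises along the triangle inequality through the position at time `m`, and the
first part of the path is controlled by the moments of `K s m`. -/
theorem W_split {B : ℝ} (hB0 : 0 < B) (hB : H.HasMoments B) {s m t : ι} (hsm : s ≤ m)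
    (hmt : m ≤ t) {l : ℝ} (hl : 0 ≤ l) (hl2 : l ≤ l₀ / 2) (y : V) :
    H.W l s t y ≤ Cv ^ 2 * B * Real.exp (B * l ^ 2 * (e m - e s)) * H.W l m t y := by
  have hst := hsm.trans hmt
  have hC := (H.snap s).Cv_pos
  set M := B * Real.exp (B * l ^ 2 * (e m - e s)) with hM
  have hM0 : 0 < M := by positivity
  refine (H.W_summable hB hst hl hl2 y).tsum_le_of_sum_le fun X => ?_
  have h1 := H.sum_le_tsum hsm hmt y X
    (p := fun x => vertexCond (c s) x * Real.exp (l * gdist E x y))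
    (fun x => mul_nonneg ((H.snap s).vertexCond_pos x).le (Real.exp_pos _).le)
    (q := fun z => Cv ^ 2 * M * (vertexCond (c m) z * Real.exp (l * gdist E z y))) ?_ ?_
  · refine le_trans (le_of_eq ?_) (h1.trans (le_of_eq ?_))
    · exact Finset.sum_congr rfl fun x _ => by ring
    · rw [W, ← tsum_mul_left]
      exact tsum_congr fun z => by rw [hM]; ring
  · intro z
    have h2 : ∑ x ∈ X, vertexCond (c s) x * Real.exp (l * gdist E x y) * K s m x z ≤
        Real.exp (l * gdist E z y) *
          ∑ x ∈ X, vertexCond (c s) x * K s m x z * Real.exp (l * gdist E x z) := by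
      rw [Finset.mul_sum]
      refine Finset.sum_le_sum fun x _ => ?_
      have h3 : Real.exp (l * gdist E x y) ≤
          Real.exp (l * gdist E x z) * Real.exp (l * gdist E z y) := by
        rw [← Real.exp_add, ← mul_add]
        refine Real.exp_le_exp.2 (mul_le_mul_of_nonneg_left ?_ hl)
        exact_mod_cast gdist_triangle (H.snap s).connected x z y
      calc _ = vertexCond (c s) x * K s m x z * Real.exp (l * gdist E x y) := by ring
        _ ≤ vertexCond (c s) x * K s m x z *
            (Real.exp (l * gdist E x z) * Real.exp (l * gdist E z y)) :=
            mul_le_mul_of_nonneg_left h3 (H.term_nonneg hsm z x)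
        _ = _ := by ring
    have h4 := H.W_sum_le hB hsm hl hl2 z X
    calc _ ≤ Real.exp (l * gdist E z y) * (Cv * M) :=
          h2.trans (mul_le_mul_of_nonneg_left h4 (Real.exp_pos _).le)
      _ ≤ Real.exp (l * gdist E z y) * (Cv * M) * (Cv * vertexCond (c m) z) :=
          le_mul_of_one_le_right (by positivity) ((H.snap m).one_le_mul_vertexCond z)
      _ = _ := by ring
  · refine ((H.W_summable hB hmt hl hl2 y).mul_left (Cv ^ 2 * M)).congr fun z => ?_
    ring

/-- The analogue of `F_holder`, with the mass of the evolving measure in the place of the unweighted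
norm. -/
theorem W_holder {B : ℝ} (hB : H.HasMoments B) {s t : ι} (hst : s ≤ t)
    {l : ℝ} (hl : 0 ≤ l) (hl2 : 2 * l ≤ l₀ / 2) (y : V) :
    H.W l s t y ^ 2 ≤ H.W (2 * l) s t y * evolMeasure c K s t y := by
  have hP : 0 ≤ H.W (2 * l) s t y * evolMeasure c K s t y :=
    mul_nonneg (H.W_nonneg _ hst y) (H.evol_nonneg hst y)
  rw [← Real.le_sqrt (H.W_nonneg _ hst y) hP]
  refine (H.W_summable hB hst hl (by linarith) y).tsum_le_of_sum_le fun X => ?_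
  refine Real.le_sqrt_of_sq_le ?_
  have h1 := Finset.sum_sq_le_sum_mul_sum_of_sq_le_mul X
    (r := fun x => vertexCond (c s) x * K s t x y * Real.exp (l * gdist E x y))
    (f := fun x => vertexCond (c s) x * K s t x y * Real.exp (2 * l * gdist E x y))
    (g := fun x => vertexCond (c s) x * K s t x y)
    (fun x _ => H.W_term_nonneg (2 * l) hst y x) (fun x _ => H.term_nonneg hst y x)
    (fun x _ => le_of_eq (by
      have : Real.exp (2 * l * gdist E x y) = Real.exp (l * gdist E x y) ^ 2 := by
        rw [← Real.exp_nat_mul]; congr 1; push_cast; ring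
      rw [this]; ring))
  refine h1.trans (mul_le_mul ?_ (H.sum_le_evol hst y X)
    (Finset.sum_nonneg fun x _ => H.term_nonneg hst y x) (H.W_nonneg _ hst y))
  exact (H.W_summable hB hst (by linarith) hl2 y).sum_le_tsum X
    fun x _ => H.W_term_nonneg (2 * l) hst y x

end WalkFamily

section Constants

variable (Cv C₁ l₀ CF : ℝ) (g : ℝ → ℝ)

/-- Gaussian concentration of the evolving measure near the target. -/
theorem evol_moment (hC₁ : 0 < C₁) (hl₀ : 0 < l₀) (hCF : 0 ≤ CF) (hg : 0 < g 1) :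
    ∃ C : ℝ, 0 < C ∧
    ∀ (V : Type u) (ι : Type w) [LinearOrder ι] (e : ι → ℝ) (E : V → V → Prop) (v : ℝ → ℝ)
      (c : ι → V → V → ℝ) (K : ι → ι → V → V → ℝ) (H : WalkFamily e E v Cv C₁ l₀ CF g c K)
      (s t : ι), s ≤ t → ∀ l, 0 ≤ l → l ≤ l₀ / 2 → ∀ y : V,
        H.W l s t y ≤ C * Real.exp (C * l ^ 2 * (e t - e s)) * evolMeasure c K s t y := by
  by_cases hCv : 1 ≤ Cv
  swap
  · exact ⟨1, one_pos, fun V ι _ e E v c K H s => absurd (H.snap s).one_le hCv⟩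
  have hCv0 : 0 < Cv := one_pos.trans_le hCv
  obtain ⟨B, hB0, hmom⟩ := exp_moment.{u, w} Cv C₁ l₀ CF g hC₁ hl₀
  set D := Cv ^ 2 / g 1 with hD
  set B' := Cv ^ 2 * B with hB'
  have hD0 : 0 < D := by positivity
  have hB'0 : 0 < B' := by positivity
  -- The summands serve, in order, short times (`1 + τ ≤ 21`), the square root taken in the
  -- induction, the cost of `W_split`, and large rates.
  set C := B' * Real.exp (21 * CF) + (B' * D) ^ 2 + 3 * B + 16 * CF / l₀ ^ 2 with hC
  have p1 : 0 < B' * Real.exp (21 * CF) := by positivity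
  have p2 : 0 < (B' * D) ^ 2 := by positivity
  have p3 : 0 ≤ 16 * CF / l₀ ^ 2 := by positivity
  have hC0 : 0 < C := by positivity
  have c1 : B' * Real.exp (21 * CF) ≤ C := by linarith
  have c2 : (B' * D) ^ 2 ≤ C := by linarith
  have c3 : B + 16 * CF / l₀ ^ 2 ≤ C := by linarith
  have c4 : 5 / 2 * B ≤ C := by linarith
  refine ⟨C, hC0, fun V ι _ e E v c K H => ?_⟩
  have hB : H.HasMoments B := hmom V ι e E v c K H
  suffices hN : ∀ N : ℕ, ∀ s t : ι, s ≤ t → e t - e s ≤ 20 * 2 ^ N → ∀ l, 0 ≤ l → l ≤ l₀ / 2 →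
      ∀ y : V, H.W l s t y ≤ C * Real.exp (C * l ^ 2 * (e t - e s)) * evolMeasure c K s t y by
    intro s t hst
    obtain ⟨N, hN'⟩ := pow_unbounded_of_one_lt (e t - e s) (by norm_num : (1 : ℝ) < 2)
    exact hN N s t hst (hN'.le.trans (by linarith [pow_pos (two_pos : (0 : ℝ) < 2) N]))
  -- For bounded times, or rates bounded below, the moment bound is compared directly with the lower
  -- bound of `le_evol`. For `l > l₀ / 4` the factor `exp (CF τ)` is swallowed by a multiple of `l²
  -- τ` in the exponent.
  have crude : ∀ s t : ι, s ≤ t → ∀ l, 0 ≤ l → l ≤ l₀ / 2 →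
      (e t - e s ≤ 20 ∨ l₀ / 4 < l) → ∀ y : V,
      H.W l s t y ≤ C * Real.exp (C * l ^ 2 * (e t - e s)) * evolMeasure c K s t y := by
    intro s t hst l hl hl2 hor y
    have hτ : 0 ≤ e t - e s := by linarith [H.e_mono s t hst]
    set τ := e t - e s
    have h1 : H.W l s t y ≤ Cv * (B * Real.exp (B * l ^ 2 * τ)) :=
      (H.W_summable hB hst hl hl2 y).tsum_le_of_sum_le fun X => H.W_sum_le hB hst hl hl2 y X
    have h2 := H.le_evol hst y
    have h3 : Cv * (B * Real.exp (B * l ^ 2 * τ)) =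
        B' * Real.exp (B * l ^ 2 * τ + CF * (1 + τ)) *
          (Cv⁻¹ * Real.exp (-(CF * (1 + τ)))) := by
      rw [Real.exp_add, Real.exp_neg, hB']
      field_simp
    have h4 : B' * Real.exp (B * l ^ 2 * τ + CF * (1 + τ)) ≤ C * Real.exp (C * l ^ 2 * τ) := by
      have hl2τ : 0 ≤ l ^ 2 * τ := by positivity
      refine le_trans ?_ (mul_le_mul_of_nonneg_right c1 (Real.exp_pos _).le)
      rw [mul_assoc B', ← Real.exp_add]
      refine mul_le_mul_of_nonneg_left (Real.exp_le_exp.2 ?_) hB'0.le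
      rcases hor with h | h
      · have e1 : B * (l ^ 2 * τ) ≤ C * (l ^ 2 * τ) :=
          mul_le_mul_of_nonneg_right (by linarith) hl2τ
        have e2 : CF * (1 + τ) ≤ 21 * CF := by nlinarith
        linarith
      · have e1 : CF * τ ≤ 16 * CF / l₀ ^ 2 * (l ^ 2 * τ) := by
          have e3 : 1 ≤ 16 / l₀ ^ 2 * l ^ 2 := by
            rw [div_mul_eq_mul_div, one_le_div (by positivity)]
            nlinarith
          calc CF * τ ≤ CF * τ * (16 / l₀ ^ 2 * l ^ 2) :=
                le_mul_of_one_le_right (by positivity) e3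
            _ = _ := by ring
        have e2 : (B + 16 * CF / l₀ ^ 2) * (l ^ 2 * τ) ≤ C * (l ^ 2 * τ) :=
          mul_le_mul_of_nonneg_right c3 hl2τ
        linarith
    calc H.W l s t y ≤ _ := h1.trans h3.le
      _ ≤ B' * Real.exp (B * l ^ 2 * τ + CF * (1 + τ)) * evolMeasure c K s t y :=
          mul_le_mul_of_nonneg_left h2 (by positivity)
      _ ≤ _ := mul_le_mul_of_nonneg_right h4 (H.evol_nonneg hst y)
  intro N
  induction N with
  | zero =>
    intro s t hst hτ l hl hl2 y
    exact crude s t hst l hl hl2 (Or.inl (by simpa using hτ)) y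
  | succ N ih =>
    intro s t hst hτN l hl hl2 y
    by_cases hor : e t - e s ≤ 20 ∨ l₀ / 4 < l
    · exact crude s t hst l hl hl2 hor y
    push Not at hor
    obtain ⟨hτ20, hl4⟩ := hor
    -- As `τ > 20`, rounding leaves `e t - e m ≤ 3 τ / 10`. The rate `2 l` over that time gives the
    -- exponent `6 C l² τ / 5`, and `W_holder` halves it; the remaining `2 C l² τ / 5` pays for
    -- `W_split`, while `doubling` returns from `μ_{m,t}` to `μ_{s,t}`.
    obtain ⟨m, hsm, hmt, hm1, hm2⟩ := H.split s t (3 / 4 * (e t - e s)) hst (by linarith)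
      (by linarith)
    set τ := e t - e s
    have hmτ : e t - e m ≤ 3 / 10 * τ := by linarith
    have hdoub := (H.doubling hg hsm hmt (by linarith) (by linarith) (by linarith) y).2
    have hIH := ih m t hmt (by rw [pow_succ] at hτN; linarith) (2 * l) (by linarith)
      (by linarith) y
    set μs := evolMeasure c K s t y
    set μm := evolMeasure c K m t y
    have hμm : 0 ≤ μm := H.evol_nonneg hmt y
    have hμs : 0 ≤ μs := H.evol_nonneg hst y
    have hWm : H.W l m t y ≤ C / (B' * D) * Real.exp (3 / 5 * C * l ^ 2 * τ) * μm := by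
      refine le_of_sq_le_sq ((H.W_holder hB hmt hl (by linarith) y).trans ?_) (by positivity)
      refine (mul_le_mul_of_nonneg_right hIH hμm).trans ?_
      have e1 : Real.exp (C * (2 * l) ^ 2 * (e t - e m)) ≤
          Real.exp (3 / 5 * C * l ^ 2 * τ) ^ 2 := by
        rw [← Real.exp_nat_mul]
        refine Real.exp_le_exp.2 ?_
        have : 0 ≤ C * l ^ 2 := by positivity
        have := mul_le_mul_of_nonneg_left hmτ this
        push_cast
        linarith
      have e2 : C ≤ (C / (B' * D)) ^ 2 := by
        rw [div_pow, le_div_iff₀ p2, sq C]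
        exact mul_le_mul_of_nonneg_left c2 hC0.le
      calc _ = C * Real.exp (C * (2 * l) ^ 2 * (e t - e m)) * μm ^ 2 := by ring
        _ ≤ (C / (B' * D)) ^ 2 * Real.exp (3 / 5 * C * l ^ 2 * τ) ^ 2 * μm ^ 2 := by gcongr
        _ = _ := by ring
    calc H.W l s t y ≤ B' * Real.exp (B * l ^ 2 * (e m - e s)) * H.W l m t y :=
          H.W_split hB0 hB hsm hmt hl hl2 y
      _ ≤ B' * Real.exp (2 / 5 * C * l ^ 2 * τ) *
          (C / (B' * D) * Real.exp (3 / 5 * C * l ^ 2 * τ) * (D * μs)) := by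
          have e1 : B * l ^ 2 * (e m - e s) ≤ 2 / 5 * C * l ^ 2 * τ :=
            mul_le_mul (mul_le_mul_of_nonneg_right (by linarith) (sq_nonneg _)) (by linarith)
              (by linarith [H.e_mono s m hsm]) (by positivity)
          refine mul_le_mul ?_ (hWm.trans ?_) (H.W_nonneg l hmt y) (by positivity)
          · gcongr
          · exact mul_le_mul_of_nonneg_left hdoub (by positivity)
      _ = C * (Real.exp (2 / 5 * C * l ^ 2 * τ) * Real.exp (3 / 5 * C * l ^ 2 * τ)) * μs := by
          field_simp
      _ = _ := by rw [← Real.exp_add]; ring_nf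

end Constants

end TimeVaryingWalk

/-! ### Upper, diagonal and lower bounds for a walk family. -/

namespace TimeVaryingWalk

universe u w

/-- The rate `l = κ d / τ` makes the exponent `-κ (1 - C₃ κ) d² / τ`, and `C₃ κ ≤ 1/2` keeps at
least half of the linear gain. -/
theorem gaussian_exponent_le {κ C₃ C d τ : ℝ} (hκ : 0 < κ) (hτ : 0 < τ)
    (hC₃κ : C₃ * κ ≤ 1 / 2) (hC : 2 / κ ≤ C) :
    -(κ * (d / τ) * d) + C₃ * (κ * (d / τ)) ^ 2 * τ ≤ -(d ^ 2 / (C * τ)) := by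
  have hC0 : 0 < C := lt_of_lt_of_le (by positivity) hC
  have h1 : -(κ * (d / τ) * d) + C₃ * (κ * (d / τ)) ^ 2 * τ =
      -(d ^ 2 / τ * (κ * (1 - C₃ * κ))) := by field_simp; ring
  have h3 : 1 / C ≤ κ * (1 - C₃ * κ) := by
    rw [div_le_iff₀ hC0]
    rw [div_le_iff₀ hκ] at hC
    nlinarith [mul_nonneg hC0.le hκ.le]
  have h5 : d ^ 2 / (C * τ) = d ^ 2 / τ * (1 / C) := by field_simp
  rw [h1, h5]
  exact neg_le_neg (mul_le_mul_of_nonneg_left h3 (by positivity))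

section Constants

variable (Cv C₁ l₀ CF : ℝ) (g : ℝ → ℝ)

-- Chapman–Kolmogorov at the middle time, then Cauchy–Schwarz with the weight on either half. Where
-- the weight sits on the first half, the second kernel is bounded by `μ / v` and the first
-- contributes its moments. Where it sits on the second half, the first kernel is bounded by `1 / v`
-- and the second contributes moments of the evolving measure, again proportional to `μ`. The
-- geometric mean has exactly the prefactor `μ / v`.
set_option maxHeartbeats 1000000 in
theorem family_upper (hC₁ : 0 < C₁) (hl₀ : 0 < l₀) (hCF : 0 ≤ CF) (hg : 0 < g 1) :
    ∃ C : ℝ, 0 < C ∧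
    ∀ (V : Type u) (ι : Type w) [LinearOrder ι] (e : ι → ℝ) (E : V → V → Prop) (v : ℝ → ℝ)
      (c : ι → V → V → ℝ) (K : ι → ι → V → V → ℝ) (_ : WalkFamily e E v Cv C₁ l₀ CF g c K)
      (s t : ι), s ≤ t → ∀ x y : V, (gdist E x y : ℝ) ≤ e t - e s →
        K s t x y ≤ C * evolMeasure c K s t y / v (Real.sqrt (e t - e s)) *
          Real.exp (-((gdist E x y : ℝ) ^ 2 / (C * (e t - e s)))) := by
  by_cases hCv : 1 ≤ Cv
  swap
  · exact ⟨1, one_pos, fun V ι _ e E v c K H s => absurd (H.snap s).one_le hCv⟩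
  have hCv0 : 0 < Cv := one_pos.trans_le hCv
  obtain ⟨B, hB0, hmom⟩ := exp_moment.{u, w} Cv C₁ l₀ CF g hC₁ hl₀
  obtain ⟨C₂, hC₂, hW⟩ := evol_moment.{u, w} Cv C₁ l₀ CF g hC₁ hl₀ hCF hg
  set D := Cv ^ 2 / g 1 with hD
  have hD0 : 0 < D := by positivity
  set Q := D * B * (C₁ * Cv) * (Cv * C₂ * D) with hQ
  have hQ0 : 0 < Q := by positivity
  set C₃ := 2 * (B + C₂) with hC₃
  have hC₃0 : 0 < C₃ := by positivity
  set κ := min (l₀ / 4) (1 / (2 * C₃)) with hκ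
  have hκ0 : 0 < κ := lt_min (by positivity) (by positivity)
  set R := C₁ * Cv * Real.exp (21 * CF + 20) with hR
  have hR0 : 0 < R := by positivity
  have hκ2 : 0 < 2 / κ := by positivity
  have hS0 := Real.sqrt_nonneg Q
  refine ⟨Real.sqrt Q + 2 / κ + R + 1, by positivity,
    fun V ι _ e E v c K H s t hst x y hd => ?_⟩
  set C := Real.sqrt Q + 2 / κ + R + 1 with hC
  have hC1 : 1 ≤ C := by linarith
  have hC0 : 0 < C := by linarith
  have hB : H.HasMoments B := hmom V ι e E v c K H
  have hμ := H.evol_nonneg hst y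
  have hlow := H.le_evol hst y
  have hv := (H.snap s).v_pos (Real.sqrt_nonneg (e t - e s))
  have hτ : 0 ≤ e t - e s := by linarith [H.e_mono s t hst]
  have hd0 : (0 : ℝ) ≤ gdist E x y := Nat.cast_nonneg _
  by_cases hτ20 : e t - e s < 20
  · have h1 := H.upper s t hst x y 0 le_rfl hl₀.le
    set τ := e t - e s
    set μ := evolMeasure c K s t y
    have h0 : -(0 * (gdist E x y : ℝ)) + C₁ * 0 ^ 2 * τ = 0 := by ring
    rw [h0, Real.exp_zero, mul_one] at h1
    have h2 : Cv⁻¹ * Real.exp (-(21 * CF)) ≤ μ := by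
      refine le_trans ?_ hlow
      refine mul_le_mul_of_nonneg_left (Real.exp_le_exp.2 ?_) (by positivity)
      nlinarith
    -- Since `d ≤ τ < 20` and `C ≥ 1`, the Gaussian factor is bounded below; at `τ = 0` the quotient
    -- is `0` by the convention for division.
    have h3 : Real.exp (-20) ≤ Real.exp (-((gdist E x y : ℝ) ^ 2 / (C * τ))) := by
      refine Real.exp_le_exp.2 (neg_le_neg ?_)
      rcases hτ.eq_or_lt with h0 | h0
      · rw [← h0]; simp
      · rw [div_le_iff₀ (by positivity)]
        nlinarith
    have hRC : R ≤ C := by linarith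
    calc K s t x y ≤ C₁ / v (Real.sqrt τ) := h1
      _ = R * (Cv⁻¹ * Real.exp (-(21 * CF))) / v (Real.sqrt τ) * Real.exp (-20) := by
          rw [hR, Real.exp_add, Real.exp_neg, Real.exp_neg]
          field_simp
      _ ≤ C * μ / v (Real.sqrt τ) * Real.exp (-((gdist E x y : ℝ) ^ 2 / (C * τ))) := by
          gcongr
  push Not at hτ20
  obtain ⟨m, hsm, hmt, hm1, hm2⟩ := H.split s t (1 / 2 * (e t - e s)) hst (by linarith)
    (by linarith)
  have hdoub := H.doubling hg hsm hmt (by linarith) (by linarith) (by linarith) y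
  have hup := fun z => H.upper s m hsm x z 0 le_rfl hl₀.le
  have hem : 0 ≤ e m - e s := by linarith
  have hvm := (H.snap s).v_pos (Real.sqrt_nonneg (e m - e s))
  have hvv : v (Real.sqrt (e t - e s)) ≤ Cv * v (Real.sqrt (e m - e s)) := by
    have := (H.snap s).v_le_of_le_two_pow_mul 1 (Real.sqrt_nonneg (e m - e s))
      (Real.sqrt_nonneg (e t - e s)) ?_
    · simpa using this
    calc Real.sqrt (e t - e s) ≤ Real.sqrt ((2 ^ 1) ^ 2 * (e m - e s)) :=
          Real.sqrt_le_sqrt (by linarith)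
      _ = 2 ^ 1 * Real.sqrt (e m - e s) := by
        rw [Real.sqrt_mul (by positivity), Real.sqrt_sq (by norm_num)]
  have hWm := fun l hl hl2 => hW V ι e E v c K H m t hmt l hl hl2 y
  set τ := e t - e s with hτdef
  set μ := evolMeasure c K s t y
  set vr := v (Real.sqrt τ)
  have hgauss : ∀ l, 0 ≤ l → l ≤ l₀ / 4 →
      K s t x y ≤ Real.sqrt Q * (μ / vr) * Real.exp (-(l * gdist E x y) + C₃ * l ^ 2 * τ) := by
    intro l hl hl4
    have hkey : Real.exp (l * gdist E x y) * K s t x y ≤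
        Real.sqrt Q * (μ / vr) * Real.exp (C₃ * l ^ 2 * τ) := by
      have hck : Real.exp (l * gdist E x y) * K s t x y ≤
          ∑' z, Real.exp (l * gdist E x y) * (K s m x z * K m t z y) := by
        rw [tsum_mul_left]
        exact mul_le_mul_of_nonneg_left (H.ck s m t hsm hmt x y) (Real.exp_pos _).le
      refine hck.trans (((H.summable_ck hsm hmt x y).mul_left _).tsum_le_of_sum_le fun Z => ?_)
      refine le_of_sq_le_sq ?_ (by positivity)
      have hn1 : ∀ z, 0 ≤ K s m x z := H.nonneg s m hsm x
      have hn2 : ∀ z, 0 ≤ K m t z y := fun z => H.nonneg m t hmt z y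
      -- Weight on the first half.
      have f1 : ∑ z ∈ Z, K s m x z * Real.exp (2 * l * gdist E x z) * K m t z y ≤
          D * (μ / vr) * (B * Real.exp (4 * B * l ^ 2 * τ)) := by
        have a1 := (hB s m hsm (2 * l) (by linarith) (by linarith) x Z).2
        calc _ ≤ ∑ z ∈ Z, K s m x z * Real.exp (2 * l * gdist E x z) * (D * (μ / vr)) := by
              refine Finset.sum_le_sum fun z _ => mul_le_mul_of_nonneg_left ?_
                (mul_nonneg (hn1 z) (Real.exp_pos _).le)
              rw [← mul_div_assoc, le_div_iff₀ hv]
              exact hdoub.1 z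
          _ = D * (μ / vr) * ∑ z ∈ Z, K s m x z * Real.exp (2 * l * gdist E x z) := by
              rw [← Finset.sum_mul, mul_comm]
          _ ≤ D * (μ / vr) * (B * Real.exp (B * (2 * l) ^ 2 * (e m - e s))) :=
              mul_le_mul_of_nonneg_left a1 (by positivity)
          _ ≤ _ := by
              have : B * (2 * l) ^ 2 * (e m - e s) ≤ 4 * B * l ^ 2 * τ := by
                have b1 : 0 ≤ 4 * B * l ^ 2 := by positivity
                have b2 := mul_le_mul_of_nonneg_left (by linarith : e m - e s ≤ τ) b1
                linarith
              gcongr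
      -- Weight on the second half.
      have f2 : ∑ z ∈ Z, K s m x z * (K m t z y * Real.exp (2 * l * gdist E z y)) ≤
          C₁ * Cv / vr * (Cv * (C₂ * Real.exp (4 * C₂ * l ^ 2 * τ) * (D * μ))) := by
        have a1 : ∀ z, K s m x z ≤ C₁ * Cv / vr := by
          intro z
          have := hup z
          have h0 : -(0 * (gdist E x z : ℝ)) + C₁ * 0 ^ 2 * (e m - e s) = 0 := by ring
          rw [h0, Real.exp_zero, mul_one] at this
          refine this.trans ?_
          rw [div_le_div_iff₀ hvm hv, mul_assoc]
          exact mul_le_mul_of_nonneg_left hvv hC₁.le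
        calc _ ≤ ∑ z ∈ Z, C₁ * Cv / vr *
              (Cv * (vertexCond (c m) z * K m t z y * Real.exp (2 * l * gdist E z y))) := by
              refine Finset.sum_le_sum fun z _ => mul_le_mul (a1 z) ?_
                (mul_nonneg (hn2 z) (Real.exp_pos _).le) (by positivity)
              have := le_mul_of_one_le_left
                (mul_nonneg (hn2 z) (Real.exp_pos (2 * l * gdist E z y)).le)
                ((H.snap m).one_le_mul_vertexCond z)
              linarith
          _ = C₁ * Cv / vr * (Cv *
              ∑ z ∈ Z, vertexCond (c m) z * K m t z y * Real.exp (2 * l * gdist E z y)) := by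
              rw [← Finset.mul_sum, ← Finset.mul_sum]
          _ ≤ C₁ * Cv / vr * (Cv * H.W (2 * l) m t y) := by
              gcongr
              exact (H.W_summable hB hmt (by linarith) (by linarith) y).sum_le_tsum Z
                fun z _ => H.W_term_nonneg _ hmt y z
          _ ≤ _ := by
              have b1 := hWm (2 * l) (by linarith) (by linarith)
              have : C₂ * (2 * l) ^ 2 * (e t - e m) ≤ 4 * C₂ * l ^ 2 * τ := by
                have b1 : 0 ≤ 4 * C₂ * l ^ 2 := by positivity
                have b2 := mul_le_mul_of_nonneg_left (by linarith : e t - e m ≤ τ) b1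
                linarith
              have b3 := hdoub.2
              have b4 := H.evol_nonneg hmt y
              gcongr
              refine b1.trans ?_
              gcongr
      have f3 : ∑ z ∈ Z, Real.exp (l * gdist E x y) * (K s m x z * K m t z y) ≤
          ∑ z ∈ Z, K s m x z * K m t z y *
            (Real.exp (l * gdist E x z) * Real.exp (l * gdist E z y)) := by
        refine Finset.sum_le_sum fun z _ => ?_
        rw [mul_comm]
        refine mul_le_mul_of_nonneg_left ?_ (mul_nonneg (hn1 z) (hn2 z))
        rw [← Real.exp_add, ← mul_add]
        refine Real.exp_le_exp.2 (mul_le_mul_of_nonneg_left ?_ hl)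
        exact_mod_cast gdist_triangle (H.snap s).connected x z y
      have f4 := Finset.sum_sq_le_sum_mul_sum_of_sq_le_mul Z
        (r := fun z => K s m x z * K m t z y *
            (Real.exp (l * gdist E x z) * Real.exp (l * gdist E z y)))
        (f := fun z => K s m x z * Real.exp (2 * l * gdist E x z) * K m t z y)
        (g := fun z => K s m x z * (K m t z y * Real.exp (2 * l * gdist E z y)))
        (fun z _ => mul_nonneg (mul_nonneg (hn1 z) (Real.exp_pos _).le) (hn2 z))
        (fun z _ => mul_nonneg (hn1 z) (mul_nonneg (hn2 z) (Real.exp_pos _).le))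
        (fun z _ => le_of_eq (by
          have e1 : ∀ p : ℝ, Real.exp (2 * l * p) = Real.exp (l * p) ^ 2 := fun p => by
            rw [← Real.exp_nat_mul]; congr 1; push_cast; ring
          rw [e1, e1]; ring))
      calc _ ≤ _ := pow_le_pow_left₀ (Finset.sum_nonneg fun z _ =>
            mul_nonneg (Real.exp_pos _).le (mul_nonneg (hn1 z) (hn2 z))) f3 2
        _ ≤ _ := f4
        _ ≤ _ := mul_le_mul f1 f2 (Finset.sum_nonneg fun z _ => mul_nonneg (hn1 z)
            (mul_nonneg (hn2 z) (Real.exp_pos _).le)) (by positivity)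
        _ = Q * (μ / vr) ^ 2 *
            (Real.exp (4 * B * l ^ 2 * τ) * Real.exp (4 * C₂ * l ^ 2 * τ)) := by
            rw [hQ]; field_simp
        _ = _ := by
            rw [mul_pow, mul_pow, Real.sq_sqrt hQ0.le, ← Real.exp_add, ← Real.exp_nat_mul, hC₃]
            congr 2
            push_cast
            ring
    have h5 : K s t x y = Real.exp (-(l * gdist E x y)) *
        (Real.exp (l * gdist E x y) * K s t x y) := by
      rw [← mul_assoc, ← Real.exp_add]; simp
    rw [h5, Real.exp_add]
    refine (mul_le_mul_of_nonneg_left hkey (Real.exp_pos _).le).trans (le_of_eq (by ring))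
  have hτ0 : 0 < τ := by linarith
  set d : ℝ := (gdist E x y : ℝ)
  have hl := hgauss (κ * (d / τ)) (by positivity) (by
    have h1 : d / τ ≤ 1 := (div_le_one hτ0).2 hd
    have h2 : κ ≤ l₀ / 4 := min_le_left _ _
    nlinarith)
  have hexp : -(κ * (d / τ) * d) + C₃ * (κ * (d / τ)) ^ 2 * τ ≤ -(d ^ 2 / (C * τ)) := by
    refine gaussian_exponent_le hκ0 hτ0 ?_ (by linarith)
    calc C₃ * κ ≤ C₃ * (1 / (2 * C₃)) := mul_le_mul_of_nonneg_left (min_le_right _ _) hC₃0.le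
      _ = 1 / 2 := by field_simp
  calc K s t x y ≤ _ := hl
    _ ≤ C * (μ / vr) * Real.exp (-(d ^ 2 / (C * τ))) := by
        gcongr
        linarith
    _ = _ := by ring

/-- By `evol_moment` and Markov's inequality, half of `μ_{m,t}(y)` is carried by starting points
within `A √τ` of `y`. The Harnack inequality bounds each of their kernels by `K s t y y`, and the
volume of that ball is a multiple of `v (√τ)`. -/
theorem family_diag (hC₁ : 0 < C₁) (hl₀ : 0 < l₀) (hCF : 0 ≤ CF) (hg : ∀ A, 1 ≤ A → 0 < g A) :
    ∃ κ : ℝ, 0 < κ ∧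
    ∀ (V : Type u) (ι : Type w) [LinearOrder ι] (e : ι → ℝ) (E : V → V → Prop) (v : ℝ → ℝ)
      (c : ι → V → V → ℝ) (K : ι → ι → V → V → ℝ) (_ : WalkFamily e E v Cv C₁ l₀ CF g c K)
      (s t : ι), s ≤ t → ∀ y : V,
        κ * evolMeasure c K s t y / v (Real.sqrt (e t - e s)) ≤ K s t y y := by
  by_cases hCv : 1 ≤ Cv
  swap
  · exact ⟨1, one_pos, fun V ι _ e E v c K H s => absurd (H.snap s).one_le hCv⟩
  have hCv0 : 0 < Cv := one_pos.trans_le hCv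
  obtain ⟨B, hB0, hmom⟩ := exp_moment.{u, w} Cv C₁ l₀ CF g hC₁ hl₀
  obtain ⟨C₂, hC₂, hW⟩ := evol_moment.{u, w} Cv C₁ l₀ CF g hC₁ hl₀ hCF (hg 1 le_rfl)
  set l₁ := l₀ / 2 with hl₁
  have hl₁0 : 0 < l₁ := by positivity
  set A := max 1 ((Real.log (2 * C₂) + C₂ * l₁ ^ 2) / l₁) with hA
  have hA1 : 1 ≤ A := le_max_left _ _
  have hA0 : 0 < A := one_pos.trans_le hA1
  have hgA := hg A hA1
  have hAtail : Real.exp (-(l₁ * A)) * (C₂ * Real.exp (C₂ * l₁ ^ 2)) ≤ 1 / 2 := by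
    have h1 : Real.log (2 * C₂) + C₂ * l₁ ^ 2 ≤ l₁ * A := by
      have := le_max_right 1 ((Real.log (2 * C₂) + C₂ * l₁ ^ 2) / l₁)
      rw [← hA, div_le_iff₀ hl₁0] at this
      linarith
    calc _ ≤ Real.exp (-(Real.log (2 * C₂) + C₂ * l₁ ^ 2)) * (C₂ * Real.exp (C₂ * l₁ ^ 2)) := by
          gcongr
      _ = 1 / 2 := by
          rw [Real.exp_neg, Real.exp_add, Real.exp_log (by positivity)]
          field_simp
  obtain ⟨j, hj⟩ := pow_unbounded_of_one_lt A (by norm_num : (1 : ℝ) < 2)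
  -- Beyond `L` one has `A √τ ≤ τ / 4 ≤ e m - e s`, so `harnack` reaches from the whole ball to `y`;
  -- below `L` the crude bound is enough.
  set L := 20 + 16 * A ^ 2 with hL
  set κ₁ := g A / (2 * Cv * Cv ^ j) with hκ₁
  set κ₂ := Real.exp (-(CF * (1 + L))) * Cv⁻¹ with hκ₂
  have hκ₁0 : 0 < κ₁ := by positivity
  have hκ₂0 : 0 < κ₂ := by positivity
  refine ⟨min κ₁ κ₂, lt_min hκ₁0 hκ₂0, fun V ι _ e E v c K H s t hst y => ?_⟩
  have hB : H.HasMoments B := hmom V ι e E v c K H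
  have hτ : 0 ≤ e t - e s := by linarith [H.e_mono s t hst]
  have hμ := H.evol_nonneg hst y
  have hv := (H.snap s).v_pos (Real.sqrt_nonneg (e t - e s))
  have hv1 := (H.snap s).one_le_v (Real.sqrt_nonneg (e t - e s))
  by_cases hτL : e t - e s < L
  · have h1 := H.crude s t hst y y (by rw [gdist_self, Nat.cast_zero]; exact hτ)
    refine le_trans ?_ h1
    rw [div_le_iff₀ hv]
    calc min κ₁ κ₂ * evolMeasure c K s t y ≤ κ₂ * Cv :=
          mul_le_mul (min_le_right _ _) (H.evol_le hst y) hμ hκ₂0.le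
      _ = Real.exp (-(CF * (1 + L))) := by rw [hκ₂]; field_simp
      _ ≤ Real.exp (-(CF * (1 + (e t - e s)))) := by gcongr
      _ ≤ _ := le_mul_of_one_le_right (Real.exp_pos _).le hv1
  push Not at hτL
  have hA2 : 0 < A ^ 2 := by positivity
  obtain ⟨m, hsm, hmt, hm1, hm2⟩ := H.split s t (1 / 2 * (e t - e s)) hst (by linarith)
    (by linarith)
  have hanti := H.evol_anti hsm hmt y
  have hemt := H.e_mono m t hmt
  set τ := e t - e s with hτdef
  set ρ := Real.sqrt τ with hρ
  have hρ2 : ρ ^ 2 = τ := Real.sq_sqrt hτ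
  have hρA : 4 * A ≤ ρ := Real.le_sqrt_of_sq_le (by nlinarith)
  have hρ0 : 0 < ρ := by linarith
  set μm := evolMeasure c K m t y
  have hμm : 0 ≤ μm := H.evol_nonneg hmt y
  set T := (H.snap m).ball y (A * ρ) with hT
  -- On the scale `ρ = √τ` the rate `l₁ / ρ` costs only a constant.
  have hWm : H.W (l₁ / ρ) m t y ≤ C₂ * Real.exp (C₂ * l₁ ^ 2) * μm := by
    refine (hW V ι e E v c K H m t hmt (l₁ / ρ) (by positivity)
      (div_le_self hl₁0.le (by linarith)) y).trans ?_
    have : C₂ * (l₁ / ρ) ^ 2 * (e t - e m) ≤ C₂ * l₁ ^ 2 := by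
      rw [div_pow, hρ2, mul_div_assoc', div_mul_eq_mul_div, div_le_iff₀ (by linarith)]
      exact mul_le_mul_of_nonneg_left (by linarith) (by positivity)
    gcongr
  have hhalf : 1 / 2 * μm ≤ ∑ z ∈ T, vertexCond (c m) z * K m t z y := by
    have : μm ≤ ∑ z ∈ T, vertexCond (c m) z * K m t z y + 1 / 2 * μm := by
      refine (H.summable_mass hmt y).tsum_le_of_sum_le fun Z => ?_
      classical
      have h1 : ∀ z ∈ Z, vertexCond (c m) z * K m t z y ≤
          (if z ∈ T then vertexCond (c m) z * K m t z y else 0) +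
          Real.exp (-(l₁ * A)) *
            (vertexCond (c m) z * K m t z y * Real.exp (l₁ / ρ * gdist E z y)) := by
        intro z _
        have h2 := H.term_nonneg hmt y z
        have h3 : 0 ≤ Real.exp (-(l₁ * A)) *
            (vertexCond (c m) z * K m t z y * Real.exp (l₁ / ρ * gdist E z y)) :=
          mul_nonneg (Real.exp_pos _).le (H.W_term_nonneg _ hmt y z)
        by_cases hz : z ∈ T
        · rw [if_pos hz]; linarith
        · rw [if_neg hz, zero_add]
          rw [hT, (H.snap m).mem_ball, not_le, gdist_comm] at hz
          have h4 : 1 ≤ Real.exp (-(l₁ * A)) * Real.exp (l₁ / ρ * gdist E z y) := by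
            rw [← Real.exp_add, Real.one_le_exp_iff]
            have e1 : l₁ / ρ * gdist E z y = l₁ * gdist E z y / ρ := by ring
            have : l₁ * A ≤ l₁ * gdist E z y / ρ := by
              rw [le_div_iff₀ hρ0, mul_assoc]
              exact mul_le_mul_of_nonneg_left hz.le hl₁0.le
            linarith
          calc _ ≤ vertexCond (c m) z * K m t z y *
                (Real.exp (-(l₁ * A)) * Real.exp (l₁ / ρ * gdist E z y)) :=
                le_mul_of_one_le_right h2 h4
            _ = _ := by ring
      refine (Finset.sum_le_sum h1).trans ?_
      rw [Finset.sum_add_distrib, ← Finset.mul_sum, ← Finset.sum_filter]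
      refine add_le_add ?_ ?_
      · exact sum_le_sum_of_support (H.term_nonneg hmt y) fun z hz hz' =>
          absurd (Finset.mem_filter.1 hz).2 hz'
      · have h2 : ∑ z ∈ Z, vertexCond (c m) z * K m t z y * Real.exp (l₁ / ρ * gdist E z y) ≤
            H.W (l₁ / ρ) m t y :=
          (H.W_summable hB hmt (by positivity) (div_le_self hl₁0.le (by linarith)) y).sum_le_tsum
            Z fun z _ => H.W_term_nonneg _ hmt y z
        calc _ ≤ Real.exp (-(l₁ * A)) * (C₂ * Real.exp (C₂ * l₁ ^ 2) * μm) :=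
              mul_le_mul_of_nonneg_left (h2.trans hWm) (Real.exp_pos _).le
          _ = Real.exp (-(l₁ * A)) * (C₂ * Real.exp (C₂ * l₁ ^ 2)) * μm := by ring
          _ ≤ _ := mul_le_mul_of_nonneg_right hAtail hμm
    linarith
  have hharn : g A * ∑ z ∈ T, vertexCond (c m) z * K m t z y ≤
      (∑ z ∈ T, vertexCond (c m) z) * K s t y y := by
    rw [Finset.mul_sum, Finset.sum_mul]
    refine Finset.sum_le_sum fun z hz => ?_
    rw [mul_left_comm]
    refine mul_le_mul_of_nonneg_left ?_ ((H.snap m).vertexCond_pos z).le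
    have hz' := (H.snap m).mem_ball.1 hz
    rw [gdist_comm] at hz'
    exact H.harnack A s m t t hA1 hsm hmt le_rfl (by linarith) (by linarith) (by linarith)
      z y y hz' (by nlinarith)
  have hvol : ∑ z ∈ T, vertexCond (c m) z ≤ Cv * (Cv ^ j * v ρ) := by
    refine ((H.snap m).vol_le y (by positivity)).trans ?_
    refine mul_le_mul_of_nonneg_left ?_ hCv0.le
    refine (H.snap m).v_le_of_le_two_pow_mul j hρ0.le (by positivity) ?_
    exact mul_le_mul_of_nonneg_right hj.le hρ0.le
  have hK := H.nonneg s t hst y y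
  rw [div_le_iff₀ hv]
  have hfin : g A * (1 / 2 * μm) ≤ Cv * (Cv ^ j * v ρ) * K s t y y :=
    (mul_le_mul_of_nonneg_left hhalf hgA.le).trans
      (hharn.trans (mul_le_mul_of_nonneg_right hvol hK))
  calc min κ₁ κ₂ * evolMeasure c K s t y ≤ κ₁ * μm :=
        mul_le_mul (min_le_left _ _) hanti hμ hκ₁0.le
    _ = g A * (1 / 2 * μm) / (Cv * Cv ^ j) := by rw [hκ₁]; field_simp
    _ ≤ Cv * (Cv ^ j * v ρ) * K s t y y / (Cv * Cv ^ j) := by gcongr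
    _ = _ := by field_simp

/-- A chain of Harnack steps leads from `x` to `y`, where `family_diag` takes over. Steps of length
about `τ / d` make the number of links of order `1 + d² / τ`, which produces the Gaussian factor. -/
theorem family_lower (hC₁ : 0 < C₁) (hl₀ : 0 < l₀) (hCF : 0 ≤ CF) (hg : ∀ A, 1 ≤ A → 0 < g A)
    (hg1 : g 1 ≤ 1) :
    ∃ C : ℝ, 0 < C ∧
    ∀ (V : Type u) (ι : Type w) [LinearOrder ι] (e : ι → ℝ) (E : V → V → Prop) (v : ℝ → ℝ)
      (c : ι → V → V → ℝ) (K : ι → ι → V → V → ℝ) (_ : WalkFamily e E v Cv C₁ l₀ CF g c K)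
      (s t : ι), s ≤ t → ∀ x y : V, (gdist E x y : ℝ) ≤ e t - e s →
        C⁻¹ * evolMeasure c K s t y / v (Real.sqrt (e t - e s)) *
          Real.exp (-(C * (gdist E x y : ℝ) ^ 2 / (e t - e s))) ≤ K s t x y := by
  by_cases hCv : 1 ≤ Cv
  swap
  · exact ⟨1, one_pos, fun V ι _ e E v c K H s => absurd (H.snap s).one_le hCv⟩
  have hCv0 : 0 < Cv := one_pos.trans_le hCv
  obtain ⟨κ, hκ, hdiag⟩ := family_diag.{u, w} Cv C₁ l₀ CF g hC₁ hl₀ hCF hg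
  have hg0 := hg 1 le_rfl
  set Λ := -Real.log (g 1) with hΛ
  have hΛ0 : 0 ≤ Λ := by rw [hΛ]; linarith [Real.log_nonpos hg0.le hg1]
  have hgΛ : g 1 = Real.exp (-Λ) := by rw [hΛ, neg_neg, Real.exp_log hg0]
  set C := (κ * g 1)⁻¹ + Cv * Real.exp CF + 128 * Λ + 1024 * CF with hC
  have p1 : 0 < (κ * g 1)⁻¹ := by positivity
  have p2 : 0 < Cv * Real.exp CF := by positivity
  have hC0 : 0 < C := by positivity
  have i1 : C⁻¹ ≤ κ * g 1 := by
    rw [inv_le_comm₀ hC0 (by positivity)]; linarith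
  have i2 : C⁻¹ ≤ (Cv * Real.exp CF)⁻¹ := inv_anti₀ p2 (by linarith)
  refine ⟨C, hC0, fun V ι _ e E v c K H s t hst x y hd => ?_⟩
  have hτ : 0 ≤ e t - e s := by linarith [H.e_mono s t hst]
  have hμ := H.evol_nonneg hst y
  have hv := (H.snap s).v_pos (Real.sqrt_nonneg (e t - e s))
  have hv1 := (H.snap s).one_le_v (Real.sqrt_nonneg (e t - e s))
  have hdg := hdiag V ι e E v c K H
  rcases Nat.eq_zero_or_pos (gdist E x y) with hd0 | hdpos
  · have hxy := (gdist_eq_zero (H.snap s).connected).1 hd0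
    subst hxy
    refine le_trans ?_ (hdg s t hst x)
    rw [hd0]
    norm_num
    gcongr
    exact i1.trans (mul_le_of_le_one_right hκ.le hg1)
  have hd1 : (1 : ℝ) ≤ gdist E x y := by exact_mod_cast hdpos
  set d : ℝ := (gdist E x y : ℝ) with hddef
  set τ := e t - e s with hτdef
  have hτ0 : 0 < τ := by linarith
  -- Here `τ` is at most a multiple of `d² / τ`, so the crude bound is already of Gaussian form.
  -- Otherwise the step length below is at least `1`.
  by_cases hfar : τ < 32 * d
  · refine le_trans ?_ (H.crude s t hst x y hd)
    have h1 : τ ≤ 1024 * (d ^ 2 / τ) := by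
      rw [mul_div_assoc', le_div_iff₀ hτ0]
      nlinarith
    have h2 : 0 ≤ d ^ 2 / τ := by positivity
    have h3 : evolMeasure c K s t y / v (Real.sqrt τ) ≤ Cv := by
      rw [div_le_iff₀ hv]
      exact (H.evol_le hst y).trans (le_mul_of_one_le_right hCv0.le hv1)
    calc C⁻¹ * evolMeasure c K s t y / v (Real.sqrt τ) * Real.exp (-(C * d ^ 2 / τ))
        = C⁻¹ * (evolMeasure c K s t y / v (Real.sqrt τ)) * Real.exp (-(C * (d ^ 2 / τ))) := by
          rw [mul_div_assoc, mul_div_assoc]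
      _ ≤ (Cv * Real.exp CF)⁻¹ * Cv * Real.exp (-(CF * τ)) := by
          have : CF * τ ≤ C * (d ^ 2 / τ) := by
            calc CF * τ ≤ CF * (1024 * (d ^ 2 / τ)) := mul_le_mul_of_nonneg_left h1 hCF
              _ = 1024 * CF * (d ^ 2 / τ) := by ring
              _ ≤ C * (d ^ 2 / τ) := mul_le_mul_of_nonneg_right (by linarith) h2
          gcongr
      _ = Real.exp (-(CF * (1 + τ))) := by
          rw [mul_add, mul_one, neg_add, Real.exp_add, Real.exp_neg CF]
          field_simp
  push Not at hfar
  have hd0 : 0 < d := by linarith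
  set q := τ / (32 * d) with hq
  have hq1 : 1 ≤ q := by rw [hq, one_le_div (by positivity)]; exact hfar
  have hqd : 32 * d * q = τ := by rw [hq]; field_simp
  -- The step length is capped by `d`; in that case a single link suffices. With `n + 1 ≤ 3 d / l`
  -- the time needed is at most `12 d l ≤ 12 d q`, below `τ = 32 d q`.
  set l := min (gdist E x y) ⌊q⌋₊ with hl
  have hl1 : 1 ≤ l := le_min hdpos ((Nat.one_le_floor_iff q).2 hq1)
  have hl1' : (1 : ℝ) ≤ l := by exact_mod_cast hl1
  have hlq : (l : ℝ) ≤ q :=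
    le_trans (by exact_mod_cast min_le_right _ _) (Nat.floor_le (by linarith))
  have hld : (l : ℝ) ≤ d := by rw [hddef]; exact_mod_cast min_le_left _ _
  set n := ⌈d / l⌉₊ with hn
  have hn1 : d / l ≤ n := Nat.le_ceil _
  have hn2 : (n : ℝ) < d / l + 1 := Nat.ceil_lt_add_one (by positivity)
  have hdl : 1 ≤ d / l := (one_le_div (by linarith)).2 hld
  have hdl' : d / l * l = d := by field_simp
  have hnl : gdist E x y ≤ n * l := by
    have : d ≤ n * l := by
      calc d = d / l * l := hdl'.symm
        _ ≤ n * l := mul_le_mul_of_nonneg_right hn1 (by linarith)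
    rw [hddef] at this
    exact_mod_cast this
  have htime : ((n : ℝ) + 1) * (4 * (l : ℝ) ^ 2) ≤ τ := by
    have h1 : (n : ℝ) + 1 ≤ 3 * (d / l) := by linarith
    calc ((n : ℝ) + 1) * (4 * (l : ℝ) ^ 2) ≤ 3 * (d / l) * (4 * (l : ℝ) ^ 2) := by gcongr
      _ = 12 * (d / l * l) * l := by ring
      _ = 12 * d * l := by rw [hdl']
      _ ≤ 12 * d * q := by gcongr
      _ ≤ τ := by nlinarith
  have hncount : (n : ℝ) ≤ 1 + 128 * (d ^ 2 / τ) := by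
    rcases le_total (gdist E x y) ⌊q⌋₊ with h | h
    · have hld' : (l : ℝ) = d := by rw [hl, min_eq_left h]
      have : n = 1 := by rw [hn, hld', div_self hd0.ne', Nat.ceil_one]
      rw [this, Nat.cast_one]
      have : 0 ≤ d ^ 2 / τ := by positivity
      linarith
    · have hlf : (l : ℝ) = ⌊q⌋₊ := by rw [hl, min_eq_right h]
      have h1 : q < l + 1 := by rw [hlf]; exact Nat.lt_floor_add_one q
      have h2 : q ≤ 2 * l := by linarith
      have h3 : d / l ≤ 64 * (d ^ 2 / τ) := by
        rw [mul_div_assoc', div_le_div_iff₀ (by linarith) hτ0, ← hqd]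
        have := mul_le_mul_of_nonneg_left h2 (by positivity : 0 ≤ 32 * d ^ 2)
        linarith
      linarith
  obtain ⟨s', h1, h2, h3⟩ := H.harnack_chain hg0 hl1 n hst y hnl htime
  have hs' : e t - e s' ≤ τ := by linarith [H.e_mono s s' h1]
  have h4 := hdg s' t h2 y
  have hv' := (H.snap s).v_pos (Real.sqrt_nonneg (e t - e s'))
  have hμ' := H.evol_nonneg h2 y
  -- The chain may stop at a time `s'` later than `s`, which only helps: the evolving measure is
  -- larger there, and the volume factor smaller.
  have h5 : κ * evolMeasure c K s t y / v (Real.sqrt τ) ≤ K s' t y y := by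
    refine le_trans ?_ h4
    have a1 := H.evol_anti h1 h2 y
    have a2 : v (Real.sqrt (e t - e s')) ≤ v (Real.sqrt τ) :=
      (H.snap s).v_mono (Real.sqrt_nonneg _) (Real.sqrt_le_sqrt hs')
    gcongr
  have h6 : g 1 * Real.exp (-(C * d ^ 2 / τ)) ≤ g 1 ^ n := by
    rw [hgΛ, ← Real.exp_nat_mul, ← Real.exp_add]
    refine Real.exp_le_exp.2 ?_
    have a1 := mul_le_mul_of_nonneg_left hncount hΛ0
    have a2 : 0 ≤ d ^ 2 / τ := by positivity
    have a3 : 128 * Λ * (d ^ 2 / τ) ≤ C * (d ^ 2 / τ) :=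
      mul_le_mul_of_nonneg_right (by linarith) a2
    rw [mul_div_assoc]
    linarith
  calc C⁻¹ * evolMeasure c K s t y / v (Real.sqrt τ) * Real.exp (-(C * d ^ 2 / τ))
      ≤ κ * g 1 * evolMeasure c K s t y / v (Real.sqrt τ) * Real.exp (-(C * d ^ 2 / τ)) := by
        gcongr
    _ = (κ * evolMeasure c K s t y / v (Real.sqrt τ)) *
        (g 1 * Real.exp (-(C * d ^ 2 / τ))) := by ring
    _ ≤ K s' t y y * g 1 ^ n := mul_le_mul h5 h6 (by positivity) (H.nonneg s' t h2 y y)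
    _ ≤ K s t x y := by rw [mul_comm]; exact h3

/-- Two-sided Gaussian estimates for a family of transition probabilities. -/
theorem family_twoSided (hC₁ : 0 < C₁) (hl₀ : 0 < l₀) (hCF : 0 ≤ CF)
    (hg : ∀ A, 1 ≤ A → 0 < g A) (hg1 : g 1 ≤ 1) :
    ∃ C : ℝ, 0 < C ∧
    ∀ (V : Type u) (ι : Type w) [LinearOrder ι] (e : ι → ℝ) (E : V → V → Prop) (v : ℝ → ℝ)
      (c : ι → V → V → ℝ) (K : ι → ι → V → V → ℝ) (_ : WalkFamily e E v Cv C₁ l₀ CF g c K)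
      (s t : ι), s ≤ t → ∀ x y : V, (gdist E x y : ℝ) ≤ e t - e s →
        TwoSided v C (e t - e s) (gdist E x y) (evolMeasure c K s t y) (K s t x y) := by
  obtain ⟨C, hC, hup⟩ := family_upper.{u, w} Cv C₁ l₀ CF g hC₁ hl₀ hCF (hg 1 le_rfl)
  obtain ⟨C', hC', hlow⟩ := family_lower.{u, w} Cv C₁ l₀ CF g hC₁ hl₀ hCF hg hg1
  refine ⟨max C C', lt_max_of_lt_left hC, fun V ι _ e E v c K H s t hst x y hd => ?_⟩
  have h1 := hup V ι e E v c K H s t hst x y hd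
  have h2 := hlow V ι e E v c K H s t hst x y hd
  have hμ := H.evol_nonneg hst y
  have hv := (H.snap s).v_pos (Real.sqrt_nonneg (e t - e s))
  have hτ : 0 ≤ e t - e s := by linarith [H.e_mono s t hst]
  constructor
  · refine le_trans ?_ h2
    have := le_max_right C C'
    gcongr
  · refine h1.trans ?_
    have := le_max_left C C'
    rcases hτ.eq_or_lt with h0 | h0
    · rw [← h0] at hv ⊢
      rw [mul_zero, mul_zero]
      gcongr
    · gcongr

end Constants

end TimeVaryingWalk

namespace TimeVaryingWalk

/-! ### Poisson weights -/

/-- The weight `e^{-q} q^n / n!`. -/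
noncomputable def poissonWeight (q : ℝ) (n : ℕ) : ℝ := Real.exp (-q) * (q ^ n / n.factorial)

theorem poissonWeight_nonneg {q : ℝ} (hq : 0 ≤ q) (n : ℕ) : 0 ≤ poissonWeight q n := by
  unfold poissonWeight; positivity

theorem poissonWeight_zero (q : ℝ) : poissonWeight q 0 = Real.exp (-q) := by
  simp [poissonWeight]

theorem continuous_poissonWeight (n : ℕ) : Continuous fun q => poissonWeight q n := by
  unfold poissonWeight; fun_prop

theorem hasSum_pow_div_factorial (q : ℝ) :
    HasSum (fun n : ℕ => q ^ n / n.factorial) (Real.exp q) := by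
  rw [Real.exp_eq_exp_ℝ]
  exact NormedSpace.expSeries_div_hasSum_exp q

theorem hasSum_poissonWeight (q : ℝ) : HasSum (poissonWeight q) 1 := by
  have := (hasSum_pow_div_factorial q).mul_left (Real.exp (-q))
  rwa [← Real.exp_add, neg_add_cancel, Real.exp_zero] at this

theorem sum_poissonWeight_le_one {q : ℝ} (hq : 0 ≤ q) (s : Finset ℕ) :
    ∑ n ∈ s, poissonWeight q n ≤ 1 :=
  sum_le_hasSum s (fun n _ => poissonWeight_nonneg hq n) (hasSum_poissonWeight q)

theorem integral_sub_pow (s t : ℝ) (n : ℕ) :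
    ∫ ξ in s..t, (t - ξ) ^ n = (t - s) ^ (n + 1) / (n + 1) := by
  rw [intervalIntegral.integral_comp_sub_left (fun x => x ^ n) t, integral_pow]
  simp

/-- Conditioning on the first arrival of a Poisson process of rate `a`: an arrival at `ξ`, then `n`
arrivals during `(ξ, t]`. Rate `1` is the walk itself, rate `2` its lazy version. -/
theorem integral_poissonWeight (a s t : ℝ) (n : ℕ) :
    ∫ ξ in s..t, a * Real.exp (-(a * (ξ - s))) * poissonWeight (a * (t - ξ)) n =
      poissonWeight (a * (t - s)) (n + 1) := by
  have h : ∀ ξ, a * Real.exp (-(a * (ξ - s))) * poissonWeight (a * (t - ξ)) n =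
      Real.exp (-(a * (t - s))) * a ^ (n + 1) / n.factorial * (t - ξ) ^ n := by
    intro ξ
    have : Real.exp (-(a * (ξ - s))) * Real.exp (-(a * (t - ξ))) =
        Real.exp (-(a * (t - s))) := by
      rw [← Real.exp_add]; congr 1; ring
    rw [poissonWeight, ← this, mul_pow]
    ring
  simp only [h]
  rw [intervalIntegral.integral_const_mul, integral_sub_pow, poissonWeight, Nat.factorial_succ,
    mul_pow]
  push_cast
  field_simp

theorem integral_rate_pow (a s t : ℝ) (n : ℕ) :
    ∫ ξ in s..t, a * ((a * (t - ξ)) ^ n / n.factorial) =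
      (a * (t - s)) ^ (n + 1) / (n + 1).factorial := by
  have h : ∀ ξ, a * ((a * (t - ξ)) ^ n / n.factorial) =
      a ^ (n + 1) / n.factorial * (t - ξ) ^ n := fun ξ => by rw [mul_pow]; ring
  simp only [h]
  rw [intervalIntegral.integral_const_mul, integral_sub_pow, Nat.factorial_succ, mul_pow]
  push_cast
  field_simp

/-! ### Averages over the neighbours -/

/-- The mean of `f` after one step from `x`. -/
noncomputable def stepMean {V : Type*} (a : V → V → ℝ) (f : V → ℝ) (x : V) : ℝ :=
  ∑' y, stepKernel a x y * f y

namespace Snapshot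

variable {V : Type*} {E : V → V → Prop} {v : ℝ → ℝ} {Cv : ℝ} {a : V → V → ℝ}
variable (h : Snapshot E v Cv a)
include h

theorem stepMean_eq (f : V → ℝ) (x : V) :
    stepMean a f x = ∑ y ∈ h.nbrs x, stepKernel a x y * f y := h.tsum_stepKernel_mul x f

theorem stepMean_mono {f f' : V → ℝ} (hf : ∀ y, f y ≤ f' y) (x : V) :
    stepMean a f x ≤ stepMean a f' x := by
  rw [h.stepMean_eq, h.stepMean_eq]
  exact Finset.sum_le_sum fun y _ => mul_le_mul_of_nonneg_left (hf y) (h.stepKernel_nonneg x y)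

theorem stepMean_const (b : ℝ) (x : V) : stepMean a (fun _ => b) x = b := by
  rw [h.stepMean_eq, ← Finset.sum_mul, h.sum_stepKernel, one_mul]

theorem stepMean_nonneg {f : V → ℝ} (hf : ∀ y, 0 ≤ f y) (x : V) : 0 ≤ stepMean a f x := by
  have := h.stepMean_mono hf x
  rwa [h.stepMean_const] at this

theorem stepMean_sum {κ : Type*} (S : Finset κ) (f : κ → V → ℝ) (x : V) :
    stepMean a (fun y => ∑ i ∈ S, f i y) x = ∑ i ∈ S, stepMean a (f i) x := by
  simp only [h.stepMean_eq, Finset.mul_sum]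
  exact Finset.sum_comm

theorem stepMean_mul (f : V → ℝ) (b : ℝ) (x : V) :
    stepMean a (fun y => f y * b) x = stepMean a f x * b := by
  simp only [h.stepMean_eq, Finset.sum_mul, mul_assoc]

theorem hasSum_stepMean {κ : Type*} {f : κ → V → ℝ} {F : V → ℝ}
    (hf : ∀ y, HasSum (fun i => f i y) (F y)) (x : V) :
    HasSum (fun i => stepMean a (f i) x) (stepMean a F x) := by
  simp only [h.stepMean_eq]
  exact hasSum_sum fun y _ => (hf y).mul_left _

/-- One step of the walk preserves the measure `π`. -/
theorem sum_vertexCond_mul_stepMean_le {f : V → ℝ} (hf : ∀ y, 0 ≤ f y) {B : ℝ}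
    (hB : ∀ Y : Finset V, ∑ y ∈ Y, vertexCond a y * f y ≤ B) (X : Finset V) :
    ∑ x ∈ X, vertexCond a x * stepMean a f x ≤ B := by
  classical
  set Y := X.biUnion h.nbrs
  refine le_trans ?_ (hB Y)
  have h1 : ∀ x ∈ X, vertexCond a x * stepMean a f x = ∑ y ∈ Y, a x y * f y := by
    intro x hx
    rw [h.stepMean_eq, Finset.mul_sum]
    simp only [← mul_assoc, h.vertexCond_mul_stepKernel]
    refine Finset.sum_subset (Finset.subset_biUnion_of_mem h.nbrs hx) fun y _ hy => ?_
    rw [h.zero x y fun hE => hy (h.mem_nbrs.2 hE), zero_mul]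
  rw [Finset.sum_congr rfl h1, Finset.sum_comm]
  refine Finset.sum_le_sum fun y _ => ?_
  rw [← Finset.sum_mul]
  refine mul_le_mul_of_nonneg_right ?_ (hf y)
  rw [h.vertexCond_eq]
  simp only [fun x => h.symm x y]
  exact sum_le_sum_of_support (h.nonneg y) fun x _ hx => h.zero y x fun hE =>
    hx (h.mem_nbrs.2 hE)

end Snapshot

theorem intervalIntegrable_sum {κ : Type*} (S : Finset κ) {f : κ → ℝ → ℝ} {a b : ℝ}
    (hf : ∀ i, IntervalIntegrable (f i) volume a b) :
    IntervalIntegrable (fun ξ => ∑ i ∈ S, f i ξ) volume a b := by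
  have : (fun ξ => ∑ i ∈ S, f i ξ) = ∑ i ∈ S, f i := by ext ξ; rw [Finset.sum_apply]
  rw [this]
  exact IntervalIntegrable.sum S fun i _ => hf i

/-! ### The constant speed walk -/

/-- An integral over the first arrival time is bounded by a Poisson weight. -/
theorem integral_le_poissonWeight {s t B : ℝ} (hst : s ≤ t) (n : ℕ) {F : ℝ → ℝ}
    (hi : IntervalIntegrable (fun ξ => Real.exp (-(1 * (ξ - s))) * F ξ) volume s t)
    (hF : ∀ ξ ∈ Icc s t, F ξ ≤ B * poissonWeight (t - ξ) n) :
    ∫ ξ in s..t, Real.exp (-(1 * (ξ - s))) * F ξ ≤ B * poissonWeight (t - s) (n + 1) := by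
  have h1 := integral_poissonWeight 1 s t n
  simp only [one_mul] at h1
  rw [← h1, ← intervalIntegral.integral_const_mul]
  refine intervalIntegral.integral_mono_on hst hi ?_ fun ξ hξ => ?_
  · refine Continuous.intervalIntegrable ?_ _ _
    have := continuous_poissonWeight n
    fun_prop
  · rw [one_mul, mul_left_comm]
    exact mul_le_mul_of_nonneg_left (hF ξ hξ) (Real.exp_pos _).le

theorem csrwPart_succ {V : Type*} (c : ℝ → V → V → ℝ) (t : ℝ) (z : V) (n : ℕ) (s : ℝ) (x : V) :
    csrwPart c t z (n + 1) s x =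
      ∫ ξ in s..t, Real.exp (-(1 * (ξ - s))) * stepMean (c ξ) (csrwPart c t z n ξ) x := by
  simp only [one_mul]; rfl

/-- Time-varying conductances satisfying the standing assumptions, on the whole time line. -/
structure Environment {V : Type*} (E : V → V → Prop) (v : ℝ → ℝ) (Cv : ℝ)
    (c : ℝ → V → V → ℝ) : Prop where
  snap : ∀ t, Snapshot E v Cv (c t)
  meas : ∀ x y, Measurable fun t => c t x y
  mono : ∀ x, Monotone fun t => vertexCond (c t) x

namespace Environment

variable {V : Type*} {E : V → V → Prop} {v : ℝ → ℝ} {Cv : ℝ} {c : ℝ → V → V → ℝ}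
variable (H : Environment E v Cv c)
include H

theorem measurable_stepKernel (x y : V) : Measurable fun t => stepKernel (c t) x y := by
  have : ∀ t, stepKernel (c t) x y = c t x y / ∑ w ∈ (H.snap 0).nbrs x, c t x w := fun t => by
    rw [stepKernel, (H.snap t).vertexCond_eq]
    rfl
  simp only [this]
  exact (H.meas x y).div (Finset.measurable_fun_sum _ fun w _ => H.meas x w)

/-- The neighbours of `x` do not depend on time, so this is a finite sum of continuous functions
multiplied by measurable factors in `[0, 1]`. -/
theorem intervalIntegrable_stepMean {f : ℝ → V → ℝ} {a b : ℝ}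
    (hf : ∀ y, ContinuousOn (fun ξ => f ξ y) (uIcc a b)) (x : V) :
    IntervalIntegrable (fun ξ => stepMean (c ξ) (f ξ) x) volume a b := by
  have h1 : (fun ξ => stepMean (c ξ) (f ξ) x) =
      ∑ y ∈ (H.snap 0).nbrs x, fun ξ => stepKernel (c ξ) x y * f ξ y := by
    ext ξ
    rw [(H.snap ξ).stepMean_eq, Finset.sum_apply]
    rfl
  rw [h1]
  refine IntervalIntegrable.sum _ fun y _ => ?_
  have h2 := (hf y).intervalIntegrable (μ := volume)
  refine h2.mono_fun ((H.measurable_stepKernel x y).aestronglyMeasurable.mul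
    h2.aestronglyMeasurable_restrict_uIoc) (Filter.Eventually.of_forall fun ξ => ?_)
  simp only [norm_mul, Real.norm_eq_abs]
  refine mul_le_of_le_one_left (abs_nonneg _) ?_
  rw [abs_of_nonneg ((H.snap ξ).stepKernel_nonneg x y)]
  exact (H.snap ξ).stepKernel_le_one x y

/-- Taking `exp s` out of the integral leaves the primitive of a locally integrable function.
Continuity is what makes the next integrand integrable. -/
theorem continuous_csrwPart (t : ℝ) (z : V) (n : ℕ) :
    ∀ x, Continuous fun s => csrwPart c t z n s x := by
  induction n with
  | zero =>
    intro x
    simp only [csrwPart]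
    split_ifs <;> fun_prop
  | succ n ih =>
    intro x
    have h1 : (fun s => csrwPart c t z (n + 1) s x) = fun s =>
        Real.exp s * -∫ ξ in t..s, Real.exp (-ξ) * stepMean (c ξ) (csrwPart c t z n ξ) x := by
      ext s
      rw [← intervalIntegral.integral_symm, ← intervalIntegral.integral_const_mul]
      refine intervalIntegral.integral_congr fun ξ _ => ?_
      simp only [stepMean]
      rw [← mul_assoc, ← Real.exp_add]
      congr 2
      ring
    rw [h1]
    refine Real.continuous_exp.mul (Continuous.neg ?_)
    refine intervalIntegral.continuous_primitive (fun a b => ?_) t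
    exact (H.intervalIntegrable_stepMean (fun y => (ih y).continuousOn) x).continuousOn_mul
      (by fun_prop)

theorem intervalIntegrable_weight_mul (a s : ℝ) {f : ℝ → V → ℝ} {p q : ℝ}
    (hf : ∀ y, ContinuousOn (fun ξ => f ξ y) (uIcc p q)) (x : V) :
    IntervalIntegrable (fun ξ => Real.exp (-(a * (ξ - s))) * stepMean (c ξ) (f ξ) x)
      volume p q :=
  (H.intervalIntegrable_stepMean hf x).continuousOn_mul (by fun_prop)

theorem intervalIntegrable_csrwPart (t : ℝ) (z : V) (n : ℕ) (s : ℝ) (x : V) (p q : ℝ) :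
    IntervalIntegrable (fun ξ => Real.exp (-(1 * (ξ - s))) *
      stepMean (c ξ) (csrwPart c t z n ξ) x) volume p q :=
  H.intervalIntegrable_weight_mul 1 s (fun y => (H.continuous_csrwPart t z n y).continuousOn) x

theorem csrwPart_nonneg (t : ℝ) (z : V) (n : ℕ) :
    ∀ s, s ≤ t → ∀ x, 0 ≤ csrwPart c t z n s x := by
  induction n with
  | zero =>
    intro s _ x
    simp only [csrwPart]
    split_ifs
    · exact (Real.exp_pos _).le
    · exact le_rfl
  | succ n ih =>
    intro s hs x
    rw [csrwPart_succ]
    exact intervalIntegral.integral_nonneg hs fun ξ hξ => mul_nonneg (Real.exp_pos _).le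
      ((H.snap ξ).stepMean_nonneg (ih ξ hξ.2) x)

theorem sum_csrwPart_le (t : ℝ) (Z : Finset V) (n : ℕ) :
    ∀ s, s ≤ t → ∀ x, ∑ z ∈ Z, csrwPart c t z n s x ≤ poissonWeight (t - s) n := by
  induction n with
  | zero =>
    intro s hs x
    simp only [csrwPart, poissonWeight_zero]
    classical
    rw [Finset.sum_ite_eq]
    split_ifs
    · exact le_rfl
    · exact (Real.exp_pos _).le
  | succ n ih =>
    intro s hs x
    simp only [csrwPart_succ]
    rw [← intervalIntegral.integral_finsetSum fun z _ =>
      H.intervalIntegrable_csrwPart t z n s x s t]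
    simp only [← Finset.mul_sum]
    rw [← one_mul (poissonWeight _ _)]
    refine integral_le_poissonWeight hs n ?_ fun ξ hξ => ?_
    · simp only [Finset.mul_sum]
      exact intervalIntegrable_sum Z fun z => H.intervalIntegrable_csrwPart t z n s x s t
    · rw [← (H.snap ξ).stepMean_sum, one_mul]
      have := (H.snap ξ).stepMean_mono (ih ξ hξ.2) x
      rwa [(H.snap ξ).stepMean_const] at this

theorem csrwPart_le {s t : ℝ} (hst : s ≤ t) (z : V) (n : ℕ) (x : V) :
    csrwPart c t z n s x ≤ poissonWeight (t - s) n := by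
  simpa using H.sum_csrwPart_le t {z} n s hst x

/-- At the first arrival `ξ`, `π_s` is replaced by the larger `π_ξ`, which the step preserves. -/
theorem sum_vertexCond_mul_csrwPart_le (t : ℝ) (z : V) (n : ℕ) :
    ∀ s, s ≤ t → ∀ X : Finset V, ∑ x ∈ X, vertexCond (c s) x * csrwPart c t z n s x ≤
      vertexCond (c t) z * poissonWeight (t - s) n := by
  induction n with
  | zero =>
    intro s hs X
    simp only [csrwPart, poissonWeight_zero]
    have hz := mul_le_mul_of_nonneg_right (H.mono z hs) (Real.exp_pos (-(t - s))).le
    have hp := mul_nonneg ((H.snap t).vertexCond_pos z).le (Real.exp_pos (-(t - s))).le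
    simp only [mul_ite, mul_zero]
    classical
    rw [Finset.sum_ite_eq']
    split_ifs
    · exact hz
    · exact hp
  | succ n ih =>
    intro s hs X
    simp only [csrwPart_succ, ← intervalIntegral.integral_const_mul, mul_left_comm _ (Real.exp _)]
    have hi : ∀ x, IntervalIntegrable (fun ξ => Real.exp (-(1 * (ξ - s))) *
        (vertexCond (c s) x * stepMean (c ξ) (csrwPart c t z n ξ) x)) volume s t := fun x => by
      simp only [mul_left_comm _ (vertexCond (c s) x)]
      exact (H.intervalIntegrable_csrwPart t z n s x s t).const_mul _
    rw [← intervalIntegral.integral_finsetSum fun x _ => hi x]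
    simp only [← Finset.mul_sum]
    refine integral_le_poissonWeight hs n ?_ fun ξ hξ => ?_
    · simp only [Finset.mul_sum]
      exact intervalIntegrable_sum X hi
    · have h1 := (H.snap ξ).sum_vertexCond_mul_stepMean_le
        (H.csrwPart_nonneg t z n ξ hξ.2) (ih ξ hξ.2) X
      refine le_trans (Finset.sum_le_sum fun x _ => ?_) h1
      exact mul_le_mul_of_nonneg_right (H.mono x hξ.1)
        ((H.snap ξ).stepMean_nonneg (H.csrwPart_nonneg t z n ξ hξ.2) x)

/-- The decomposition of a path with `n` arrivals at an intermediate time. -/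
theorem csrwPart_split (m t : ℝ) (z : V) (n : ℕ) :
    ∀ (s : ℝ) (x : V) (Z : Finset V), (∀ y, gdist E x y ≤ n → y ∈ Z) →
      csrwPart c t z n s x = ∑ k ∈ Finset.range (n + 1), ∑ y ∈ Z,
        csrwPart c m y k s x * csrwPart c t z (n - k) m y := by
  have hzero : ∀ (n : ℕ) (s : ℝ) (x : V) (Z : Finset V), x ∈ Z →
      ∑ y ∈ Z, csrwPart c m y 0 s x * csrwPart c t z n m y =
        Real.exp (-(m - s)) * csrwPart c t z n m x := by
    intro n s x Z hx
    rw [Finset.sum_eq_single x]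
    · simp [csrwPart]
    · intro y _ hy
      simp [csrwPart, hy.symm]
    · exact fun h => absurd hx h
  induction n with
  | zero =>
    intro s x Z hZ
    rw [Finset.sum_range_one, Nat.sub_zero, hzero _ _ _ _ (hZ x (by simp [gdist_self]))]
    simp only [csrwPart]
    split_ifs
    · rw [← Real.exp_add]; congr 1; ring
    · rw [mul_zero]
  | succ n ih =>
    intro s x Z hZ
    rw [Finset.sum_range_succ', Nat.sub_zero, hzero _ _ _ _ (hZ x (by simp [gdist_self])),
      csrwPart_succ, ← intervalIntegral.integral_add_adjacent_intervals
        (H.intervalIntegrable_csrwPart t z n s x s m) (H.intervalIntegrable_csrwPart t z n s x m t)]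
    congr 1
    · have h1 : ∀ ξ, Real.exp (-(1 * (ξ - s))) * stepMean (c ξ) (csrwPart c t z n ξ) x =
          ∑ k ∈ Finset.range (n + 1), ∑ y ∈ Z, Real.exp (-(1 * (ξ - s))) *
            stepMean (c ξ) (csrwPart c m y k ξ) x * csrwPart c t z (n - k) m y := by
        intro ξ
        have h2 : stepMean (c ξ) (csrwPart c t z n ξ) x =
            stepMean (c ξ) (fun w => ∑ k ∈ Finset.range (n + 1), ∑ y ∈ Z,
              csrwPart c m y k ξ w * csrwPart c t z (n - k) m y) x := by
          rw [(H.snap ξ).stepMean_eq, (H.snap ξ).stepMean_eq]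
          refine Finset.sum_congr rfl fun w hw => ?_
          rw [ih ξ w Z fun y hy => hZ y ?_]
          have := gdist_le_add_one (H.snap 0).connected ((H.snap ξ).mem_nbrs.1 hw) y
          omega
        rw [h2, (H.snap ξ).stepMean_sum, Finset.mul_sum]
        refine Finset.sum_congr rfl fun k _ => ?_
        rw [(H.snap ξ).stepMean_sum, Finset.mul_sum]
        refine Finset.sum_congr rfl fun y _ => ?_
        rw [(H.snap ξ).stepMean_mul, mul_assoc]
      simp only [h1]
      have hi : ∀ k y, IntervalIntegrable (fun ξ => Real.exp (-(1 * (ξ - s))) *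
          stepMean (c ξ) (csrwPart c m y k ξ) x * csrwPart c t z (n - k) m y) volume s m :=
        fun k y => (H.intervalIntegrable_csrwPart m y k s x s m).mul_const _
      rw [intervalIntegral.integral_finsetSum fun k _ =>
        intervalIntegrable_sum Z (hi k)]
      refine Finset.sum_congr rfl fun k _ => ?_
      rw [intervalIntegral.integral_finsetSum fun y _ => hi k y]
      refine Finset.sum_congr rfl fun y _ => ?_
      rw [intervalIntegral.integral_mul_const, csrwPart_succ, Nat.succ_sub_succ]
    · rw [csrwPart_succ, ← intervalIntegral.integral_const_mul]
      refine intervalIntegral.integral_congr fun ξ _ => ?_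
      change _ = Real.exp (-(m - s)) * (Real.exp (-(1 * (ξ - m))) * _)
      rw [← mul_assoc, ← Real.exp_add]
      congr 2
      ring

end Environment

end TimeVaryingWalk

/-! ### Chapman–Kolmogorov and the backward equation for the constant speed walk. -/

namespace TimeVaryingWalk

theorem _root_.AbsolutelyContinuousOnInterval.congr {f g : ℝ → ℝ} {a b : ℝ}
    (hf : AbsolutelyContinuousOnInterval f a b) (hfg : EqOn f g (uIcc a b)) :
    AbsolutelyContinuousOnInterval g a b := by
  rw [absolutelyContinuousOnInterval_iff] at hf ⊢
  intro ε hε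
  obtain ⟨δ, hδ, h⟩ := hf ε hε
  refine ⟨δ, hδ, fun I hI hsum => lt_of_eq_of_lt ?_ (h I hI hsum)⟩
  exact Finset.sum_congr rfl fun i hi => by
    rw [hfg (hI.left i hi).left, hfg (hI.left i hi).right]

theorem absolutelyContinuousOnInterval_exp (b p q : ℝ) :
    AbsolutelyContinuousOnInterval (fun s => Real.exp (b * s)) p q :=
  ContDiffOn.absolutelyContinuousOnInterval (by fun_prop)

namespace Environment

variable {V : Type*} {E : V → V → Prop} {v : ℝ → ℝ} {Cv : ℝ} {c : ℝ → V → V → ℝ}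
variable (H : Environment E v Cv c)
include H

theorem summable_csrwPart {s t : ℝ} (hst : s ≤ t) (x z : V) :
    Summable fun n => csrwPart c t z n s x :=
  Summable.of_nonneg_of_le (fun n => H.csrwPart_nonneg t z n s hst x)
    (fun n => H.csrwPart_le hst z n x) (hasSum_poissonWeight (t - s)).summable

theorem hasSum_csrwPart {s t : ℝ} (hst : s ≤ t) (x z : V) :
    HasSum (fun n => csrwPart c t z n s x) (csrwKernel c s t x z) :=
  (H.summable_csrwPart hst x z).hasSum

theorem csrwKernel_nonneg {s t : ℝ} (hst : s ≤ t) (x z : V) : 0 ≤ csrwKernel c s t x z :=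
  tsum_nonneg fun n => H.csrwPart_nonneg t z n s hst x

theorem sum_csrwKernel_le {s t : ℝ} (hst : s ≤ t) (x : V) (Z : Finset V) :
    ∑ z ∈ Z, csrwKernel c s t x z ≤ 1 :=
  hasSum_le (fun n => H.sum_csrwPart_le t Z n s hst x)
    (hasSum_sum fun z _ => H.hasSum_csrwPart hst x z) (hasSum_poissonWeight (t - s))

theorem csrwKernel_le_one {s t : ℝ} (hst : s ≤ t) (x z : V) : csrwKernel c s t x z ≤ 1 := by
  simpa using H.sum_csrwKernel_le hst x {z}

theorem sum_vertexCond_mul_csrwKernel_le {s t : ℝ} (hst : s ≤ t) (X : Finset V) (z : V) :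
    ∑ x ∈ X, vertexCond (c s) x * csrwKernel c s t x z ≤ vertexCond (c t) z := by
  have h1 := (hasSum_poissonWeight (t - s)).mul_left (vertexCond (c t) z)
  rw [mul_one] at h1
  exact hasSum_le (fun n => H.sum_vertexCond_mul_csrwPart_le t z n s hst X)
    (hasSum_sum fun x _ => (H.hasSum_csrwPart hst x z).mul_left _) h1

theorem exp_neg_le_csrwKernel {s t : ℝ} (hst : s ≤ t) (z : V) :
    Real.exp (-(t - s)) ≤ csrwKernel c s t z z := by
  have := (H.summable_csrwPart hst z z).sum_le_tsum {0}
    fun n _ => H.csrwPart_nonneg t z n s hst z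
  rw [Finset.sum_singleton] at this
  refine le_trans (le_of_eq ?_) this
  simp only [csrwPart, if_true]

theorem summable_csrwKernel_mul {s m t : ℝ} (hsm : s ≤ m) (hmt : m ≤ t) (x z : V) :
    Summable fun y => csrwKernel c s m x y * csrwKernel c m t y z :=
  summable_of_sum_le (c := 1)
    (fun y => mul_nonneg (H.csrwKernel_nonneg hsm x y) (H.csrwKernel_nonneg hmt y z))
    fun Y => (Finset.sum_le_sum fun y _ => mul_le_of_le_one_right (H.csrwKernel_nonneg hsm x y)
      (H.csrwKernel_le_one hmt y z)).trans (H.sum_csrwKernel_le hsm x Y)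

/-- Paths with fewer than `N` arrivals are split at time `m`, and the pairs of arrival numbers with
sum below `N` are enlarged to a full square. Only this inequality is needed later. -/
theorem csrwKernel_le_tsum {s m t : ℝ} (hsm : s ≤ m) (hmt : m ≤ t) (x z : V) :
    csrwKernel c s t x z ≤ ∑' y, csrwKernel c s m x y * csrwKernel c m t y z := by
  refine (H.summable_csrwPart (hsm.trans hmt) x z).tsum_le_of_sum_range_le fun N => ?_
  set Z := (H.snap 0).ball x N with hZ
  have hmem : ∀ n < N, ∀ y, gdist E x y ≤ n → y ∈ Z := fun n hn y hy =>
    (H.snap 0).mem_ball.2 (by exact_mod_cast hy.trans hn.le)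
  have hp : ∀ k y, 0 ≤ csrwPart c m y k s x := fun k y => H.csrwPart_nonneg m y k s hsm x
  have hq : ∀ k y, 0 ≤ csrwPart c t z k m y := fun k y => H.csrwPart_nonneg t z k m hmt y
  calc ∑ n ∈ Finset.range N, csrwPart c t z n s x
      = ∑ n ∈ Finset.range N, ∑ k ∈ Finset.range (n + 1), ∑ y ∈ Z,
          csrwPart c m y k s x * csrwPart c t z (n - k) m y :=
        Finset.sum_congr rfl fun n hn =>
          H.csrwPart_split m t z n s x Z (hmem n (Finset.mem_range.1 hn))
    _ = ∑ k ∈ Finset.range N, ∑ j ∈ Finset.range (N - k), ∑ y ∈ Z,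
          csrwPart c m y k s x * csrwPart c t z j m y :=
        Finset.sum_range_diag_flip N fun k j => ∑ y ∈ Z,
          csrwPart c m y k s x * csrwPart c t z j m y
    _ ≤ ∑ k ∈ Finset.range N, ∑ j ∈ Finset.range N, ∑ y ∈ Z,
          csrwPart c m y k s x * csrwPart c t z j m y := by
        refine Finset.sum_le_sum fun k _ => Finset.sum_le_sum_of_subset_of_nonneg
          (Finset.range_mono (Nat.sub_le _ _)) fun j _ _ => ?_
        exact Finset.sum_nonneg fun y _ => mul_nonneg (hp k y) (hq j y)
    _ = ∑ y ∈ Z, (∑ k ∈ Finset.range N, csrwPart c m y k s x) *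
          ∑ k ∈ Finset.range N, csrwPart c t z k m y := by
        simp only [Finset.sum_mul_sum]
        rw [Finset.sum_comm (s := Z)]
        exact Finset.sum_congr rfl fun k _ => Finset.sum_comm
    _ ≤ ∑ y ∈ Z, csrwKernel c s m x y * csrwKernel c m t y z :=
        Finset.sum_le_sum fun y _ => mul_le_mul
          ((H.summable_csrwPart hsm x y).sum_le_tsum _ fun k _ => hp k y)
          ((H.summable_csrwPart hmt y z).sum_le_tsum _ fun k _ => hq k y)
          (Finset.sum_nonneg fun k _ => hq k y) (H.csrwKernel_nonneg hsm x y)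
    _ ≤ _ := (H.summable_csrwKernel_mul hsm hmt x z).sum_le_tsum Z fun y _ =>
        mul_nonneg (H.csrwKernel_nonneg hsm x y) (H.csrwKernel_nonneg hmt y z)

theorem continuousOn_csrwKernel (a t : ℝ) (x z : V) :
    ContinuousOn (fun s => csrwKernel c s t x z) (Icc a t) := by
  refine continuousOn_tsum (fun n => (H.continuous_csrwPart t z n x).continuousOn)
    (hasSum_pow_div_factorial (t - a)).summable fun n s hs => ?_
  rw [Real.norm_of_nonneg (H.csrwPart_nonneg t z n s hs.2 x)]
  refine (H.csrwPart_le hs.2 z n x).trans ?_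
  have h1 : 0 ≤ t - s := by linarith [hs.2]
  have h2 : t - s ≤ t - a := by linarith [hs.1]
  refine (mul_le_of_le_one_left (by positivity) (Real.exp_le_one_iff.2 (by linarith))).trans ?_
  gcongr

theorem intervalIntegrable_csrwKernel (a b : ℝ) {s t : ℝ} (hst : s ≤ t) (x z : V) :
    IntervalIntegrable (fun ξ => Real.exp (-(a * (ξ - b))) *
      stepMean (c ξ) (fun y => csrwKernel c ξ t y z) x) volume s t :=
  H.intervalIntegrable_weight_mul a b
    (fun y => by rw [uIcc_of_le hst]; exact H.continuousOn_csrwKernel s t y z) x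

/-- The equation solved by the transition probabilities, conditioning on the first arrival. -/
theorem csrwKernel_eq {s t : ℝ} (hst : s ≤ t) (x z : V) :
    csrwKernel c s t x z = csrwPart c t z 0 s x + ∫ ξ in s..t, Real.exp (-(1 * (ξ - s))) *
      stepMean (c ξ) (fun y => csrwKernel c ξ t y z) x := by
  have h1 := H.hasSum_csrwPart hst x z
  rw [← hasSum_nat_add_iff' 1, Finset.sum_range_one] at h1
  have h2 : HasSum (fun n => csrwPart c t z (n + 1) s x) (∫ ξ in s..t,
      Real.exp (-(1 * (ξ - s))) * stepMean (c ξ) (fun y => csrwKernel c ξ t y z) x) := by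
    simp only [csrwPart_succ]
    refine intervalIntegral.hasSum_integral_of_dominated_convergence
      (fun n _ => (t - s) ^ n / n.factorial)
      (fun n => (H.intervalIntegrable_csrwPart t z n s x s t).aestronglyMeasurable_restrict_uIoc)
      (fun n => Filter.Eventually.of_forall fun ξ hξ => ?_)
      (Filter.Eventually.of_forall fun ξ _ => (hasSum_pow_div_factorial (t - s)).summable)
      intervalIntegrable_const
      (Filter.Eventually.of_forall fun ξ hξ => ?_)
    · rw [uIoc_of_le hst] at hξ
      have h3 : 0 ≤ t - ξ := by linarith [hξ.2]
      have h4 : t - ξ ≤ t - s := by linarith [hξ.1]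
      have h5 := (H.snap ξ).stepMean_nonneg (H.csrwPart_nonneg t z n ξ hξ.2) x
      have h6 := (H.snap ξ).stepMean_mono (H.csrwPart_le hξ.2 z n) x
      rw [(H.snap ξ).stepMean_const] at h6
      rw [Real.norm_of_nonneg (mul_nonneg (Real.exp_pos _).le h5)]
      refine (mul_le_of_le_one_left h5 (Real.exp_le_one_iff.2 (by linarith [hξ.1]))).trans
        (h6.trans ?_)
      refine (mul_le_of_le_one_left (by positivity) (Real.exp_le_one_iff.2 (by linarith))).trans ?_
      gcongr
    · rw [uIoc_of_le hst] at hξ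
      exact ((H.snap ξ).hasSum_stepMean (fun y => H.hasSum_csrwPart hξ.2 y z) x).mul_left _
  have := h1.unique h2
  linarith

/-- The integrand no longer contains `s`, so regularity in `s` reduces to that of a primitive. -/
theorem csrwKernel_eq_exp_mul {a t : ℝ} (x z : V) {s : ℝ} (hs : s ∈ Icc a t) :
    csrwKernel c s t x z = Real.exp s * (csrwPart c t z 0 0 x +
      ∫ ξ in s..t, Real.exp (-(1 * (ξ - 0))) * stepMean (c ξ) (fun y => csrwKernel c ξ t y z) x) := by
  rw [H.csrwKernel_eq hs.2, mul_add, ← intervalIntegral.integral_const_mul]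
  congr 1
  · simp only [csrwPart]
    split_ifs
    · rw [← Real.exp_add]; congr 1; ring
    · rw [mul_zero]
  · refine intervalIntegral.integral_congr fun ξ _ => ?_
    change _ = Real.exp s * (Real.exp (-(1 * (ξ - 0))) * _)
    rw [← mul_assoc, ← Real.exp_add]
    congr 2
    ring

theorem absolutelyContinuousOnInterval_csrwKernel {a t : ℝ} (hat : a ≤ t) (x z : V) :
    AbsolutelyContinuousOnInterval (fun s => csrwKernel c s t x z) a t := by
  have hi := H.intervalIntegrable_csrwKernel 1 0 hat x z
  have h1 := hi.absolutelyContinuousOnInterval_intervalIntegral (c := t) right_mem_uIcc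
  have h2 : AbsolutelyContinuousOnInterval (fun _ => csrwPart c t z 0 0 x) a t :=
    ContDiffOn.absolutelyContinuousOnInterval contDiffOn_const
  refine ((absolutelyContinuousOnInterval_exp 1 a t).fun_mul (h2.fun_sub h1)).congr fun s hs => ?_
  rw [uIcc_of_le hat] at hs
  simp only [one_mul s, sub_eq_add_neg (csrwPart c t z 0 0 x)]
  rw [H.csrwKernel_eq_exp_mul x z hs, intervalIntegral.integral_symm t s]

/-- Lebesgue differentiation of the primitive in `csrwKernel_eq_exp_mul`. The end points, a null
set, are left out because the formula must hold in a neighbourhood. -/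
theorem ae_hasDerivAt_csrwKernel {a t : ℝ} (hat : a ≤ t) (x z : V) :
    ∀ᵐ s, s ∈ Icc a t → HasDerivAt (fun r => csrwKernel c r t x z)
      (-(stepMean (c s) (fun y => csrwKernel c s t y z) x - csrwKernel c s t x z)) s := by
  have hi := H.intervalIntegrable_csrwKernel 1 0 hat x z
  have h1 : ∀ᵐ s : ℝ, s ≠ a := by simp [ae_iff, measure_singleton]
  have h2 : ∀ᵐ s : ℝ, s ≠ t := by simp [ae_iff, measure_singleton]
  filter_upwards [hi.ae_hasDerivAt_integral, h1, h2] with s hs hsa hst hsI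
  have hs' : s ∈ Ioo a t := ⟨lt_of_le_of_ne hsI.1 hsa.symm, lt_of_le_of_ne hsI.2 hst⟩
  have h3 := hs (by rwa [uIcc_of_le hat]) t right_mem_uIcc
  have h4 := (Real.hasDerivAt_exp s).mul (h3.const_sub (csrwPart c t z 0 0 x))
  have h5 := h4.congr_of_eventuallyEq (f₁ := fun r => csrwKernel c r t x z) (by
    filter_upwards [Icc_mem_nhds hs'.1 hs'.2] with r hr
    rw [H.csrwKernel_eq_exp_mul x z hr, intervalIntegral.integral_symm t r, ← sub_eq_add_neg]
    rfl)
  refine h5.congr_deriv ?_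
  rw [H.csrwKernel_eq_exp_mul x z hsI, intervalIntegral.integral_symm t s]
  have h6 : Real.exp s * Real.exp (-(1 * (s - 0))) = 1 := by
    rw [← Real.exp_add]; simp
  linear_combination -(stepMean (c s) (fun y => csrwKernel c s t y z) x) * h6

theorem csrwKernel_self (t : ℝ) (x z : V) : csrwKernel c t t x z = csrwPart c t z 0 t x := by
  rw [H.csrwKernel_eq le_rfl, intervalIntegral.integral_same, add_zero]

/-- The equation for the walk that is slowed down by a factor `1 / 2` and runs at rate `2`. -/
theorem csrwKernel_eq_lazy {s t : ℝ} (hst : s ≤ t) (x z : V) :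
    csrwKernel c s t x z = csrwPart c t z 0 t x * Real.exp (-(2 * (t - s))) +
      ∫ ξ in s..t, Real.exp (-(2 * (ξ - s))) *
        (stepMean (c ξ) (fun y => csrwKernel c ξ t y z) x + csrwKernel c ξ t x z) := by
  -- The derivative of `exp (-2 r) K_{r,t}` is `-exp (-2 r) (K_r + I) K_{r,t}`; absolute continuity
  -- allows it to be integrated back.
  have h1 := ((absolutelyContinuousOnInterval_exp (-2) s t).fun_mul
    (H.absolutelyContinuousOnInterval_csrwKernel hst x z)).integral_deriv_eq_sub
  have h2 : ∫ ξ in s..t, deriv (fun r => Real.exp (-2 * r) * csrwKernel c r t x z) ξ =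
      ∫ ξ in s..t, -(Real.exp (-2 * s) * (Real.exp (-(2 * (ξ - s))) *
        (stepMean (c ξ) (fun y => csrwKernel c ξ t y z) x + csrwKernel c ξ t x z))) := by
    refine intervalIntegral.integral_congr_ae ?_
    filter_upwards [H.ae_hasDerivAt_csrwKernel hst x z] with ξ hξ hξI
    rw [uIoc_of_le hst] at hξI
    have h3 := ((hasDerivAt_id ξ).const_mul (-2 : ℝ)).exp.mul (hξ ⟨hξI.1.le, hξI.2⟩)
    refine h3.deriv.trans ?_
    have h4 : Real.exp (-2 * s) * Real.exp (-(2 * (ξ - s))) = Real.exp (-2 * ξ) := by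
      rw [← Real.exp_add]; congr 1; ring
    simp only [id]
    rw [← mul_assoc (Real.exp (-2 * s)), h4]
    ring
  rw [h2, intervalIntegral.integral_neg, intervalIntegral.integral_const_mul,
    H.csrwKernel_self] at h1
  have h5 : Real.exp (-2 * t) = Real.exp (-2 * s) * Real.exp (-(2 * (t - s))) := by
    rw [← Real.exp_add]; congr 1; ring
  rw [h5] at h1
  refine mul_left_cancel₀ (Real.exp_pos (-2 * s)).ne' ?_
  linear_combination h1

end Environment

end TimeVaryingWalk

namespace TimeVaryingWalk

universe u

/-! ### Lazy conductances -/

open scoped Classical in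
/-- Conductances of the walk that stays put with probability `1 / 2` at each step. -/
noncomputable def lazyCond {V : Type*} (a : V → V → ℝ) (x y : V) : ℝ :=
  (a x y + if x = y then vertexCond a x else 0) / 2

theorem gdist_lazy {V : Type*} (E : V → V → Prop) : gdist (fun x y => E x y ∨ x = y) = gdist E := by
  have : SimpleGraph.fromRel (fun x y => E x y ∨ x = y) = SimpleGraph.fromRel E := by
    ext x y
    simp only [SimpleGraph.fromRel_adj]
    constructor
    · rintro ⟨h, (h1 | h1) | (h1 | h1)⟩
      · exact ⟨h, Or.inl h1⟩
      · exact absurd h1 h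
      · exact ⟨h, Or.inr h1⟩
      · exact absurd h1.symm h
    · rintro ⟨h, h1 | h1⟩
      · exact ⟨h, Or.inl (Or.inl h1)⟩
      · exact ⟨h, Or.inr (Or.inl h1)⟩
  ext x y
  rw [gdist, this, gdist]

theorem gball_lazy {V : Type*} (E : V → V → Prop) : gball (fun x y => E x y ∨ x = y) = gball E := by
  ext x r y
  simp only [gball, gdist_lazy]

namespace Snapshot

variable {V : Type*} {E : V → V → Prop} {v : ℝ → ℝ} {Cv : ℝ} {a : V → V → ℝ}
variable (h : Snapshot E v Cv a)
include h

open scoped Classical in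
theorem tsum_row_add_diag {F : V → ℝ} (x : V) (b : ℝ) (hF : ∀ y, ¬ E x y → F y = 0) :
    ∑' y, (F y + if x = y then b else 0) = ∑' y, F y + b := by
  have h0 : ∀ y, y ≠ x → (if x = y then b else 0) = 0 := fun y hy => if_neg (Ne.symm hy)
  rw [Summable.tsum_add (h.summable_row x hF) (summable_of_ne_finset_zero (s := {x}) fun y hy =>
    h0 y fun hyx => hy (Finset.mem_singleton.2 hyx)), tsum_eq_single x h0, if_pos rfl]

theorem vertexCond_lazy (x : V) : vertexCond (lazyCond a) x = vertexCond a x := by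
  rw [vertexCond]
  simp only [lazyCond]
  rw [tsum_div_const, h.tsum_row_add_diag x _ (h.zero x)]
  exact add_self_div_two _

open scoped Classical in
theorem stepKernel_lazy (x y : V) :
    stepKernel (lazyCond a) x y = (stepKernel a x y + if x = y then 1 else 0) / 2 := by
  rw [stepKernel, h.vertexCond_lazy, lazyCond, stepKernel]
  have := (h.vertexCond_pos x).ne'
  split_ifs
  · field_simp
  · ring

/-- Adding loops changes neither distances nor vertex conductances, so volume growth survives with
the same constants. -/
theorem snapshot_lazy : Snapshot (fun x y => E x y ∨ x = y) v Cv (lazyCond a) where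
  edge_symm x y := by
    rintro (h1 | h1)
    · exact Or.inl (h.edge_symm x y h1)
    · exact Or.inr h1.symm
  locallyFinite x := ((h.locallyFinite x).union (finite_singleton x)).subset fun y hy => by
    rcases hy with h1 | h1
    · exact Or.inl h1
    · exact Or.inr h1.symm
  connected := h.connected.mono fun x y hxy => by
    rw [SimpleGraph.fromRel_adj] at hxy ⊢
    exact ⟨hxy.1, hxy.2.imp Or.inl Or.inl⟩
  symm x y := by
    by_cases hxy : x = y
    · rw [hxy]
    · rw [lazyCond, lazyCond, if_neg hxy, if_neg (Ne.symm hxy), h.symm]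
  nonneg x y := by
    have h1 := h.nonneg x y
    have h2 := (h.vertexCond_pos x).le
    unfold lazyCond
    split_ifs <;> linarith
  zero x y hxy := by
    rw [not_or] at hxy
    rw [lazyCond, if_neg hxy.2, h.zero x y hxy.1]
    norm_num
  lower x r hr := by
    simp only [ballVol, h.vertexCond_lazy]
    rw [gball_lazy]
    exact h.lower x r hr
  upper x r hr := by
    simp only [ballVol, h.vertexCond_lazy]
    rw [gball_lazy]
    exact h.upper x r hr
  mono := h.mono
  doubling := h.doubling
  v_zero := h.v_zero
  v_one := h.v_one

theorem stepMean_lazy (f : V → ℝ) (x : V) :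
    stepMean (lazyCond a) f x = (stepMean a f x + f x) / 2 := by
  classical
  simp only [stepMean, h.stepKernel_lazy]
  have h1 : ∀ y, (stepKernel a x y + if x = y then 1 else 0) / 2 * f y =
      (stepKernel a x y * f y + if x = y then f x else 0) / 2 := fun y => by
    split_ifs with hxy
    · rw [hxy]; ring
    · ring
  simp only [h1]
  rw [tsum_div_const, h.tsum_row_add_diag x _ fun y hy => by rw [h.stepKernel_zero hy, zero_mul]]

/-- Loops carry no energy, so the lazy Dirichlet form is half of the original one. The absolute
value is there because `CP` has no prescribed sign. -/
theorem poincareAt_lazy {CP : ℝ} (hP : PoincareAt E a CP) :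
    PoincareAt (fun x y => E x y ∨ x = y) (lazyCond a) (2 * |CP|) := by
  intro f x r hr
  rw [gball_lazy]
  have h1 : ∀ x y, (f x - f y) ^ 2 * stepKernel (lazyCond a) x y * vertexCond (lazyCond a) x =
      1 / 2 * ((f x - f y) ^ 2 * stepKernel a x y * vertexCond a x) := by
    intro x y
    rw [h.stepKernel_lazy, h.vertexCond_lazy]
    split_ifs with hxy
    · rw [hxy]; ring
    · ring
  simp only [h1]
  simp only [tsum_mul_left, h.vertexCond_lazy]
  refine (hP f x r hr).trans ?_
  set Q := ∑' x' : gball E x (2 * r), ∑' y : gball E x (2 * r),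
        (f x' - f y) ^ 2 * stepKernel a x' y * vertexCond a x'
  have hQ : 0 ≤ Q := tsum_nonneg fun x' => tsum_nonneg fun y => mul_nonneg
    (mul_nonneg (sq_nonneg _) (h.stepKernel_nonneg _ _)) (h.vertexCond_pos _).le
  have h2 : CP * r ^ 2 * Q ≤ |CP| * r ^ 2 * Q := by
    gcongr
    exact le_abs_self CP
  linarith

end Snapshot

/-! ### Bounds on Poisson mixtures -/

theorem factorial_add_le (n m : ℕ) :
    (n + m).factorial ≤ m.factorial * n.factorial * (n + 1) ^ m := by
  induction m with
  | zero => simp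
  | succ m ih =>
    rw [← add_assoc, Nat.factorial_succ]
    calc (n + m + 1) * (n + m).factorial
        ≤ ((m + 1) * (n + 1)) * (m.factorial * n.factorial * (n + 1) ^ m) :=
          Nat.mul_le_mul (by nlinarith) ih
      _ = _ := by rw [Nat.factorial_succ, pow_succ]; ring

/-- A negative power of `n + 1` is traded for a shift of the index by `m`, after which the weights
still sum to at most one. -/
theorem poissonWeight_mul_pow_le {q : ℝ} (hq : 0 ≤ q) (n m : ℕ) :
    poissonWeight q n * (q / (n + 1)) ^ m ≤ m.factorial * poissonWeight q (n + m) := by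
  have h1 : ((n + m).factorial : ℝ) ≤ m.factorial * n.factorial * (n + 1) ^ m := by
    exact_mod_cast factorial_add_le n m
  have h2 : (0 : ℝ) < (n + m).factorial := by positivity
  unfold poissonWeight
  have h3 : Real.exp (-q) * (q ^ n / n.factorial) * (q / (n + 1)) ^ m =
      Real.exp (-q) * q ^ (n + m) * (1 / (n.factorial * (n + 1) ^ m)) := by
    rw [div_pow, pow_add]; field_simp
  have h4 : m.factorial * (Real.exp (-q) * (q ^ (n + m) / (n + m).factorial)) =
      Real.exp (-q) * q ^ (n + m) * (m.factorial / (n + m).factorial) := by ring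
  rw [h3, h4]
  refine mul_le_mul_of_nonneg_left ?_ (by positivity)
  rw [div_le_div_iff₀ (by positivity) h2]
  linarith

/-- Exponential tilting of a Poisson law is a Poisson law of mean `q exp a`. -/
theorem exp_mul_poissonWeight (a q : ℝ) (n : ℕ) :
    Real.exp (a * n) * poissonWeight q n =
      Real.exp (q * (Real.exp a - 1)) * poissonWeight (q * Real.exp a) n := by
  have h1 : Real.exp (a * n) = Real.exp a ^ n := by rw [← Real.exp_nat_mul]; congr 1; ring
  have h2 : Real.exp (q * (Real.exp a - 1)) * Real.exp (-(q * Real.exp a)) = Real.exp (-q) := by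
    rw [← Real.exp_add]; congr 1; ring
  rw [poissonWeight, poissonWeight, ← h2, h1, mul_pow]
  ring

/-- Doubling gives polynomial growth: enlarging a radius by `λ ≥ 1` multiplies `v` by at most `Cv λ
^ (2 m)` when `Cv ≤ 4 ^ m`. Here `λ² = q / (n + 1)`, the shift avoiding a division by zero at `n =
0`. -/
theorem Snapshot.v_sqrt_le {V : Type*} {E : V → V → Prop} {v : ℝ → ℝ} {Cv : ℝ} {a : V → V → ℝ}
    (h : Snapshot E v Cv a) {m : ℕ} (hm : Cv ≤ 4 ^ m) {q : ℝ} (hq : 0 ≤ q) (n : ℕ) :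
    v (Real.sqrt q) ≤ Cv ^ 2 * (1 + (q / (n + 1)) ^ m) * v (Real.sqrt n) := by
  have hCv := h.Cv_pos
  have hC1 := h.one_le
  have hn : (0 : ℝ) < n + 1 := by positivity
  have hx : 0 ≤ q / (n + 1) := by positivity
  have hvn := h.v_pos (Real.sqrt_nonneg n)
  have h1 : v (Real.sqrt (n + 1)) ≤ Cv * v (Real.sqrt n) := by
    rcases Nat.eq_zero_or_pos n with h0 | h0
    · subst h0
      simp [h.v_zero, h.v_one, hC1]
    · have := h.v_le_of_le_two_pow_mul 1 (Real.sqrt_nonneg n) (Real.sqrt_nonneg (n + 1)) ?_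
      · simpa using this
      have h0' : (1 : ℝ) ≤ n := by exact_mod_cast h0
      calc Real.sqrt (n + 1) ≤ Real.sqrt ((2 ^ 1) ^ 2 * n) := Real.sqrt_le_sqrt (by linarith)
        _ = 2 ^ 1 * Real.sqrt n := by
          rw [Real.sqrt_mul (by positivity), Real.sqrt_sq (by norm_num)]
  have h2 : v (Real.sqrt q) ≤ Cv * (1 + (q / (n + 1)) ^ m) * v (Real.sqrt (n + 1)) := by
    have hvn1 := h.v_pos (Real.sqrt_nonneg ((n : ℝ) + 1))
    have hsq : Real.sqrt q = Real.sqrt (q / (n + 1)) * Real.sqrt (n + 1) := by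
      rw [← Real.sqrt_mul hx]; congr 1; field_simp
    rcases le_total q (n + 1) with h0 | h0
    · calc v (Real.sqrt q) ≤ v (Real.sqrt (n + 1)) :=
            h.v_mono (Real.sqrt_nonneg _) (Real.sqrt_le_sqrt h0)
        _ ≤ _ := le_mul_of_one_le_left hvn1.le (by
            have := mul_nonneg hCv.le (pow_nonneg hx m)
            linarith)
    · have hx1 : 1 ≤ Real.sqrt (q / (n + 1)) := Real.one_le_sqrt.2 ((one_le_div hn).2 h0)
      obtain ⟨j, hj1, hj2⟩ := exists_nat_pow_near hx1 one_lt_two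
      have h3 := h.v_le_of_le_two_pow_mul (j + 1) (Real.sqrt_nonneg ((n : ℝ) + 1))
        (Real.sqrt_nonneg q) (by
          rw [hsq]; exact mul_le_mul_of_nonneg_right hj2.le (Real.sqrt_nonneg _))
      have h4 : Cv ^ j ≤ (q / (n + 1)) ^ m := by
        calc Cv ^ j ≤ (4 ^ m) ^ j := pow_le_pow_left₀ hCv.le hm j
          _ = ((2 ^ j) ^ 2) ^ m := by
            rw [← pow_mul, ← pow_mul, ← pow_mul, show (4 : ℝ) = 2 ^ 2 by norm_num, ← pow_mul]
            congr 1; ring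
          _ ≤ (Real.sqrt (q / (n + 1)) ^ 2) ^ m := by gcongr
          _ = _ := by rw [Real.sq_sqrt hx]
      refine h3.trans (mul_le_mul_of_nonneg_right ?_ hvn1.le)
      rw [pow_succ, mul_comm]
      exact mul_le_mul_of_nonneg_left (by linarith) hCv.le
  calc _ ≤ _ := h2
    _ ≤ Cv * (1 + (q / (n + 1)) ^ m) * (Cv * v (Real.sqrt n)) :=
      mul_le_mul_of_nonneg_left h1 (by positivity)
    _ = _ := by ring

/-- Small values of `n`, where `v (√n)` is much smaller than `v (√q)`, are unlikely: `v_sqrt_le`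
bounds the ratio by a power, and `poissonWeight_mul_pow_le` absorbs it. -/
theorem sum_poissonWeight_div_le (Cv : ℝ) : ∃ B : ℝ, 0 < B ∧
    ∀ (V : Type u) (E : V → V → Prop) (v : ℝ → ℝ) (a : V → V → ℝ) (_ : Snapshot E v Cv a)
      (q : ℝ), 0 ≤ q → ∀ N : ℕ,
      ∑ n ∈ Finset.range N, poissonWeight q n / v (Real.sqrt n) ≤ B / v (Real.sqrt q) := by
  by_cases hC : 1 ≤ Cv
  swap
  · exact ⟨1, one_pos, fun V E v a h => absurd h.one_le hC⟩
  have hC0 : 0 < Cv := one_pos.trans_le hC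
  obtain ⟨m, hm⟩ := pow_unbounded_of_one_lt Cv (by norm_num : (1 : ℝ) < 4)
  refine ⟨Cv ^ 2 * (1 + m.factorial), by positivity, fun V E v a h q hq N => ?_⟩
  have hv := h.v_pos (Real.sqrt_nonneg q)
  have h1 : ∀ n : ℕ, poissonWeight q n / v (Real.sqrt n) ≤ Cv ^ 2 / v (Real.sqrt q) *
      (poissonWeight q n + m.factorial * poissonWeight q (n + m)) := by
    intro n
    have hvn := h.v_pos (Real.sqrt_nonneg n)
    have h2 := h.v_sqrt_le hm.le hq n
    have h3 := poissonWeight_mul_pow_le hq n m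
    have h4 := poissonWeight_nonneg hq n
    rw [div_le_iff₀ hvn, div_mul_eq_mul_div, div_mul_eq_mul_div, le_div_iff₀ hv]
    calc poissonWeight q n * v (Real.sqrt q)
        ≤ poissonWeight q n * (Cv ^ 2 * (1 + (q / (n + 1)) ^ m) * v (Real.sqrt n)) :=
          mul_le_mul_of_nonneg_left h2 h4
      _ = Cv ^ 2 * (poissonWeight q n + poissonWeight q n * (q / (n + 1)) ^ m) *
          v (Real.sqrt n) := by ring
      _ ≤ _ := by gcongr
  have h5 : ∑ n ∈ Finset.range N, poissonWeight q (n + m) ≤ 1 := by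
    have := sum_poissonWeight_le_one hq ((Finset.range N).map (addRightEmbedding m))
    simpa only [Finset.sum_map, addRightEmbedding_apply] using this
  calc _ ≤ ∑ n ∈ Finset.range N, Cv ^ 2 / v (Real.sqrt q) *
      (poissonWeight q n + m.factorial * poissonWeight q (n + m)) :=
        Finset.sum_le_sum fun n _ => h1 n
    _ = Cv ^ 2 / v (Real.sqrt q) * (∑ n ∈ Finset.range N, poissonWeight q n +
        m.factorial * ∑ n ∈ Finset.range N, poissonWeight q (n + m)) := by
        rw [← Finset.mul_sum, Finset.sum_add_distrib, Finset.mul_sum]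
    _ ≤ Cv ^ 2 / v (Real.sqrt q) * (1 + m.factorial * 1) := by
        gcongr
        exact sum_poissonWeight_le_one hq _
    _ = _ := by ring

end TimeVaryingWalk

/-! ### The constant speed walk as a mixture of lazy discrete walks. -/

namespace TimeVaryingWalk

universe u

section Discrete

variable {V : Type*} {E : V → V → Prop} {v : ℝ → ℝ} {Cv : ℝ} {c : ℕ → V → V → ℝ}

theorem dtrwSteps_congr {c c' : ℕ → V → V → ℝ} (n : ℕ) :
    ∀ (s : ℕ), (∀ i, i ≤ s + n → c i = c' i) → ∀ x z, dtrwSteps c n s x z = dtrwSteps c' n s x z := by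
  induction n with
  | zero => intro s _ x z; rfl
  | succ n ih =>
    intro s h x z
    simp only [dtrwSteps]
    rw [h (s + 1) (by omega)]
    exact tsum_congr fun y => by rw [ih (s + 1) (fun i hi => h i (by omega))]

theorem sum_dtrwSteps_le_one (hS : ∀ i, Snapshot E v Cv (c i)) (n : ℕ) :
    ∀ (s : ℕ) (x : V) (Z : Finset V), ∑ z ∈ Z, dtrwSteps c n s x z ≤ 1 := by
  induction n with
  | zero =>
    intro s x Z
    classical
    simp only [dtrwSteps]
    rw [Finset.sum_ite_eq]
    split_ifs
    · exact le_rfl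
    · exact zero_le_one
  | succ n ih =>
    intro s x Z
    have h1 := (hS (s + 1)).stepMean_sum Z (fun z y => dtrwSteps c n (s + 1) y z) x
    have h2 := (hS (s + 1)).stepMean_mono (fun y => ih (s + 1) y Z) x
    rw [(hS (s + 1)).stepMean_const, h1] at h2
    exact h2

end Discrete

namespace Environment

variable {V : Type*} {E : V → V → Prop} {v : ℝ → ℝ} {Cv : ℝ} {c : ℝ → V → V → ℝ}
variable (H : Environment E v Cv c)
include H

/-- The constant speed walk is bounded by a Poisson mixture of lazy discrete time walks. -/
theorem sum_dtrwSteps_mul_csrwKernel_le {t : ℝ} {x z : V} {B : ℕ → ℝ}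
    (hB : ∀ θ : ℕ → ℝ, Monotone θ → ∀ n,
      dtrwSteps (fun i => lazyCond (c (θ i))) n 0 x z ≤ B n) (N : ℕ) :
    ∀ (k : ℕ) (s : ℝ) (θ : ℕ → ℝ), Monotone θ → (∀ i, θ i ≤ s) → s ≤ t →
      ∑ y ∈ (H.snap 0).ball x k,
        dtrwSteps (fun i => lazyCond (c (θ i))) k 0 x y * csrwKernel c s t y z ≤
      ∑ n ∈ Finset.range N, B (k + n) * poissonWeight (2 * (t - s)) n +
        (2 * (t - s)) ^ N / N.factorial := by
  have hS : ∀ θ : ℕ → ℝ, ∀ i, Snapshot (fun x y => E x y ∨ x = y) v Cv (lazyCond (c (θ i))) :=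
    fun θ i => (H.snap (θ i)).snapshot_lazy
  -- `N` counts the arrivals still to be resolved and `k` those already made, at the times recorded
  -- in `θ`. At `N = 0` the total mass `1` is the remainder, and each further integration turns it
  -- into the next term of the exponential series.
  induction N with
  | zero =>
    intro k s θ hθ hs hst
    simp only [Finset.range_zero, Finset.sum_empty, pow_zero, Nat.factorial_zero, Nat.cast_one,
      div_one, zero_add]
    refine (Finset.sum_le_sum fun y _ => mul_le_of_le_one_right (dtrwSteps_nonneg (hS θ) k 0 x y)
      (H.csrwKernel_le_one hst y z)).trans (sum_dtrwSteps_le_one (hS θ) k 0 x _)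
  | succ N ih =>
    intro k s θ hθ hs hst
    set T := (H.snap 0).ball x k with hT
    have hTmem : ∀ y, gdist (fun x y => E x y ∨ x = y) x y ≤ k → y ∈ T := fun y hy =>
      (H.snap 0).mem_ball.2 (by rw [gdist_lazy] at hy; exact_mod_cast hy)
    set A := fun y => dtrwSteps (fun i => lazyCond (c (θ i))) k 0 x y with hA
    have hA0 : ∀ y, 0 ≤ A y := fun y => dtrwSteps_nonneg (hS θ) k 0 x y
    set F := fun (ξ : ℝ) (y : V) =>
      stepMean (c ξ) (fun w => csrwKernel c ξ t w z) y + csrwKernel c ξ t y z with hF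
    have hFi : ∀ y, IntervalIntegrable (fun ξ => Real.exp (-(2 * (ξ - s))) * F ξ y) volume s t := by
      intro y
      have h1 := H.continuousOn_csrwKernel s t
      have h2 : IntervalIntegrable (fun ξ => F ξ y) volume s t :=
        (H.intervalIntegrable_stepMean (fun w => by rw [uIcc_of_le hst]; exact h1 w z) y).add
          (ContinuousOn.intervalIntegrable (by rw [uIcc_of_le hst]; exact h1 y z))
      exact h2.continuousOn_mul (by fun_prop)
    have hstep : ∀ ξ ∈ Icc s t, ∑ y ∈ T, A y * F ξ y ≤
        2 * (∑ n ∈ Finset.range N, B (k + 1 + n) * poissonWeight (2 * (t - ξ)) n +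
          (2 * (t - ξ)) ^ N / N.factorial) := by
      intro ξ hξ
      -- The new arrival time `ξ` is appended after the first `k` steps; all earlier times are at
      -- most `s ≤ ξ`, so the sequence stays monotone.
      set θ' : ℕ → ℝ := fun i => if i ≤ k then θ i else ξ with hθ'
      have hmono : Monotone θ' := by
        intro i j hij
        simp only [hθ']
        split_ifs with h1 h2
        · exact hθ hij
        · exact (hs i).trans hξ.1
        · omega
        · exact le_rfl
      have hle : ∀ i, θ' i ≤ ξ := by
        intro i
        simp only [hθ']
        split_ifs
        · exact (hs i).trans hξ.1
        · exact le_rfl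
      have h1 := ih (k + 1) ξ θ' hmono hle hξ.2
      refine le_trans (le_of_eq ?_) (mul_le_mul_of_nonneg_left h1 zero_le_two)
      have h2 : ∀ w, dtrwSteps (fun i => lazyCond (c (θ' i))) (k + 1) 0 x w =
          ∑ y ∈ T, A y * stepKernel (lazyCond (c ξ)) y w := by
        intro w
        rw [dtrwSteps_add (hS θ') k 1 0 x w T hTmem]
        refine Finset.sum_congr rfl fun y _ => ?_
        rw [dtrwSteps_one (hS θ')]
        congr 1
        · refine dtrwSteps_congr k 0 (fun i hi => ?_) x y
          simp only [hθ']
          rw [if_pos (by omega)]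
        · simp only [hθ']
          rw [if_neg (by omega)]
      simp only [h2, Finset.sum_mul]
      rw [Finset.sum_comm, Finset.mul_sum]
      refine Finset.sum_congr rfl fun y hy => ?_
      have h3 : F ξ y = 2 * stepMean (lazyCond (c ξ)) (fun w => csrwKernel c ξ t w z) y := by
        rw [(H.snap ξ).stepMean_lazy]; simp only [hF]; ring
      have h4 := (H.snap ξ).snapshot_lazy
      have h5 : stepMean (lazyCond (c ξ)) (fun w => csrwKernel c ξ t w z) y =
          ∑ w ∈ (H.snap 0).ball x ((k + 1 : ℕ) : ℝ),
            stepKernel (lazyCond (c ξ)) y w * csrwKernel c ξ t w z := by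
        rw [h4.stepMean_eq]
        refine Finset.sum_subset (fun w hw => ?_) fun w _ hw => ?_
        · have h6 := gdist_le_one (E := fun x y => E x y ∨ x = y) (h4.mem_nbrs.1 hw)
          rw [gdist_lazy] at h6
          have h7 := gdist_triangle (H.snap 0).connected x y w
          have h8 : gdist E x y ≤ k := by exact_mod_cast (H.snap 0).mem_ball.1 hy
          refine (H.snap 0).mem_ball.2 ?_
          exact_mod_cast (by omega : gdist E x w ≤ k + 1)
        · rw [h4.stepKernel_zero fun hE => hw (h4.mem_nbrs.2 hE), zero_mul]
      rw [h3, h5, mul_left_comm, Finset.mul_sum]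
      simp only [mul_assoc]
    have hzero : ∑ y ∈ T, A y * (csrwPart c t z 0 t y * Real.exp (-(2 * (t - s)))) ≤
        B k * Real.exp (-(2 * (t - s))) := by
      have h1 : ∑ y ∈ T, A y * csrwPart c t z 0 t y ≤ A z := by
        classical
        simp only [csrwPart, sub_self, neg_zero, Real.exp_zero, mul_ite, mul_one, mul_zero]
        rw [Finset.sum_ite_eq']
        split_ifs
        · exact le_rfl
        · exact hA0 z
      simp only [← mul_assoc]
      rw [← Finset.sum_mul]
      exact mul_le_mul_of_nonneg_right (h1.trans (hB θ hθ k)) (Real.exp_pos _).le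
    have hint : ∑ y ∈ T, A y * ∫ ξ in s..t, Real.exp (-(2 * (ξ - s))) * F ξ y ≤
        ∑ n ∈ Finset.range N, B (k + 1 + n) * poissonWeight (2 * (t - s)) (n + 1) +
          (2 * (t - s)) ^ (N + 1) / (N + 1).factorial := by
      simp only [← intervalIntegral.integral_const_mul]
      rw [← intervalIntegral.integral_finsetSum fun y _ => (hFi y).const_mul _]
      simp only [← integral_poissonWeight 2 s t, ← integral_rate_pow 2 s t]
      simp only [← intervalIntegral.integral_const_mul (B _)]
      have hc1 : ∀ n : ℕ, IntervalIntegrable (fun ξ => B (k + 1 + n) *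
          (2 * Real.exp (-(2 * (ξ - s))) * poissonWeight (2 * (t - ξ)) n)) volume s t := fun n => by
        have := continuous_poissonWeight n
        exact Continuous.intervalIntegrable (by fun_prop) _ _
      have hc2 : IntervalIntegrable (fun ξ => 2 * ((2 * (t - ξ)) ^ N / N.factorial))
          volume s t := Continuous.intervalIntegrable (by fun_prop) _ _
      rw [← intervalIntegral.integral_finsetSum fun n _ => hc1 n,
        ← intervalIntegral.integral_add (intervalIntegrable_sum _ hc1) hc2]
      refine intervalIntegral.integral_mono_on hst
        (intervalIntegrable_sum _ fun y => (hFi y).const_mul _)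
        ((intervalIntegrable_sum _ hc1).add hc2) fun ξ hξ => ?_
      have h1 := mul_le_mul_of_nonneg_left (hstep ξ hξ) (Real.exp_pos (-(2 * (ξ - s)))).le
      have h2 : 0 ≤ 2 * ((2 * (t - ξ)) ^ N / N.factorial) := by
        have : 0 ≤ t - ξ := by linarith [hξ.2]
        positivity
      have h3 : Real.exp (-(2 * (ξ - s))) ≤ 1 := Real.exp_le_one_iff.2 (by linarith [hξ.1])
      have h4 := mul_le_of_le_one_left h2 h3
      calc ∑ y ∈ T, A y * (Real.exp (-(2 * (ξ - s))) * F ξ y)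
          = Real.exp (-(2 * (ξ - s))) * ∑ y ∈ T, A y * F ξ y := by
            rw [Finset.mul_sum]
            exact Finset.sum_congr rfl fun y _ => by ring
        _ ≤ _ := h1
        _ = ∑ n ∈ Finset.range N, B (k + 1 + n) *
              (2 * Real.exp (-(2 * (ξ - s))) * poissonWeight (2 * (t - ξ)) n) +
            Real.exp (-(2 * (ξ - s))) * (2 * ((2 * (t - ξ)) ^ N / N.factorial)) := by
            rw [mul_add, mul_add, Finset.mul_sum, Finset.mul_sum]
            congr 1
            exact Finset.sum_congr rfl fun n _ => by ring
        _ ≤ _ := by linarith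
    have hu : ∀ y, csrwKernel c s t y z = csrwPart c t z 0 t y * Real.exp (-(2 * (t - s))) +
        ∫ ξ in s..t, Real.exp (-(2 * (ξ - s))) * F ξ y := fun y => H.csrwKernel_eq_lazy hst y z
    have hsum : ∑ y ∈ T, A y * csrwKernel c s t y z =
        ∑ y ∈ T, A y * (csrwPart c t z 0 t y * Real.exp (-(2 * (t - s)))) +
          ∑ y ∈ T, A y * ∫ ξ in s..t, Real.exp (-(2 * (ξ - s))) * F ξ y := by
      rw [← Finset.sum_add_distrib]
      exact Finset.sum_congr rfl fun y _ => by rw [hu y, mul_add]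
    rw [hsum, Finset.sum_range_succ' _ N, add_zero, poissonWeight_zero]
    have h6 : ∑ n ∈ Finset.range N, B (k + (n + 1)) * poissonWeight (2 * (t - s)) (n + 1) =
        ∑ n ∈ Finset.range N, B (k + 1 + n) * poissonWeight (2 * (t - s)) (n + 1) :=
      Finset.sum_congr rfl fun n _ => by rw [show k + (n + 1) = k + 1 + n by omega]
    rw [h6]
    linarith

/-- The remainder `(2 (t - s)) ^ N / N!` tends to zero. -/
theorem csrwKernel_le_of_lazy {s t : ℝ} (hst : s ≤ t) {x z : V} {B : ℕ → ℝ} {M : ℝ}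
    (hB : ∀ θ : ℕ → ℝ, Monotone θ → ∀ n,
      dtrwSteps (fun i => lazyCond (c (θ i))) n 0 x z ≤ B n)
    (hM : ∀ N, ∑ n ∈ Finset.range N, B n * poissonWeight (2 * (t - s)) n ≤ M) :
    csrwKernel c s t x z ≤ M := by
  have h1 : ∀ N : ℕ, csrwKernel c s t x z ≤ M + (2 * (t - s)) ^ N / N.factorial := by
    intro N
    have h2 := H.sum_dtrwSteps_mul_csrwKernel_le hB N 0 s (fun _ => s) monotone_const
      (fun _ => le_rfl) hst
    rw [Nat.cast_zero, (H.snap 0).ball_zero, Finset.sum_singleton, dtrwSteps_zero_self,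
      one_mul] at h2
    simp only [zero_add] at h2
    exact h2.trans (add_le_add_left (hM N) _)
  have h3 := (FloorSemiring.tendsto_pow_div_factorial_atTop (2 * (t - s))).const_add M
  rw [add_zero] at h3
  exact ge_of_tendsto' h3 h1

end Environment

/-- Exponential and Poissonian bounds for the constant speed walk. -/
theorem csrwKernel_bounds (CP Cv : ℝ) : ∃ C : ℝ, 1 ≤ C ∧
    ∀ (V : Type u) (E : V → V → Prop) (v : ℝ → ℝ) (c : ℝ → V → V → ℝ)
      (_ : Environment E v Cv c) (_ : ∀ t, PoincareAt E (c t) CP)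
      (s t : ℝ) (_ : s ≤ t) (x z : V),
      (∀ l, 0 ≤ l → l ≤ 1 → csrwKernel c s t x z ≤ C / v (Real.sqrt (t - s)) *
        Real.exp (-(l * gdist E x z) + C * l ^ 2 * (t - s))) ∧
      (∀ l, 0 ≤ l → t - s ≤ gdist E x z → csrwKernel c s t x z ≤ C / v (Real.sqrt (t - s)) *
        Real.exp (-(l * gdist E x z) + 2 * (t - s) * (Real.exp l - 1))) := by
  obtain ⟨C₀, hC₀, hdt⟩ := dtrwSteps_le.{u} Cv (2 * |CP|) (1 / 2) (by norm_num)
  obtain ⟨B, hB0, hB⟩ := sum_poissonWeight_div_le.{u} Cv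
  have hC₀0 : 0 < C₀ := one_pos.trans_le hC₀
  refine ⟨C₀ + C₀ * B + 2 * C₀ * Real.exp C₀, ?_, fun V E v c H hP s t hst x z => ?_⟩
  · have : 0 ≤ C₀ * B + 2 * C₀ * Real.exp C₀ := by positivity
    linarith
  set C := C₀ + C₀ * B + 2 * C₀ * Real.exp C₀ with hC
  have q1 : 0 < C₀ * B := by positivity
  have q2 : 0 < 2 * C₀ * Real.exp C₀ := by positivity
  have hsteps : ∀ θ : ℕ → ℝ, Monotone θ → ∀ n l, 0 ≤ l → l ≤ 1 →
      dtrwSteps (fun i => lazyCond (c (θ i))) n 0 x z ≤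
        C₀ / v (Real.sqrt n) * Real.exp (-(l * gdist E x z) + C₀ * l ^ 2 * n) := by
    intro θ hθ n l hl0 hl1
    have h1 := hdt V (fun x y => E x y ∨ x = y) v (fun i => lazyCond (c (θ i)))
      (fun i => (H.snap _).snapshot_lazy) (fun i => (H.snap _).poincareAt_lazy (hP _))
      (fun i y => by
        rw [(H.snap _).stepKernel_lazy, if_pos rfl]
        have := (H.snap (θ i)).stepKernel_nonneg y y
        linarith)
      (fun y i j hij => by
        simp only [(H.snap _).vertexCond_lazy]
        exact H.mono y (hθ hij)) n 0 x z l hl0 hl1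
    rwa [gdist_lazy] at h1
  have hτ : 0 ≤ t - s := sub_nonneg.2 hst
  set τ := t - s
  have hv := (H.snap 0).v_pos (Real.sqrt_nonneg τ)
  set d : ℝ := (gdist E x z : ℝ)
  constructor
  · intro l hl0 hl1
    -- The discrete bound at rate `l` grows like `exp (C₀ l² n)`; tilting turns this into a Poisson
    -- law of larger mean, and the average of `1 / v (√n)` under it is at most `B / v (√τ)`.
    have hB' := H.csrwKernel_le_of_lazy hst (x := x) (z := z)
      (B := fun n => C₀ / v (Real.sqrt n) * Real.exp (-(l * d) + C₀ * l ^ 2 * n))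
      (M := C₀ * B / v (Real.sqrt τ) *
        Real.exp (-(l * d) + 2 * τ * (Real.exp (C₀ * l ^ 2) - 1)))
      (fun θ hθ n => hsteps θ hθ n l hl0 hl1) (fun N => ?_)
    · refine hB'.trans ?_
      have h1 : Real.exp (C₀ * l ^ 2) - 1 ≤ C₀ * l ^ 2 * Real.exp C₀ := by
        have h2 : C₀ * l ^ 2 ≤ C₀ := mul_le_of_le_one_right hC₀0.le (pow_le_one₀ hl0 hl1)
        have h3 : 1 - C₀ * l ^ 2 ≤ Real.exp (-(C₀ * l ^ 2)) := by
          have := Real.add_one_le_exp (-(C₀ * l ^ 2)); linarith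
        have h4 : Real.exp (C₀ * l ^ 2) * Real.exp (-(C₀ * l ^ 2)) = 1 := by
          rw [← Real.exp_add, add_neg_cancel, Real.exp_zero]
        have h5 := mul_le_mul_of_nonneg_left h3 (Real.exp_pos (C₀ * l ^ 2)).le
        have h6 : C₀ * l ^ 2 * Real.exp (C₀ * l ^ 2) ≤ C₀ * l ^ 2 * Real.exp C₀ := by gcongr
        linarith
      have h7 : 2 * τ * (Real.exp (C₀ * l ^ 2) - 1) ≤ C * l ^ 2 * τ := by
        calc 2 * τ * (Real.exp (C₀ * l ^ 2) - 1) ≤ 2 * τ * (C₀ * l ^ 2 * Real.exp C₀) := by gcongr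
          _ = 2 * C₀ * Real.exp C₀ * (l ^ 2 * τ) := by ring
          _ ≤ C * (l ^ 2 * τ) := mul_le_mul_of_nonneg_right (by linarith) (by positivity)
          _ = _ := by ring
      have h8 : C₀ * B ≤ C := by linarith
      gcongr
    · set a := C₀ * l ^ 2
      have ha : 0 ≤ a := by positivity
      have h1 : ∀ n : ℕ, C₀ / v (Real.sqrt n) * Real.exp (-(l * d) + a * n) *
          poissonWeight (2 * τ) n = C₀ * Real.exp (-(l * d) + 2 * τ * (Real.exp a - 1)) *
            (poissonWeight (2 * τ * Real.exp a) n / v (Real.sqrt n)) := by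
        intro n
        have := exp_mul_poissonWeight a (2 * τ) n
        rw [Real.exp_add, Real.exp_add]
        calc _ = C₀ / v (Real.sqrt n) * Real.exp (-(l * d)) *
              (Real.exp (a * n) * poissonWeight (2 * τ) n) := by ring
          _ = _ := by rw [this]; ring
      refine (Finset.sum_congr rfl fun n _ => h1 n).trans_le ?_
      rw [← Finset.mul_sum]
      have h2 := hB V E v (c 0) (H.snap 0) (2 * τ * Real.exp a) (by positivity) N
      have h3 : v (Real.sqrt τ) ≤ v (Real.sqrt (2 * τ * Real.exp a)) := by
        refine (H.snap 0).v_mono (Real.sqrt_nonneg _) (Real.sqrt_le_sqrt ?_)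
        have := Real.one_le_exp ha
        nlinarith
      calc _ ≤ C₀ * Real.exp (-(l * d) + 2 * τ * (Real.exp a - 1)) * (B / v (Real.sqrt τ)) := by
            gcongr
            refine h2.trans ?_
            gcongr
        _ = _ := by ring
  · intro l hl0 hd
    -- No lazy walk reaches `z` in fewer than `d` steps, and for `n ≥ d ≥ τ` the volume is at least
    -- `v (√τ)`. What remains is a Chernoff bound for the tail of a Poisson variable of mean `2 τ`.
    have hB' := H.csrwKernel_le_of_lazy hst (x := x) (z := z)
      (B := fun n => if d ≤ n then C₀ / v (Real.sqrt τ) else 0)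
      (M := C₀ / v (Real.sqrt τ) * Real.exp (-(l * d) + 2 * τ * (Real.exp l - 1)))
      (fun θ hθ n => ?_) (fun N => ?_)
    · refine hB'.trans ?_
      have : C₀ ≤ C := by linarith
      gcongr
    · split_ifs with hdn
      · have h1 := hsteps θ hθ n 0 le_rfl zero_le_one
        have h0 : -(0 * d) + C₀ * 0 ^ 2 * (n : ℝ) = 0 := by ring
        rw [h0, Real.exp_zero, mul_one] at h1
        refine h1.trans ?_
        have h2 := (H.snap 0).v_mono (Real.sqrt_nonneg τ) (Real.sqrt_le_sqrt (hd.trans hdn))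
        gcongr
      · rw [dtrwSteps_support (fun i => (H.snap (θ i)).snapshot_lazy)]
        rw [gdist_lazy]
        exact Nat.cast_lt.1 (not_le.1 hdn)
    · have h1 : ∀ n : ℕ, (if d ≤ n then C₀ / v (Real.sqrt τ) else 0) * poissonWeight (2 * τ) n ≤
          C₀ / v (Real.sqrt τ) * Real.exp (-(l * d) + 2 * τ * (Real.exp l - 1)) *
            poissonWeight (2 * τ * Real.exp l) n := by
        intro n
        have p1 := poissonWeight_nonneg (by positivity : 0 ≤ 2 * τ) n
        have p2 := poissonWeight_nonneg (by positivity : 0 ≤ 2 * τ * Real.exp l) n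
        split_ifs with hdn
        · have h2 : 1 ≤ Real.exp (-(l * d)) * Real.exp (l * n) := by
            rw [← Real.exp_add, Real.one_le_exp_iff]
            have := mul_le_mul_of_nonneg_left hdn hl0
            linarith
          have h3 := exp_mul_poissonWeight l (2 * τ) n
          calc _ ≤ C₀ / v (Real.sqrt τ) *
                (Real.exp (-(l * d)) * Real.exp (l * n) * poissonWeight (2 * τ) n) := by
                gcongr
                exact le_mul_of_one_le_left p1 h2
            _ = C₀ / v (Real.sqrt τ) * Real.exp (-(l * d)) *
                (Real.exp (l * n) * poissonWeight (2 * τ) n) := by ring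
            _ = _ := by rw [h3, Real.exp_add]; ring
        · rw [zero_mul]
          positivity
      refine (Finset.sum_le_sum fun n _ => h1 n).trans ?_
      rw [← Finset.mul_sum]
      exact mul_le_of_le_one_right (by positivity)
        (sum_poissonWeight_le_one (by positivity) _)

end TimeVaryingWalk

/-! ### The upper bound for the constant speed walk. -/

namespace TimeVaryingWalk

universe u

/-- Freezing the conductances before time `0` keeps monotonicity and measurability and makes them
available on the whole line; kernels at times `≥ 0` are unchanged. -/
theorem StandingCSRW.environment {V : Type*} {E : V → V → Prop} {c : ℝ → V → V → ℝ} {v : ℝ → ℝ}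
    {Cv : ℝ} (h : StandingCSRW E c v Cv) : Environment E v Cv fun t => c (max t 0) where
  snap t := snapshot_of_network h.network h.growth (le_max_right t 0)
  meas x y := by
    have h1 : Measurable fun t : ℝ => (⟨max t 0, mem_Ici.2 (le_max_right t 0)⟩ : Ici (0 : ℝ)) :=
      (measurable_id.max measurable_const).subtype_mk
    exact (h.measurable x y).comp h1
  mono x := fun s t hst => h.monotone x (mem_Ici.2 (le_max_right s 0))
    (mem_Ici.2 (le_max_right t 0)) (max_le_max_right 0 hst)

theorem csrwPart_congr {V : Type*} {c c' : ℝ → V → V → ℝ} (h : ∀ ξ, 0 ≤ ξ → c ξ = c' ξ) (t : ℝ)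
    (z : V) (n : ℕ) : ∀ s, 0 ≤ s → s ≤ t → ∀ x, csrwPart c t z n s x = csrwPart c' t z n s x := by
  induction n with
  | zero => intro s _ _ x; rfl
  | succ n ih =>
    intro s hs hst x
    simp only [csrwPart]
    refine intervalIntegral.integral_congr fun ξ hξ => ?_
    rw [uIcc_of_le hst] at hξ
    rw [h ξ (hs.trans hξ.1)]
    congr 1
    exact tsum_congr fun y => by rw [ih ξ (hs.trans hξ.1) hξ.2]

theorem csrwKernel_congr {V : Type*} {c c' : ℝ → V → V → ℝ} (h : ∀ ξ, 0 ≤ ξ → c ξ = c' ξ)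
    {s t : ℝ} (hs : 0 ≤ s) (hst : s ≤ t) (x z : V) : csrwKernel c s t x z = csrwKernel c' s t x z :=
  tsum_congr fun n => csrwPart_congr h t z n s hs hst x

theorem csrwKernel_max {V : Type*} (c : ℝ → V → V → ℝ) {s t : ℝ} (hs : 0 ≤ s) (hst : s ≤ t)
    (x z : V) : csrwKernel c s t x z = csrwKernel (fun t => c (max t 0)) s t x z :=
  csrwKernel_congr (fun ξ hξ => by rw [max_eq_left hξ]) hs hst x z

theorem decayFactor_csrw_of_lt {C τ : ℝ} {d : ℕ} (hτ : 0 < τ) (hd : τ < d) :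
    decayFactor rateCSRW C τ d = Real.exp (-(d * (Real.log (d / τ) + 1) / C)) := by
  rw [decayFactor, if_neg hτ.ne', rateCSRW, if_neg (not_le.2 ((one_lt_div hτ).2 hd)),
    ← EReal.coe_mul, ← EReal.coe_neg, EReal.exp_coe, ENNReal.toReal_ofReal (Real.exp_pos _).le]
  congr 2
  field_simp

theorem decayFactor_zero (I : ℝ → EReal) (C : ℝ) (d : ℕ) :
    decayFactor I C 0 d = if d = 0 then 1 else 0 := by
  rw [decayFactor, if_pos rfl]

theorem upperBound_csrw (CP Cv : ℝ) : ∃ C : ℝ, 0 < C ∧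
      ∀ (V : Type u) (E : V → V → Prop) (c : ℝ → V → V → ℝ) (v : ℝ → ℝ),
        StandingCSRW E c v Cv → UniformPoincare E c CP → UpperBoundCSRW E c v C := by
  obtain ⟨C, hC, hb⟩ := csrwKernel_bounds.{u} CP Cv
  have hC0 : 0 < C := one_pos.trans_le hC
  refine ⟨20 * C, by positivity, fun V E c v hstand hP s t x z hs hst => ?_⟩
  have H := hstand.environment
  rw [csrwKernel_max c hs hst]
  obtain ⟨h1, h2⟩ := hb V E v _ H (fun t => poincareAt_of_uniform hP (le_max_right t 0)) s t hst x z
  have hv := (H.snap 0).v_pos (Real.sqrt_nonneg (t - s))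
  have hCC : C / v (Real.sqrt (t - s)) ≤ 20 * C / v (Real.sqrt (t - s)) := by gcongr; linarith
  rcases hst.eq_or_lt with h0 | h0
  · subst h0
    rw [sub_self, decayFactor_zero, Real.sqrt_zero, (H.snap 0).v_zero]
    by_cases hxz : x = z
    · rw [hxz, gdist_self, if_pos rfl]
      exact (H.csrwKernel_le_one le_rfl z z).trans (by linarith)
    · rw [if_neg fun h0 => hxz ((gdist_eq_zero (H.snap 0).connected).1 h0), H.csrwKernel_self]
      simp [csrwPart, hxz]
  have hτ : 0 < t - s := sub_pos.2 h0
  set τ := t - s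
  set κ := 1 / (2 * C) with hκ
  have hκ0 : 0 < κ := by positivity
  have hκC : C * κ = 1 / 2 := by rw [hκ]; field_simp
  have hκ1 : κ ≤ 1 := by rw [hκ, div_le_one (by positivity)]; linarith
  have hd0 : (0 : ℝ) ≤ gdist E x z := Nat.cast_nonneg _
  by_cases hd : (gdist E x z : ℝ) ≤ τ
  · rw [decayFactor_of_le (I := rateCSRW) (fun r hr => if_pos hr) hτ hd]
    set d : ℝ := (gdist E x z : ℝ)
    have h3 : d / τ ≤ 1 := (div_le_one hτ).2 hd
    refine (h1 (κ * (d / τ)) (by positivity) (mul_le_one₀ hκ1 (by positivity) h3)).trans ?_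
    refine mul_le_mul hCC (Real.exp_le_exp.2 ?_) (Real.exp_pos _).le (by positivity)
    refine gaussian_exponent_le hκ0 hτ hκC.le ?_
    rw [hκ]
    field_simp
    norm_num
  · push Not at hd
    rw [decayFactor_csrw_of_lt hτ hd]
    set d : ℝ := (gdist E x z : ℝ)
    have hdpos : 0 < d := hτ.trans hd
    have hlog : 0 ≤ Real.log (d / τ) := Real.log_nonneg ((one_le_div hτ).2 hd.le)
    -- Up to this ratio `I` is linear in `d / τ` up to constants, and the fixed rate `κ` suffices;
    -- `20 C` is chosen so that `5 d / (20 C) = κ d / 2`.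
    by_cases hfar : Real.log (d / τ) ≤ 4
    · refine (h1 κ hκ0.le hκ1).trans ?_
      refine mul_le_mul hCC (Real.exp_le_exp.2 ?_) (Real.exp_pos _).le (by positivity)
      have h3 : C * κ ^ 2 * τ ≤ κ / 2 * d := by
        rw [pow_two, ← mul_assoc, hκC]
        calc 1 / 2 * κ * τ ≤ 1 / 2 * κ * d := by gcongr
          _ = κ / 2 * d := by ring
      have h4 : d * (Real.log (d / τ) + 1) / (20 * C) ≤ κ / 2 * d := by
        rw [div_le_iff₀ (by positivity)]
        have : κ / 2 * d * (20 * C) = 10 * d * (C * κ) := by ring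
        rw [this, hκC]
        nlinarith
      linarith
    · push Not at hfar
      have hln2 := Real.log_two_lt_d9
      have hln2' := Real.log_two_gt_d9
      set L := Real.log (d / τ)
      have hexp : Real.exp (L - Real.log 2) = d / τ / 2 := by
        rw [Real.exp_sub, Real.exp_log (by positivity), Real.exp_log two_pos]
      -- The rate `log (d / (2 τ))` is optimal in the Chernoff bound and gives the exponent `-d (L -
      -- log 2) + d - 2 τ`.
      refine (h2 (L - Real.log 2) (by linarith) hd.le).trans ?_
      refine mul_le_mul hCC (Real.exp_le_exp.2 ?_) (Real.exp_pos _).le (by positivity)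
      rw [hexp]
      have h3 : 2 * τ * (d / τ / 2 - 1) = d - 2 * τ := by field_simp
      have h4 : d * (L + 1) / (20 * C) ≤ d * (L + 1) / 20 := by
        gcongr
        linarith
      rw [h3]
      have h5 : 0 ≤ d * (L - 4) := mul_nonneg hdpos.le (by linarith)
      nlinarith

end TimeVaryingWalk

/-! ### From the parabolic Harnack inequality to the two-sided estimates. -/

namespace TimeVaryingWalk

open scoped NNReal

universe u

/-- The Harnack constant for the geometry in which `x₁`, `x₂` are within `A` times the parabolic
length scale. -/
noncomputable def harnackConst (γ : ℝ → ℝ → ℝ → ℝ → ℝ) (A : ℝ) : ℝ :=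
  if γ (1 / (3 * A)) (7 / (8 * A)) (15 / (16 * A)) (1 / A) ∈ Ioo (0 : ℝ) 1 then
    γ (1 / (3 * A)) (7 / (8 * A)) (15 / (16 * A)) (1 / A) else 1

theorem harnackConst_pos (γ : ℝ → ℝ → ℝ → ℝ → ℝ) (A : ℝ) : 0 < harnackConst γ A := by
  unfold harnackConst
  split_ifs with h
  · exact h.1
  · exact one_pos

theorem harnackConst_le_one (γ : ℝ → ℝ → ℝ → ℝ → ℝ) (A : ℝ) : harnackConst γ A ≤ 1 := by
  unfold harnackConst
  split_ifs with h
  · exact h.2.le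
  · exact le_rfl

/-- With `R = A √D` and `D = T - s`, the cylinder spans exactly `[s, T]`, and the admissible range
`(D / 9, 49 D / 64]` of `τ₁` contains `[D / 8, 3 D / 4]`. -/
theorem harnack_scales {A D : ℝ} (hA : 1 ≤ A) (hD : 0 < D) :
    (1 / (3 * A) * (A * Real.sqrt D)) ^ 2 = D / 9 ∧
    (7 / (8 * A) * (A * Real.sqrt D)) ^ 2 = 49 / 64 * D ∧
    (15 / (16 * A) * (A * Real.sqrt D)) ^ 2 = 225 / 256 * D ∧
    (1 / A * (A * Real.sqrt D)) ^ 2 = D := by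
  have hA0 : 0 < A := one_pos.trans_le hA
  have h : ∀ p q : ℝ, 0 < q → (p / (q * A) * (A * Real.sqrt D)) ^ 2 = (p / q) ^ 2 * D := by
    intro p q hq
    have h1 : p / (q * A) * (A * Real.sqrt D) = p / q * Real.sqrt D := by field_simp
    rw [h1, mul_pow, Real.sq_sqrt hD.le]
  refine ⟨?_, ?_, ?_, ?_⟩
  · rw [h 1 3 (by norm_num)]; ring
  · rw [h 7 8 (by norm_num)]; ring
  · rw [h 15 16 (by norm_num)]; ring
  · have := h 1 1 one_pos
    rw [one_mul] at this
    rw [this]; ring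

theorem harnack_exponents {A : ℝ} (hA : 1 ≤ A) : 0 < 1 / (3 * A) ∧ 1 / (3 * A) ≤ 7 / (8 * A) ∧
    7 / (8 * A) < 15 / (16 * A) ∧ 15 / (16 * A) ≤ 1 / A := by
  have hA0 : 0 < A := one_pos.trans_le hA
  refine ⟨by positivity, ?_, ?_, ?_⟩
  · rw [div_le_div_iff₀ (by positivity) (by positivity)]; linarith
  · rw [div_lt_div_iff₀ (by positivity) (by positivity)]; linarith
  · rw [div_le_div_iff₀ (by positivity) (by positivity)]; linarith

/-- The Gaussian decay implies exponential decay. -/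
theorem decayFactor_le_exp {I : ℝ → EReal} (hI : ∀ r, r ≤ 1 → I r = ((r ^ 2 : ℝ) : EReal))
    {C τ : ℝ} {d : ℕ} (hC : 0 < C)
    (hfar : 0 < τ → τ < d → decayFactor I C τ d ≤ Real.exp (-(d / C)))
    (hτ : 0 ≤ τ) {l : ℝ} (hlC : l ≤ 1 / C) :
    decayFactor I C τ d ≤ Real.exp (-(l * d) + C * l ^ 2 * τ) := by
  rcases hτ.eq_or_lt with h0 | h0
  · rw [← h0, decayFactor_zero]
    split_ifs with hd
    · simp [hd]
    · exact (Real.exp_pos _).le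
  by_cases hd : (d : ℝ) ≤ τ
  · rw [decayFactor_of_le hI h0 hd]
    refine Real.exp_le_exp.2 ?_
    have h1 : (d : ℝ) ^ 2 / (C * τ) - l * d + C * l ^ 2 * τ =
        ((d - C * τ * l / 2) ^ 2 + 3 / 4 * (C * τ * l) ^ 2) / (C * τ) := by
      field_simp
      ring
    have h2 : 0 ≤ ((d - C * τ * l / 2) ^ 2 + 3 / 4 * (C * τ * l) ^ 2) / (C * τ) := by positivity
    linarith
  · push Not at hd
    refine (hfar h0 hd).trans (Real.exp_le_exp.2 ?_)
    have h1 : l * d ≤ 1 / C * d := mul_le_mul_of_nonneg_right hlC (Nat.cast_nonneg d)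
    have h2 : 1 / C * d = d / C := by ring
    have h3 : 0 ≤ C * l ^ 2 * τ := by positivity
    linarith

theorem decayFactor_csrw_le_exp {C τ l : ℝ} {d : ℕ} (hC : 0 < C) (hτ : 0 ≤ τ)
    (hlC : l ≤ 1 / C) :
    decayFactor rateCSRW C τ d ≤ Real.exp (-(l * d) + C * l ^ 2 * τ) := by
  refine decayFactor_le_exp (I := rateCSRW) (fun r hr => if_pos hr) hC (fun h0 hd => ?_) hτ hlC
  rw [decayFactor_csrw_of_lt h0 hd]
  refine Real.exp_le_exp.2 (neg_le_neg ?_)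
  have : 0 ≤ Real.log (d / τ) := Real.log_nonneg ((one_le_div h0).2 hd.le)
  have h1 : (d : ℝ) ≤ d * (Real.log (d / τ) + 1) :=
    le_mul_of_one_le_right (Nat.cast_nonneg d) (by linarith)
  gcongr

theorem decayFactor_dtrw_le_exp {C τ l : ℝ} {d : ℕ} (hC : 0 < C) (hτ : 0 ≤ τ)
    (hlC : l ≤ 1 / C) :
    decayFactor rateDTRW C τ d ≤ Real.exp (-(l * d) + C * l ^ 2 * τ) := by
  refine decayFactor_le_exp (I := rateDTRW) (fun r hr => if_pos hr) hC (fun h0 hd => ?_) hτ hlC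
  rw [decayFactor, if_neg h0.ne', rateDTRW, if_neg (not_le.2 ((one_lt_div h0).2 hd)),
    EReal.coe_mul_top_of_pos (by positivity), EReal.neg_top, EReal.exp_bot, ENNReal.toReal_zero]
  exact (Real.exp_pos _).le

theorem IsSolutionCSRW.congr {V : Type*} {E : V → V → Prop} {c c' : ℝ → V → V → ℝ} {t₁ t₂ : ℝ}
    {z : V} {R : ℝ} {u : ℝ → V → ℝ} (hc : ∀ ξ, 0 ≤ ξ → c ξ = c' ξ) (ht₁ : 0 ≤ t₁)
    (h : IsSolutionCSRW E c t₁ t₂ z R u) : IsSolutionCSRW E c' t₁ t₂ z R u where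
  nonneg := h.nonneg
  absCont := h.absCont
  equation x hx := by
    have h1 := h.equation x hx
    rw [ae_restrict_iff' measurableSet_Icc] at h1 ⊢
    filter_upwards [h1] with s hs hsI
    have := hs hsI
    rwa [hc s (ht₁.trans hsI.1)] at this

theorem HarnackCSRW.congr {V : Type*} {E : V → V → Prop} {c c' : ℝ → V → V → ℝ}
    {γ : ℝ → ℝ → ℝ → ℝ → ℝ} (hc : ∀ ξ, 0 ≤ ξ → c ξ = c' ξ) (h : HarnackCSRW E c γ) :
    HarnackCSRW E c' γ := by
  intro θ₁ θ₂ θ₃ θ₄ h1 h2 h3 h4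
  obtain ⟨hγ, hh⟩ := h θ₁ θ₂ θ₃ θ₄ h1 h2 h3 h4
  refine ⟨hγ, fun R T z u hR hT hu => hh R T z u hR hT (hu.congr (fun ξ hξ => (hc ξ hξ).symm) ?_)⟩
  linarith

section Continuous

variable {V : Type*} {E : V → V → Prop} {v : ℝ → ℝ} {Cv : ℝ} {c : ℝ → V → V → ℝ}

theorem Environment.isSolution (H : Environment E v Cv c) {s T t : ℝ} (hsT : s ≤ T) (hTt : T ≤ t)
    (y z : V) (R : ℝ) : IsSolutionCSRW E c s T z R (fun r x => csrwKernel c r t x y) where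
  nonneg r hr x := H.csrwKernel_nonneg (hr.2.trans hTt) x y
  absCont x := (H.absolutelyContinuousOnInterval_csrwKernel (hsT.trans hTt) x y).mono (by
    rw [uIcc_of_le hsT, uIcc_of_le (hsT.trans hTt)]
    exact Icc_subset_Icc_right hTt)
  equation x _ := by
    rw [ae_restrict_iff' measurableSet_Icc]
    filter_upwards [H.ae_hasDerivAt_csrwKernel (hsT.trans hTt) x y] with r hr hrI
    exact hr ⟨hrI.1, hrI.2.trans hTt⟩

variable {γ : ℝ → ℝ → ℝ → ℝ → ℝ}

theorem Environment.harnack (H : Environment E v Cv c) (hγ : HarnackCSRW E c γ) {A s m T t : ℝ}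
    (hA : 1 ≤ A) (hs : 0 ≤ s) (hTt : T ≤ t) (hsT : s < T) (h1 : 1 / 8 * (T - s) ≤ T - m)
    (h2 : T - m ≤ 3 / 4 * (T - s)) {x₁ x₂ : V}
    (hx : (gdist E x₁ x₂ : ℝ) ≤ A * Real.sqrt (T - s)) (y : V) :
    harnackConst γ A * csrwKernel c m t x₁ y ≤ csrwKernel c s t x₂ y := by
  have hD : 0 < T - s := sub_pos.2 hsT
  obtain ⟨e1, e2, e3, e4⟩ := harnack_scales hA hD
  obtain ⟨a1, a2, a3, a4⟩ := harnack_exponents hA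
  obtain ⟨hγI, hh⟩ := hγ _ _ _ _ a1 a2 a3 a4
  have hA0 : 0 < A := one_pos.trans_le hA
  have hR : 0 < A * Real.sqrt (T - s) := mul_pos hA0 (Real.sqrt_pos.2 hD)
  have h3 := hh (A * Real.sqrt (T - s)) T x₁ (fun r x => csrwKernel c r t x y) hR
    (by rw [e4]; linarith)
    (by rw [e4, sub_sub_cancel]; exact H.isSolution hsT.le hTt y x₁ _)
    (T - m) (T - s) (by rw [e1]; linarith) (by rw [e2]; linarith) (by rw [e3]; linarith)
    (by rw [e4]) x₁ (by simp only [gball, mem_ofPred_eq, gdist_self, Nat.cast_zero]; exact hR.le)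
    x₂ hx
  rw [sub_sub_cancel, sub_sub_cancel] at h3
  rw [harnackConst, if_pos hγI]
  exact h3

/-- A Harnack step per edge of a geodesic, with time step `δ` and look-ahead `2 δ ≥ 1`, so that
adjacent vertices are within the parabolic scale. The last factor is the probability of no arrival.
No ellipticity is needed. -/
theorem Environment.pow_le_csrwKernel (H : Environment E v Cv c) (hγ : HarnackCSRW E c γ)
    {t δ : ℝ} (hδ : 1 / 2 ≤ δ) (y : V) (k : ℕ) :
    ∀ (s : ℝ) (x : V), 0 ≤ s → gdist E x y = k → s + (k + 1) * δ ≤ t →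
      harnackConst γ 1 ^ k * Real.exp (-(t - s)) ≤ csrwKernel c s t x y := by
  induction k with
  | zero =>
    intro s x hs hx hst
    rw [(gdist_eq_zero (H.snap 0).connected).1 hx, pow_zero, one_mul]
    refine H.exp_neg_le_csrwKernel ?_ y
    rw [Nat.cast_zero, zero_add, one_mul] at hst
    linarith
  | succ k ih =>
    intro s x hs hx hst
    obtain ⟨w, _, hxw, hwy⟩ := exists_step (H.snap 0).connected (H.snap 0).edge_symm hx
    push_cast at hst
    have hkδ : 0 ≤ k * δ := by positivity
    have h1 := ih (s + δ) w (by linarith) hwy (by linarith)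
    have h2 := H.harnack hγ (A := 1) (s := s) (m := s + δ) (T := s + 2 * δ) (t := t) le_rfl hs
      (by linarith) (by linarith) (by linarith) (by linarith) (x₁ := w) (x₂ := x) (by
        rw [gdist_comm, hxw, Nat.cast_one, one_mul]
        exact Real.one_le_sqrt.2 (by linarith)) y
    refine le_trans ?_ h2
    rw [pow_succ', mul_assoc]
    refine mul_le_mul_of_nonneg_left (le_trans ?_ h1) (harnackConst_pos γ 1).le
    refine mul_le_mul_of_nonneg_left (Real.exp_le_exp.2 (by linarith))
      (pow_nonneg (harnackConst_pos γ 1).le k)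

/-- The time step is `(t - s) / (2 d)`, which is at least `1/2` because `d ≤ t - s`. -/
theorem Environment.exp_le_csrwKernel (H : Environment E v Cv c) (hγ : HarnackCSRW E c γ)
    {s t : ℝ} (hs : 0 ≤ s) (hst : s ≤ t) {x y : V} (hd : (gdist E x y : ℝ) ≤ t - s) :
    Real.exp (-((1 - Real.log (harnackConst γ 1)) * (1 + (t - s)))) ≤ csrwKernel c s t x y := by
  have hg := harnackConst_pos γ 1
  have hlog := Real.log_nonpos hg.le (harnackConst_le_one γ 1)
  set Λ := Real.log (harnackConst γ 1) with hΛ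
  have hτ : 0 ≤ t - s := sub_nonneg.2 hst
  have hΛτ : 0 ≤ -Λ * (t - s) := mul_nonneg (by linarith) hτ
  rcases Nat.eq_zero_or_pos (gdist E x y) with h0 | h0
  · rw [(gdist_eq_zero (H.snap 0).connected).1 h0]
    refine le_trans (Real.exp_le_exp.2 ?_) (H.exp_neg_le_csrwKernel hst y)
    linarith
  have hd1 : (1 : ℝ) ≤ gdist E x y := by exact_mod_cast h0
  have h1 := H.pow_le_csrwKernel hγ (t := t) (δ := (t - s) / (2 * gdist E x y)) (by
      rw [div_le_div_iff₀ two_pos (by positivity)]; linarith) y _ s x hs rfl (by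
      have h2 : ((gdist E x y : ℝ) + 1) * ((t - s) / (2 * gdist E x y)) ≤
          (2 * gdist E x y) * ((t - s) / (2 * gdist E x y)) :=
        mul_le_mul_of_nonneg_right (by linarith) (by positivity)
      have h3 : (2 * gdist E x y) * ((t - s) / (2 * gdist E x y)) = t - s := by field_simp
      linarith)
  refine le_trans ?_ h1
  have h2 : harnackConst γ 1 ^ gdist E x y = Real.exp (gdist E x y * Λ) := by
    rw [Real.exp_nat_mul, hΛ, Real.exp_log hg]
  rw [h2, ← Real.exp_add]
  refine Real.exp_le_exp.2 ?_
  have h3 : -Λ * gdist E x y ≤ -Λ * (t - s) := mul_le_mul_of_nonneg_left hd (by linarith)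
  linarith

theorem Environment.walkFamily {V : Type u} {E : V → V → Prop} {c : ℝ → V → V → ℝ}
    (H : Environment E v Cv c) {C : ℝ} (hC : 0 < C)
    (hU : UpperBoundCSRW E c v C) (hγ : HarnackCSRW E c γ) :
    WalkFamily (fun t : ℝ≥0 => (t : ℝ)) E v Cv C (1 / C) (1 - Real.log (harnackConst γ 1))
      (harnackConst γ) (fun t => c t) (fun s t => csrwKernel c s t) where
  e_mono s t hst := NNReal.coe_le_coe.2 hst
  split s t δ hst hδ0 hδ := by
    lift δ to ℝ≥0 using hδ0
    refine ⟨s + δ, le_self_add, ?_, ?_, ?_⟩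
    · rw [← NNReal.coe_le_coe, NNReal.coe_add]; linarith
    · rw [NNReal.coe_add]; linarith
    · rw [NNReal.coe_add]; linarith
  snap t := H.snap t
  nonneg s t hst := H.csrwKernel_nonneg (NNReal.coe_le_coe.2 hst)
  mass s t hst := H.sum_vertexCond_mul_csrwKernel_le (NNReal.coe_le_coe.2 hst)
  row s t hst := H.sum_csrwKernel_le (NNReal.coe_le_coe.2 hst)
  ck s m t hsm hmt := H.csrwKernel_le_tsum (NNReal.coe_le_coe.2 hsm) (NNReal.coe_le_coe.2 hmt)
  upper s t hst x y l _ hlC := by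
    have hst' : (s : ℝ) ≤ t := NNReal.coe_le_coe.2 hst
    have hv := (H.snap 0).v_pos (Real.sqrt_nonneg ((t : ℝ) - s))
    exact (hU s t x y s.2 hst').trans (mul_le_mul_of_nonneg_left
      (decayFactor_csrw_le_exp hC (sub_nonneg.2 hst') hlC) (by positivity))
  harnack A s m T t hA hsm hmT hTt hsT h1 h2 x₁ x₂ y hx _ :=
    H.harnack hγ hA s.2 (NNReal.coe_le_coe.2 hTt) hsT h1 h2 hx y
  crude s t hst x y hd := H.exp_le_csrwKernel hγ s.2 (NNReal.coe_le_coe.2 hst) hd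

end Continuous

theorem twoSided_csrw (C Cv : ℝ) (γ : ℝ → ℝ → ℝ → ℝ → ℝ) (hC : 0 < C) :
    ∃ Cstar : ℝ, 0 < Cstar ∧
      ∀ (V : Type u) (E : V → V → Prop) (c : ℝ → V → V → ℝ) (v : ℝ → ℝ),
        StandingCSRW E c v Cv → UpperBoundCSRW E c v C → HarnackCSRW E c γ →
        TwoSidedCSRW E c v Cstar := by
  have hlog := Real.log_nonpos (harnackConst_pos γ 1).le (harnackConst_le_one γ 1)
  obtain ⟨Cs, hCs, hb⟩ := family_twoSided.{u, 0} Cv C (1 / C)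
    (1 - Real.log (harnackConst γ 1)) (harnackConst γ) hC (by positivity) (by linarith)
    (fun A _ => harnackConst_pos γ A) (harnackConst_le_one γ 1)
  refine ⟨Cs, hCs, fun V E c v hst hU hγ s t y hs hst' => ?_⟩
  have H := hst.environment
  have hmax : ∀ ξ : ℝ, 0 ≤ ξ → c ξ = c (max ξ 0) := fun ξ hξ => by rw [max_eq_left hξ]
  have F := H.walkFamily (γ := γ) hC (fun s t x y hs hst => by
    rw [← csrwKernel_max c hs hst]; exact hU s t x y hs hst) (hγ.congr hmax)
  lift s to ℝ≥0 using hs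
  lift t to ℝ≥0 using s.2.trans hst'
  have hst0 : s ≤ t := NNReal.coe_le_coe.1 hst'
  have hK : ∀ x, csrwKernel (fun t => c (max t 0)) s t x y = csrwKernel c s t x y := fun x =>
    (csrwKernel_max c s.2 hst' x y).symm
  have hc : c (max (s : ℝ) 0) = c s := (hmax s s.2).symm
  constructor
  · have := F.summable_mass hst0 y
    simpa only [hK, hc] using this
  · intro x hd
    have h1 := hb V ℝ≥0 _ E v _ _ F s t hst0 x y hd
    simpa only [evolMeasure, hK, hc] using h1

section Discrete

variable {V : Type*} {E : V → V → Prop} {v : ℝ → ℝ} {Cv : ℝ} {c : ℕ → V → V → ℝ}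

theorem sum_vertexCond_mul_dtrwSteps_le (hS : ∀ i, Snapshot E v Cv (c i))
    (hm : ∀ x, Monotone fun i => vertexCond (c i) x) (n : ℕ) :
    ∀ (s : ℕ) (X : Finset V) (z : V),
      ∑ x ∈ X, vertexCond (c s) x * dtrwSteps c n s x z ≤ vertexCond (c (s + n)) z := by
  induction n with
  | zero =>
    intro s X z
    classical
    simp only [dtrwSteps, mul_ite, mul_one, mul_zero]
    rw [Finset.sum_ite_eq']
    split_ifs
    · exact le_rfl
    · exact ((hS s).vertexCond_pos z).le
  | succ n ih =>
    intro s X z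
    have h1 := (hS (s + 1)).sum_vertexCond_mul_stepMean_le
      (fun y => dtrwSteps_nonneg hS n (s + 1) y z) (fun Y => ih (s + 1) Y z) X
    rw [show s + (n + 1) = s + 1 + n by omega]
    refine le_trans (Finset.sum_le_sum fun x _ => ?_) h1
    exact mul_le_mul_of_nonneg_right (hm x (Nat.le_succ s))
      ((hS (s + 1)).stepMean_nonneg (fun y => dtrwSteps_nonneg hS n (s + 1) y z) x)

theorem dtrwSteps_le_one (hS : ∀ i, Snapshot E v Cv (c i)) (n s : ℕ) (x z : V) :
    dtrwSteps c n s x z ≤ 1 := by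
  simpa using sum_dtrwSteps_le_one hS n s x {z}

/-- The walk follows a geodesic when it has no time to spare and stays put otherwise; each of these
moves has probability at least `α`. -/
theorem pow_le_dtrwSteps (hS : ∀ i, Snapshot E v Cv (c i)) {α : ℝ} (hα : 0 < α)
    (hl : ∀ i x, α ≤ stepKernel (c i) x x) (he : ∀ i x y, E x y → α ≤ stepKernel (c i) x y)
    (y : V) (n : ℕ) : ∀ (s : ℕ) (x : V), gdist E x y ≤ n → α ^ n ≤ dtrwSteps c n s x y := by
  induction n with
  | zero =>
    intro s x h
    rw [(gdist_eq_zero (hS 0).connected).1 (Nat.le_zero.1 h), dtrwSteps_zero_self, pow_zero]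
  | succ n ih =>
    intro s x h
    have key : ∀ w, gdist E w y ≤ n → α ≤ stepKernel (c (s + 1)) x w →
        α ^ (n + 1) ≤ dtrwSteps c (n + 1) s x y := by
      intro w hw hαw
      -- A positive transition probability forces an edge, also for the loop at `x`.
      have hE : E x w := by
        by_contra hE
        rw [(hS (s + 1)).stepKernel_zero hE] at hαw
        linarith
      rw [dtrwSteps_succ hS, pow_succ']
      refine le_trans (mul_le_mul hαw (ih (s + 1) w hw) (by positivity)
        ((hS _).stepKernel_nonneg _ _)) ?_
      exact Finset.single_le_sum
        (f := fun w => stepKernel (c (s + 1)) x w * dtrwSteps c n (s + 1) w y)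
        (fun w _ => mul_nonneg ((hS _).stepKernel_nonneg _ _) (dtrwSteps_nonneg hS _ _ _ _))
        ((hS _).mem_nbrs.2 hE)
    rcases h.eq_or_lt with h1 | h1
    · obtain ⟨w, hE, _, hwy⟩ := exists_step (hS 0).connected (hS 0).edge_symm h1
      exact key w hwy.le (he _ _ _ hE)
    · exact key x (by omega) (hl _ _)

variable {γ : ℝ → ℝ → ℝ → ℝ → ℝ}

theorem dtrw_harnack (hS : ∀ i, Snapshot E v Cv (c i)) (hγ : HarnackDTRW E c γ) {A : ℝ}
    {s m T t : ℕ} (hA : 1 ≤ A) (hsm : s ≤ m) (hmT : m ≤ T) (hTt : T ≤ t) (hsT : (s : ℝ) < T)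
    (h1 : 1 / 8 * ((T : ℝ) - s) ≤ T - m) (h2 : (T : ℝ) - m ≤ 3 / 4 * (T - s)) {x₁ x₂ : V}
    (hx : (gdist E x₁ x₂ : ℝ) ≤ A * Real.sqrt (T - s)) (hxm : (gdist E x₁ x₂ : ℝ) ≤ m - s)
    (y : V) : harnackConst γ A * dtrwKernel c m t x₁ y ≤ dtrwKernel c s t x₂ y := by
  have hD : 0 < (T : ℝ) - s := sub_pos.2 hsT
  obtain ⟨e1, e2, e3, e4⟩ := harnack_scales hA hD
  obtain ⟨a1, a2, a3, a4⟩ := harnack_exponents hA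
  obtain ⟨hγI, hh⟩ := hγ _ _ _ _ a1 a2 a3 a4
  have hA0 : 0 < A := one_pos.trans_le hA
  have hR : 0 < A * Real.sqrt (T - s) := mul_pos hA0 (Real.sqrt_pos.2 hD)
  have hxm' : gdist E x₁ x₂ ≤ m - s := by
    rw [← Nat.cast_sub hsm] at hxm
    exact_mod_cast hxm
  have c1 : ((T - m : ℕ) : ℝ) = T - m := Nat.cast_sub hmT
  have c2 : ((T - s : ℕ) : ℝ) = T - s := Nat.cast_sub (hsm.trans hmT)
  have hsol : IsSolutionDTRW E c ((T : ℝ) - (1 / A * (A * Real.sqrt (T - s))) ^ 2) T x₁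
      (8 * (A * Real.sqrt (T - s))) (fun r x => dtrwKernel c r t x y) := by
    constructor
    · intro r _ _ x
      exact dtrwSteps_nonneg hS _ _ _ _
    · intro r _ hr x _
      have hr' : r + 1 ≤ T := by exact_mod_cast hr
      simp only [dtrwKernel]
      rw [show t - r = (t - (r + 1)) + 1 by omega]
      rfl
  have h3 := hh (A * Real.sqrt (T - s)) T x₁ (fun r x => dtrwKernel c r t x y) hR
    (by rw [e4]; linarith [Nat.cast_nonneg (α := ℝ) s]) hsol
    (T - m) (T - s) (by rw [e1, c1]; linarith) (by rw [e2, c1]; linarith)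
    (by rw [e3, c2]; linarith)
    (by rw [e4, c2]) x₁ (by simp only [gball, mem_ofPred_eq, gdist_self, Nat.cast_zero]; exact hR.le)
    x₂ hx (by omega)
  rw [show T - (T - m) = m by omega, show T - (T - s) = s by omega] at h3
  rw [harnackConst, if_pos hγI]
  exact h3

theorem dtrw_walkFamily {V : Type u} {E : V → V → Prop} {c : ℕ → V → V → ℝ}
    (hS : ∀ i, Snapshot E v Cv (c i)) (hm : ∀ x, Monotone fun i => vertexCond (c i) x)
    {C α : ℝ} (hC : 0 < C) (hα : 0 < α) (hl : ∀ i x, α ≤ stepKernel (c i) x x)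
    (he : ∀ i x y, E x y → α ≤ stepKernel (c i) x y)
    (hU : UpperBoundDTRW E c v C) (hγ : HarnackDTRW E c γ) :
    WalkFamily (fun t : ℕ => (t : ℝ)) E v Cv C (1 / C) |Real.log α|
      (harnackConst γ) c (dtrwKernel c) where
  e_mono s t hst := Nat.cast_le.2 hst
  split s t δ hst hδ0 hδ := by
    have h1 := Nat.floor_le hδ0
    refine ⟨s + ⌊δ⌋₊, le_self_add, ?_, ?_, ?_⟩
    · have : ((s + ⌊δ⌋₊ : ℕ) : ℝ) ≤ t := by push_cast; linarith
      exact_mod_cast this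
    · have := Nat.lt_floor_add_one δ
      push_cast; linarith
    · push_cast; linarith
  snap := hS
  nonneg s t _ := dtrwSteps_nonneg hS _ s
  mass s t hst X y := by
    have := sum_vertexCond_mul_dtrwSteps_le hS hm (t - s) s X y
    rwa [Nat.add_sub_cancel' hst] at this
  row s t _ := sum_dtrwSteps_le_one hS _ s
  ck s m t hsm hmt x z := by
    have h1 := dtrwSteps_add hS (m - s) (t - m) s x z ((hS 0).ball x (m - s : ℕ)) fun y hy =>
      (hS 0).mem_ball.2 (by exact_mod_cast hy)
    rw [Nat.add_sub_cancel' hsm, show m - s + (t - m) = t - s by omega] at h1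
    have h0 : ∀ y, 0 ≤ dtrwKernel c s m x y * dtrwKernel c m t y z := fun y =>
      mul_nonneg (dtrwSteps_nonneg hS _ _ _ _) (dtrwSteps_nonneg hS _ _ _ _)
    rw [dtrwKernel, h1]
    refine (summable_of_sum_le (c := 1) h0 fun Y => ?_).sum_le_tsum _ fun y _ => h0 y
    exact (Finset.sum_le_sum fun y _ => mul_le_of_le_one_right (dtrwSteps_nonneg hS _ _ _ _)
      (dtrwSteps_le_one hS _ _ _ _)).trans (sum_dtrwSteps_le_one hS _ s x Y)
  upper s t hst x y l _ hlC := by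
    have hst' : (s : ℝ) ≤ t := Nat.cast_le.2 hst
    have hv := (hS 0).v_pos (Real.sqrt_nonneg ((t : ℝ) - s))
    exact (hU s t x y hst).trans (mul_le_mul_of_nonneg_left
      (decayFactor_dtrw_le_exp hC (sub_nonneg.2 hst') hlC) (by positivity))
  harnack A s m T t hA hsm hmT hTt hsT h1 h2 x₁ x₂ y hx hxm :=
    dtrw_harnack hS hγ hA hsm hmT hTt hsT h1 h2 hx hxm y
  crude s t hst x y hd := by
    rw [← Nat.cast_sub hst] at hd ⊢
    refine le_trans ?_ (pow_le_dtrwSteps hS hα hl he y (t - s) s x (by exact_mod_cast hd))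
    have h2 : α ^ (t - s) = Real.exp ((t - s : ℕ) * Real.log α) := by
      rw [Real.exp_nat_mul, Real.exp_log hα]
    rw [h2]
    refine Real.exp_le_exp.2 ?_
    have h3 := neg_abs_le (Real.log α)
    have h4 := abs_nonneg (Real.log α)
    have h5 := mul_le_mul_of_nonneg_left h3 (Nat.cast_nonneg (α := ℝ) (t - s))
    linarith

end Discrete

theorem twoSided_dtrw (C Cv α : ℝ) (γ : ℝ → ℝ → ℝ → ℝ → ℝ) (hC : 0 < C) (hα : 0 < α) :
    ∃ Cstar : ℝ, 0 < Cstar ∧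
      ∀ (V : Type u) (E : V → V → Prop) (c : ℕ → V → V → ℝ) (v : ℝ → ℝ),
        StandingDTRW E c v Cv α → UniformlyElliptic E c α → UpperBoundDTRW E c v C →
        HarnackDTRW E c γ → TwoSidedDTRW E c v Cstar := by
  obtain ⟨Cs, hCs, hb⟩ := family_twoSided.{u, 0} Cv C (1 / C) |Real.log α| (harnackConst γ) hC
    (by positivity) (abs_nonneg _) (fun A _ => harnackConst_pos γ A) (harnackConst_le_one γ 1)
  refine ⟨Cs, hCs, fun V E c v hst he hU hγ s t y hst' => ?_⟩
  have F := dtrw_walkFamily (γ := γ)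
    (fun i => snapshot_of_network hst.network hst.growth (Nat.zero_le i))
    (fun x i j hij => hst.monotone x (mem_Ici.2 (Nat.zero_le i)) (mem_Ici.2 (Nat.zero_le j)) hij)
    hC hα (fun i => hst.lazy i (Nat.zero_le i)) (fun i => he i (Nat.zero_le i)) hU hγ
  exact ⟨F.summable_mass hst' y, fun x hd => hb V ℕ _ E v _ _ F s t hst' x y hd⟩

end TimeVaryingWalk

theorem mainTheorem2 :
    -- (a), constant speed random walk
    (∀ CP Cv : ℝ, ∃ C : ℝ, 0 < C ∧
      ∀ (V : Type*) (E : V → V → Prop) (c : ℝ → V → V → ℝ) (v : ℝ → ℝ),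
        TimeVaryingWalk.StandingCSRW E c v Cv →
        TimeVaryingWalk.UniformPoincare E c CP →
        TimeVaryingWalk.UpperBoundCSRW E c v C) ∧
    -- (a), uniformly lazy discrete time random walk
    (∀ CP Cv αl : ℝ, 0 < αl → ∃ C : ℝ, 0 < C ∧
      ∀ (V : Type*) (E : V → V → Prop) (c : ℕ → V → V → ℝ) (v : ℝ → ℝ),
        TimeVaryingWalk.StandingDTRW E c v Cv αl →
        TimeVaryingWalk.UniformPoincare E c CP →
        TimeVaryingWalk.UpperBoundDTRW E c v C) ∧
    -- (b), constant speed random walk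
    (∀ (C Cv : ℝ) (γ : ℝ → ℝ → ℝ → ℝ → ℝ), 0 < C → ∃ Cstar : ℝ, 0 < Cstar ∧
      ∀ (V : Type*) (E : V → V → Prop) (c : ℝ → V → V → ℝ) (v : ℝ → ℝ),
        TimeVaryingWalk.StandingCSRW E c v Cv →
        TimeVaryingWalk.UpperBoundCSRW E c v C →
        TimeVaryingWalk.HarnackCSRW E c γ →
        TimeVaryingWalk.TwoSidedCSRW E c v Cstar) ∧
    -- (b), uniformly elliptic and uniformly lazy discrete time random walk
    (∀ (C Cv α : ℝ) (γ : ℝ → ℝ → ℝ → ℝ → ℝ), 0 < C → 0 < α → ∃ Cstar : ℝ, 0 < Cstar ∧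
      ∀ (V : Type*) (E : V → V → Prop) (c : ℕ → V → V → ℝ) (v : ℝ → ℝ),
        TimeVaryingWalk.StandingDTRW E c v Cv α →
        TimeVaryingWalk.UniformlyElliptic E c α →
        TimeVaryingWalk.UpperBoundDTRW E c v C →
        TimeVaryingWalk.HarnackDTRW E c γ →
        TimeVaryingWalk.TwoSidedDTRW E c v Cstar) := by
  exact ⟨TimeVaryingWalk.upperBound_csrw, TimeVaryingWalk.upperBound_dtrw,
    TimeVaryingWalk.twoSided_csrw, TimeVaryingWalk.twoSided_dtrw⟩
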